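/- Consider a unit-cost word-RAM with words of $w$ bits (additions, truncated subtractions, multiplications, divisions with remainder, comparisons, indirect reads and writes; all values are non-negative integers below $2^w$ and no overflow may occur). For a string $S=S[1]\cdots S[n]$ over the alphabet $\{0,\dots,\sigma-1\}$ and a table $M$ that assigns an integer to every symbol of the alphabet, let $S^M=M(S[1])\cdots M(S[n])$, and let $S^M_h=M(S[h])\cdots M(S[n])$ be the $h$-th suffix of $S^M$. There are a preprocessing program, a sorting program and a constant $K_0$ such that for every constant $C$ there are constants $c,K$ with the following property. Let $S$ be a string of length $n$ over $\{0,\dots,\sigma-1\}$ and let $w\ge c\,(\lfloor\log_2 (n+\sigma)\rfloor+1)$ (where $\lfloor\log_2 0\rfloor$ is read as $0$). 1. Given $S$, $n$ and $\sigma$ (but no $i,j,M$), the preprocessing program halts after at most $K_0\,(n+\sigma+1)$ steps; this is $O(n)$ if $\sigma=O(n)$. 2. After that, any number of sorting requests may be served one after the other. A request consists of positions $1\le i\le j\le n$ and a table $M$, stored in memory with entries below $2^w$, that maps distinct symbols occurring in $S$ to distinct integers and maps every symbol occurring in $S[i],\dots,S[j]$ to an integer in $\{0,\dots,C\,(j-i+1)-1\}$;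 $M$ need not respect the order of the symbols. On such a request the sorting program halts after at most $K\,(j-i+1)$ steps, that is, in $O(j-i+1)$ time independently of $n$ and $\sigma$, and it outputs the positions $i,\dots,j$ arranged in the strictly increasing lexicographic order of the remapped suffixes $S^M_i,\dots,S^M_j$ (a proper prefix of a string being smaller than the string). -/

import Mathlib

/-! A word-RAM with a step count.  Programs are written in structured form.  The store consists of
registers and of arrays; a program mentions only finitely many of each, so the arrays may be thought
of as interleaved in one random-access memory.  Every value held by the machine is a natural number
below the word bound `W`, and every primitive operation costs one step. -/
namespace WordRAM

/-- The contents of the registers (`reg x`) and of the arrays (`mem a k` is cell `k` of array `a`). -/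
structure State where
  reg : ℕ → ℕ
  mem : ℕ → ℕ → ℕ

/-- The binary word operations. -/
inductive Op where
  | add | sub | mul | div | mod | lt | eq

/-- Subtraction is truncated at `0`, division rounds down (with `x / 0 = 0` and `x % 0 = x`), and a
comparison returns `1` for true and `0` for false. -/
def Op.eval : Op → ℕ → ℕ → ℕ
  | .add, x, y => x + y
  | .sub, x, y => x - y
  | .mul, x, y => x * y
  | .div, x, y => x / y
  | .mod, x, y => x % y
  | .lt, x, y => if x < y then 1 else 0
  | .eq, x, y => if x = y then 1 else 0

/-- Expressions: constants, registers, array reads, word operations. -/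
inductive Expr where
  | const (k : ℕ)
  | reg (x : ℕ)
  | read (a : ℕ) (idx : Expr)
  | bin (o : Op) (e₁ e₂ : Expr)

/-- `e.Eval W s v`: on store `s`, the expression `e` evaluates to `v` without overflow, that is, all
values that occur during the evaluation are below `W`. -/
inductive Expr.Eval (W : ℕ) (s : State) : Expr → ℕ → Prop where
  | const {k : ℕ} : k < W → Expr.Eval W s (.const k) k
  | reg {x : ℕ} : s.reg x < W → Expr.Eval W s (.reg x) (s.reg x)
  | read {a k : ℕ} {idx : Expr} :
      Expr.Eval W s idx k → s.mem a k < W → Expr.Eval W s (.read a idx) (s.mem a k)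
  | bin {o : Op} {e₁ e₂ : Expr} {v₁ v₂ : ℕ} :
      Expr.Eval W s e₁ v₁ → Expr.Eval W s e₂ v₂ → o.eval v₁ v₂ < W →
      Expr.Eval W s (.bin o e₁ e₂) (o.eval v₁ v₂)

/-- The number of steps that the evaluation of an expression takes. -/
def Expr.cost : Expr → ℕ
  | .const _ => 1
  | .reg _ => 1
  | .read _ idx => idx.cost + 1
  | .bin _ e₁ e₂ => e₁.cost + e₂.cost + 1

/-- Programs. -/
inductive Prog where
  | skip
  | assign (x : ℕ) (e : Expr)
  | store (a : ℕ) (idx e : Expr)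
  | seq (p q : Prog)
  | cond (e : Expr) (p q : Prog)
  | loop (e : Expr) (p : Prog)

/-- `s` with register `x` set to `v`. -/
def State.setReg (s : State) (x v : ℕ) : State :=
  { s with reg := Function.update s.reg x v }

/-- `s` with cell `k` of array `a` set to `v`. -/
def State.setMem (s : State) (a k v : ℕ) : State :=
  { s with mem := Function.update s.mem a (Function.update (s.mem a) k v) }

/-- `Exec W p s t s'`: with word bound `W`, the program `p` started on store `s` halts after exactly
`t` steps with store `s'`, and no overflow occurs.  A test succeeds if its value is not `0`. -/
inductive Exec (W : ℕ) : Prog → State → ℕ → State → Prop where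
  | skip {s : State} : Exec W .skip s 1 s
  | assign {s : State} {x : ℕ} {e : Expr} {v : ℕ} :
      e.Eval W s v → Exec W (.assign x e) s (e.cost + 1) (s.setReg x v)
  | store {s : State} {a : ℕ} {idx e : Expr} {k v : ℕ} :
      idx.Eval W s k → e.Eval W s v →
      Exec W (.store a idx e) s (idx.cost + e.cost + 1) (s.setMem a k v)
  | seq {p q : Prog} {s s₁ s₂ : State} {t₁ t₂ : ℕ} :
      Exec W p s t₁ s₁ → Exec W q s₁ t₂ s₂ → Exec W (.seq p q) s (t₁ + t₂) s₂
  | cond_true {e : Expr} {p q : Prog} {s s' : State} {v t : ℕ} :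
      e.Eval W s v → v ≠ 0 → Exec W p s t s' → Exec W (.cond e p q) s (e.cost + 1 + t) s'
  | cond_false {e : Expr} {p q : Prog} {s s' : State} {t : ℕ} :
      e.Eval W s 0 → Exec W q s t s' → Exec W (.cond e p q) s (e.cost + 1 + t) s'
  | loop_done {e : Expr} {p : Prog} {s : State} :
      e.Eval W s 0 → Exec W (.loop e p) s (e.cost + 1) s
  | loop_step {e : Expr} {p : Prog} {s s₁ s₂ : State} {v t₁ t₂ : ℕ} :
      e.Eval W s v → v ≠ 0 → Exec W p s t₁ s₁ → Exec W (.loop e p) s₁ t₂ s₂ →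
      Exec W (.loop e p) s (e.cost + 1 + t₁ + t₂) s₂

end WordRAM

namespace SuffixSorting

open WordRAM

/-- The start of the preprocessing of a string `S` over the alphabet `{0, …, σ - 1}`: register `0`
holds the length of `S`, register `1` holds `σ`, array `0` holds `S`, all the rest is zero. -/
def inputState (S : List ℕ) (σ : ℕ) : State where
  reg x := if x = 0 then S.length else if x = 1 then σ else 0
  mem a k := if a = 0 then S.getD k 0 else 0

/-- Passing a sorting request to the machine in store `s`: register `0` receives `i`, register `1`
receives `j`, the first `σ` cells of array `1` receive the table `M`, and the rest of the store is
left as it is. -/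
def requestState (s : State) (σ i j : ℕ) (M : ℕ → ℕ) : State where
  reg x := if x = 0 then i else if x = 1 then j else s.reg x
  mem a k := if a = 1 ∧ k < σ then M k else s.mem a k

/-- The first `m` cells of array `2`, where the answer to a request is expected. -/
def output (s : State) (m : ℕ) : List ℕ :=
  (List.range m).map (s.mem 2)

/-- The string `S` with its symbols replaced according to the table `M`. -/
def remap (M : ℕ → ℕ) (S : List ℕ) : List ℕ :=
  S.map M

/-- An admissible request (positions are counted from `0`): a contiguous range `i, …, j` of positions
of `S`, and a table `M` with entries below `W` that maps distinct symbols of `S` to distinct integers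
and the symbols occurring in `S[i], …, S[j]` to the first `C * (j - i + 1)` integers. -/
structure Admissible (W C σ : ℕ) (S : List ℕ) (i j : ℕ) (M : ℕ → ℕ) : Prop where
  le : i ≤ j
  lt_length : j < S.length
  entry_lt : ∀ a < σ, M a < W
  injOn : Set.InjOn M {a | a ∈ S}
  small : ∀ p, i ≤ p → p ≤ j → M (S.getD p 0) < C * (j - i + 1)

/-- `out` lists the positions `i, …, j` in the strict lexicographic order of the suffixes of `T` that
start there (a proper prefix of a string is smaller than the string). -/
def IsSortedSuffixes (T : List ℕ) (i j : ℕ) (out : List ℕ) : Prop :=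
  out.Perm (List.range' i (j - i + 1)) ∧ out.Pairwise (fun p q => T.drop p < T.drop q)

end SuffixSorting

/-! Injectivity of the table on the symbols of S leaves the length L of the longest common prefix of
two suffixes unchanged; only the comparison of the two symbols after it depends on M. So S is
prepared once for constant-time common-prefix queries. Its suffix array is built by the linear-time
"skew" recursion on the positions not divisible by 3 (`suffixArray_run`), the common prefixes of
neighbours are computed by Kasai's algorithm (`kasai_run`), and a linear-size structure answers
range minimum queries over them in constant time (`rmqBuild_run`, `rmqQuery_run`). By `lce_of_isMin`
such a minimum is the common-prefix length of the two suffixes at the ends of the range.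

For a request, put U = S^M. Every suffix of U starting in the window i, …, j is compared with the
one suffix at j, in constant time each (`compareSuffix_run`). The result is a digit: 0 for smaller,
1 for the suffix at j itself, 2 for greater. The symbol U[k] is replaced by T[k] = 3 U[k] + digit.
Digit 1 makes the last symbol of T unique, and the order of the suffixes of the short string T is
that of the full suffixes of U (`Refines.drop_lt`). Indeed, at the first mismatch of T either the
symbols of U differ, or they agree and the digits differ, in which case the suffix at j separates
the two suffixes starting there (or is one of them); before the mismatch U agrees. As T has length m
+ 1 with m = j - i and symbols below 3C(m+1), the same suffix array program sorts it in O(m+1) time.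

Strings are functions on all of ℕ with a length N, and `UniqLast` (the last symbol occurs once)
plays the part of a sentinel: equal symbols at different positions never include the last position,
so every comparison is decided inside the string, whatever the memory behind it contains. The
property holds for S with a sentinel, for the refined window T, and passes to the string of names in
the recursion.

Time is counted in loop iterations: `Run` bounds the steps by a constant depending on the program
text alone, times the iterations plus one. `run_while` and `run_for` supply invariants together with
an amortising potential. -/

/-! ### Reasoning about word-RAM programs -/
namespace WordRAM

variable {W : ℕ}

/-- The value of an expression. -/
def Expr.val (s : State) : Expr → ℕ
  | .const k => k
  | .reg x => s.reg x
  | .read a e => s.mem a (e.val s)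
  | .bin o e f => o.eval (e.val s) (f.val s)

/-- The overflow condition of a word operation on words. -/
def Op.Safe (W : ℕ) : Op → ℕ → ℕ → Prop
  | .add, x, y => x + y < W
  | .mul, x, y => x * y < W
  | _, _, _ => True

/-- The overflow condition of an expression on a store that holds words only. -/
def Expr.Safe (W : ℕ) (s : State) : Expr → Prop
  | .const k => k < W
  | .reg _ => True
  | .read _ e => e.Safe W s
  | .bin o e f => e.Safe W s ∧ f.Safe W s ∧ o.Safe W (e.val s) (f.val s)

/-- The store holds words only. -/
structure Bdd (W : ℕ) (s : State) : Prop where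
  one_lt : 1 < W
  reg : ∀ x, s.reg x < W
  mem : ∀ a k, s.mem a k < W

theorem Op.eval_lt {o : Op} {x y : ℕ} (h1 : 1 < W) (hx : x < W) (h : o.Safe W x y) :
    o.eval x y < W := by
  cases o <;> simp only [Op.eval, Op.Safe] at *
  · exact h
  · omega
  · exact h
  · exact (Nat.div_le_self _ _).trans_lt hx
  · exact (Nat.mod_le _ _).trans_lt hx
  all_goals split_ifs <;> omega

/-- Once all stored values are words, only constants, sums and products can overflow; every other
operation returns a word automatically. This reduces the obligations to a few inequalities. -/
theorem Expr.Safe.eval {s : State} (hb : Bdd W s) : ∀ {e : Expr}, e.Safe W s →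
    e.val s < W ∧ e.Eval W s (e.val s)
  | .const _, h => ⟨h, .const h⟩
  | .reg x, _ => ⟨hb.reg x, .reg (hb.reg x)⟩
  | .read a e, h => ⟨hb.mem _ _, .read (Expr.Safe.eval hb (e := e) h).2 (hb.mem _ _)⟩
  | .bin o e f, h =>
    have he := Expr.Safe.eval hb (e := e) h.1
    have hf := Expr.Safe.eval hb (e := f) h.2.1
    have := Op.eval_lt hb.one_lt he.1 h.2.2
    ⟨this, .bin he.2 hf.2 this⟩

theorem Expr.Eval.lt {s : State} {e : Expr} {v : ℕ} (h : e.Eval W s v) : v < W := by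
  cases h <;> assumption

/-! ### Notation -/

/-- Constants. -/
abbrev C (k : ℕ) : Expr := .const k
/-- Registers. -/
abbrev V (x : ℕ) : Expr := .reg x
/-- Array cells. -/
abbrev Rd (a : ℕ) (e : Expr) : Expr := .read a e

instance : Add Expr := ⟨.bin .add⟩
instance : Sub Expr := ⟨.bin .sub⟩
instance : Mul Expr := ⟨.bin .mul⟩
instance : Div Expr := ⟨.bin .div⟩
instance : Mod Expr := ⟨.bin .mod⟩

/-- Comparison. -/
def Expr.less (e f : Expr) : Expr := .bin .lt e f
/-- Equality test. -/
def Expr.equal (e f : Expr) : Expr := .bin .eq e f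

/-- Comparison of the values of two expressions. -/
infix:50 " ≺ₑ " => Expr.less
/-- Equality test on two expressions. -/
infix:50 " ≡ₑ " => Expr.equal
/-- Assignment of an expression to a register. -/
infix:45 " ≔ " => Prog.assign
/-- Sequential composition of programs. -/
infixr:40 " ⨾ " => Prog.seq

section simps

variable (s : State) (e f : Expr) (k x a : ℕ)

@[simp] theorem val_C : (C k).val s = k := rfl
@[simp] theorem val_V : (V x).val s = s.reg x := rfl
@[simp] theorem val_Rd : (Rd a e).val s = s.mem a (e.val s) := rfl
@[simp] theorem val_add : (e + f).val s = e.val s + f.val s := rfl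
@[simp] theorem val_sub : (e - f).val s = e.val s - f.val s := rfl
@[simp] theorem val_mul : (e * f).val s = e.val s * f.val s := rfl
@[simp] theorem val_div : (e / f).val s = e.val s / f.val s := rfl
@[simp] theorem val_mod : (e % f).val s = e.val s % f.val s := rfl
@[simp] theorem val_less : (e ≺ₑ f).val s = if e.val s < f.val s then 1 else 0 := rfl
@[simp] theorem val_equal : (e ≡ₑ f).val s = if e.val s = f.val s then 1 else 0 := rfl
@[simp] theorem safe_C : (C k).Safe W s ↔ k < W := Iff.rfl
@[simp] theorem safe_V : (V x).Safe W s := trivial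
@[simp] theorem safe_Rd : (Rd a e).Safe W s ↔ e.Safe W s := Iff.rfl
@[simp] theorem safe_add :
    (e + f).Safe W s ↔ e.Safe W s ∧ f.Safe W s ∧ e.val s + f.val s < W := Iff.rfl
@[simp] theorem safe_sub : (e - f).Safe W s ↔ e.Safe W s ∧ f.Safe W s :=
  ⟨fun h => ⟨h.1, h.2.1⟩, fun h => ⟨h.1, h.2, trivial⟩⟩
@[simp] theorem safe_mul :
    (e * f).Safe W s ↔ e.Safe W s ∧ f.Safe W s ∧ e.val s * f.val s < W := Iff.rfl
@[simp] theorem safe_div : (e / f).Safe W s ↔ e.Safe W s ∧ f.Safe W s :=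
  ⟨fun h => ⟨h.1, h.2.1⟩, fun h => ⟨h.1, h.2, trivial⟩⟩
@[simp] theorem safe_mod : (e % f).Safe W s ↔ e.Safe W s ∧ f.Safe W s :=
  ⟨fun h => ⟨h.1, h.2.1⟩, fun h => ⟨h.1, h.2, trivial⟩⟩
@[simp] theorem safe_less : (e ≺ₑ f).Safe W s ↔ e.Safe W s ∧ f.Safe W s :=
  ⟨fun h => ⟨h.1, h.2.1⟩, fun h => ⟨h.1, h.2, trivial⟩⟩
@[simp] theorem safe_equal : (e ≡ₑ f).Safe W s ↔ e.Safe W s ∧ f.Safe W s :=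
  ⟨fun h => ⟨h.1, h.2.1⟩, fun h => ⟨h.1, h.2, trivial⟩⟩

variable (v y b : ℕ)

@[simp] theorem setReg_reg : (s.setReg x v).reg y = if y = x then v else s.reg y := by
  simp [State.setReg, Function.update_apply]
@[simp] theorem setReg_mem : (s.setReg x v).mem = s.mem := rfl
@[simp] theorem setMem_reg : (s.setMem a k v).reg = s.reg := rfl
@[simp] theorem setMem_mem :
    (s.setMem a k v).mem b = if b = a then Function.update (s.mem a) k v else s.mem b := by
  simp only [State.setMem, Function.update_apply]

end simps

/-! ### Frames -/

/-- Whether a program may write the register `x`. -/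
def Prog.wr (x : ℕ) : Prog → Bool
  | .skip => false
  | .assign y _ => Nat.beq x y
  | .store _ _ _ => false
  | .seq p q => p.wr x || q.wr x
  | .cond _ p q => p.wr x || q.wr x
  | .loop _ p => p.wr x

/-- Whether a program may write the array `a`. -/
def Prog.wm (a : ℕ) : Prog → Bool
  | .skip => false
  | .assign _ _ => false
  | .store b _ _ => Nat.beq a b
  | .seq p q => p.wm a || q.wm a
  | .cond _ p q => p.wm a || q.wm a
  | .loop _ p => p.wm a

/-- `s'` agrees with `s` on all that `p` does not write. -/
structure Fr (p : Prog) (s s' : State) : Prop where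
  reg : ∀ x, p.wr x = false → s'.reg x = s.reg x
  mem : ∀ a, p.wm a = false → s'.mem a = s.mem a

theorem Fr.refl (p : Prog) (s : State) : Fr p s s := ⟨fun _ _ => rfl, fun _ _ => rfl⟩

theorem Fr.trans {p : Prog} {s s' s'' : State} (h : Fr p s s') (h' : Fr p s' s'') : Fr p s s'' :=
  ⟨fun x hx => (h'.reg x hx).trans (h.reg x hx), fun a ha => (h'.mem a ha).trans (h.mem a ha)⟩

theorem Fr.mono {p q : Prog} {s s' : State} (h : Fr p s s')
    (hr : ∀ x, q.wr x = false → p.wr x = false) (hm : ∀ a, q.wm a = false → p.wm a = false) :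
    Fr q s s' :=
  ⟨fun x hx => h.reg x (hr x hx), fun a ha => h.mem a (hm a ha)⟩

/-- `Prog.wr` and `Prog.wm` are computable Boolean functions, so for a concrete program the
statement that a register or array is untouched is closed by `rfl`. This replaces explicit frame
conditions in all later specifications. -/
theorem Exec.frame {p : Prog} {s s' : State} {t : ℕ} (h : Exec W p s t s') : Fr p s s' := by
  induction h with
  | skip => exact Fr.refl _ _
  | assign _ =>
    refine ⟨fun y hy => ?_, fun _ _ => rfl⟩
    simp only [Prog.wr] at hy
    simp [Nat.ne_of_beq_eq_false hy]
  | store _ _ =>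
    refine ⟨fun _ _ => rfl, fun b hb => ?_⟩
    simp only [Prog.wm] at hb
    simp [Nat.ne_of_beq_eq_false hb]
  | seq _ _ ih₁ ih₂ =>
    exact (ih₁.mono (by simp +contextual [Prog.wr]) (by simp +contextual [Prog.wm])).trans
      (ih₂.mono (by simp +contextual [Prog.wr]) (by simp +contextual [Prog.wm]))
  | cond_true _ _ _ ih => exact ih.mono (by simp +contextual [Prog.wr]) (by simp +contextual [Prog.wm])
  | cond_false _ _ ih => exact ih.mono (by simp +contextual [Prog.wr]) (by simp +contextual [Prog.wm])
  | loop_done _ => exact Fr.refl _ _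
  | loop_step _ _ _ _ ih₁ ih₂ => exact (ih₁.mono (by simp [Prog.wr]) (by simp [Prog.wm])).trans ih₂

theorem Bdd.setReg {s : State} (h : Bdd W s) {x v : ℕ} (hv : v < W) : Bdd W (s.setReg x v) :=
  ⟨h.one_lt, fun y => by simp only [setReg_reg]; split_ifs; exacts [hv, h.reg y], h.mem⟩

theorem Bdd.setMem {s : State} (h : Bdd W s) {a k v : ℕ} (hv : v < W) : Bdd W (s.setMem a k v) :=
  ⟨h.one_lt, h.reg, fun b l => by
    simp only [setMem_mem]
    split_ifs
    · rw [Function.update_apply]; split_ifs; exacts [hv, h.mem a l]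
    · exact h.mem b l⟩

theorem Exec.bdd {p : Prog} {s s' : State} {t : ℕ} (h : Exec W p s t s') : Bdd W s → Bdd W s' := by
  induction h with
  | skip => exact id
  | assign h => exact fun hb => hb.setReg h.lt
  | store _ h => exact fun hb => hb.setMem h.lt
  | seq _ _ ih₁ ih₂ => exact fun hb => ih₂ (ih₁ hb)
  | cond_true _ _ _ ih => exact ih
  | cond_false _ _ ih => exact ih
  | loop_done _ => exact id
  | loop_step _ _ _ _ ih₁ ih₂ => exact fun hb => ih₂ (ih₁ hb)

/-! ### Running time in terms of the number of loop iterations -/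

/-- The cost of a program per loop iteration. -/
def Prog.kappa : Prog → ℕ
  | .skip => 1
  | .assign _ e => e.cost + 1
  | .store _ i e => i.cost + e.cost + 1
  | .seq p q => p.kappa + q.kappa
  | .cond e p q => e.cost + 1 + p.kappa + q.kappa
  | .loop e p => e.cost + 1 + p.kappa

/-- `p` leads from `s` to `s'` within `i` loop iterations. -/
def Run (W : ℕ) (p : Prog) (s : State) (i : ℕ) (s' : State) : Prop :=
  ∃ t, Exec W p s t s' ∧ t ≤ p.kappa * (i + 1)

section Run

variable {p q : Prog} {e : Expr} {s s₁ s₂ : State} {i j : ℕ}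

theorem Run.bdd (h : Run W p s i s₁) (hb : Bdd W s) : Bdd W s₁ := h.choose_spec.1.bdd hb

theorem Run.frame (h : Run W p s i s₁) : Fr p s s₁ := h.choose_spec.1.frame

theorem Run.mono (h : Run W p s i s₁) (hij : i ≤ j) : Run W p s j s₁ := by
  obtain ⟨t, h, ht⟩ := h
  exact ⟨t, h, ht.trans (Nat.mul_le_mul_left _ (by omega))⟩

/-- Iteration counts add exactly because the factor `Prog.kappa` already adds over the two parts; no
constants pile up in the counts. -/
theorem Run.seq (h₁ : Run W p s i s₁) (h₂ : Run W q s₁ j s₂) : Run W (p ⨾ q) s (i + j) s₂ := by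
  obtain ⟨t₁, h₁, ht₁⟩ := h₁
  obtain ⟨t₂, h₂, ht₂⟩ := h₂
  refine ⟨_, .seq h₁ h₂, ?_⟩
  simp only [Prog.kappa]
  nlinarith [Nat.zero_le (p.kappa * j), Nat.zero_le (q.kappa * i)]

theorem Run.loop_done (hb : Bdd W s) (he : e.Safe W s) (h0 : e.val s = 0) :
    Run W (.loop e p) s 0 s := by
  refine ⟨_, .loop_done (h0 ▸ (he.eval hb).2), ?_⟩
  simp only [Prog.kappa]; omega

theorem Run.loop_step (hb : Bdd W s) (he : e.Safe W s) (h0 : e.val s ≠ 0) (h₁ : Run W p s i s₁)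
    (h₂ : Run W (.loop e p) s₁ j s₂) : Run W (.loop e p) s (i + 1 + j) s₂ := by
  obtain ⟨t₁, h₁, ht₁⟩ := h₁
  obtain ⟨t₂, h₂, ht₂⟩ := h₂
  refine ⟨_, .loop_step (he.eval hb).2 h0 h₁ h₂, ?_⟩
  simp only [Prog.kappa] at *
  nlinarith [Nat.zero_le (p.kappa * j), Nat.zero_le ((e.cost + 1) * i),
    Nat.zero_le (e.cost * i)]

theorem Run.cond_true (hb : Bdd W s) (he : e.Safe W s) (h0 : e.val s ≠ 0) (h : Run W p s i s₁) :
    Run W (.cond e p q) s i s₁ := by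
  obtain ⟨t, h, ht⟩ := h
  refine ⟨_, .cond_true (he.eval hb).2 h0 h, ?_⟩
  simp only [Prog.kappa]
  nlinarith [Nat.zero_le (q.kappa * i), Nat.zero_le (e.cost * i)]

theorem Run.cond_false (hb : Bdd W s) (he : e.Safe W s) (h0 : e.val s = 0) (h : Run W q s i s₁) :
    Run W (.cond e p q) s i s₁ := by
  obtain ⟨t, h, ht⟩ := h
  refine ⟨_, .cond_false (h0 ▸ (he.eval hb).2) h, ?_⟩
  simp only [Prog.kappa]
  nlinarith [Nat.zero_le (p.kappa * i), Nat.zero_le (e.cost * i)]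

end Run

/-! ### Straight-line code -/

/-- The effect of a program without loops. -/
def Prog.den : Prog → State → State
  | .skip, s => s
  | .assign x e, s => s.setReg x (e.val s)
  | .store a k e, s => s.setMem a (k.val s) (e.val s)
  | .seq p q, s => q.den (p.den s)
  | .cond e p q, s => if e.val s ≠ 0 then p.den s else q.den s
  | .loop _ _, s => s

/-- The program has no loops and runs without overflow. -/
def Prog.Safe (W : ℕ) : Prog → State → Prop
  | .skip, _ => True
  | .assign _ e, s => e.Safe W s
  | .store _ k e, s => k.Safe W s ∧ e.Safe W s
  | .seq p q, s => p.Safe W s ∧ q.Safe W (p.den s)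
  | .cond e p q, s => e.Safe W s ∧ if e.val s ≠ 0 then p.Safe W s else q.Safe W s
  | .loop _ _, _ => False

/-- Loop-free code is executed by evaluating the function `Prog.den`, which `simp` can unfold. -/
theorem run_den : ∀ {p : Prog} {s : State}, Bdd W s → p.Safe W s → Run W p s 0 (p.den s)
  | .skip, _, _, _ => ⟨_, .skip, by simp [Prog.kappa]⟩
  | .assign _ _, _, hb, h => ⟨_, .assign (h.eval hb).2, by simp [Prog.kappa]⟩
  | .store _ _ _, _, hb, h => ⟨_, .store (h.1.eval hb).2 (h.2.eval hb).2, by simp [Prog.kappa]⟩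
  | .seq _ _, _, hb, h => (run_den hb h.1).seq (run_den ((run_den hb h.1).bdd hb) h.2)
  | .cond e p q, s, hb, h => by
    simp only [Prog.Safe, Prog.den] at h ⊢
    split_ifs at h ⊢ with h0
    · exact .cond_true hb h.1 h0 (run_den hb h.2)
    · exact .cond_false hb h.1 (not_not.1 h0) (run_den hb h.2)

/-! ### Loops -/

/-- The potential Φ serves twice: it decreases by at least 1 per round, which gives termination, and
its decrease also pays for the iterations inside the body, which gives the amortised count. -/
theorem run_while {e : Expr} {p : Prog} {s : State} (hb : Bdd W s) (I : State → Prop)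
    (Φ : State → ℕ) (hI : I s) (hsafe : ∀ s', Bdd W s' → Fr p s s' → I s' → e.Safe W s')
    (step : ∀ s', Bdd W s' → Fr p s s' → I s' → e.val s' ≠ 0 →
      ∃ s'' i, Run W p s' i s'' ∧ I s'' ∧ i + 1 + Φ s'' ≤ Φ s') :
    ∃ s' i, Run W (.loop e p) s i s' ∧ I s' ∧ e.val s' = 0 ∧ i + Φ s' ≤ Φ s := by
  suffices H : ∀ n s', Φ s' = n → Bdd W s' → Fr p s s' → I s' →
      ∃ s'' i, Run W (.loop e p) s' i s'' ∧ I s'' ∧ e.val s'' = 0 ∧ i + Φ s'' ≤ Φ s' from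
    H _ s rfl hb (Fr.refl _ _) hI
  intro n
  induction n using Nat.strong_induction_on with
  | _ n ih =>
    intro s' hn hb' hf hI'
    by_cases h0 : e.val s' = 0
    · exact ⟨s', 0, .loop_done hb' (hsafe s' hb' hf hI') h0, hI', h0, by omega⟩
    · obtain ⟨s₁, i, hr, hI₁, hΦ⟩ := step s' hb' hf hI' h0
      obtain ⟨s₂, j, hr₂, hI₂, h0₂, hΦ₂⟩ :=
        ih (Φ s₁) (by omega) s₁ rfl (hr.bdd hb') (hf.trans hr.frame) hI₁
      exact ⟨s₂, _, .loop_step hb' (hsafe s' hb' hf hI') h0 hr hr₂, hI₂, h0₂, by omega⟩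

/-- The loop `for x = 0, …, y - 1`. -/
def forLt (x y : ℕ) (body : Prog) : Prog :=
  x ≔ C 0 ⨾ .loop (V x ≺ₑ V y) (body ⨾ x ≔ V x + C 1)

/-- Each round may spend c iterations plus whatever it releases from the potential Φ. Invariant and
potential are evaluated after the counter has been advanced, so they may mention the counter
register. -/
theorem run_for {x y : ℕ} {body : Prog} {s : State} (hb : Bdd W s)
    (hx : body.wr x = false) (hy : (forLt x y body).wr y = false) {N : ℕ} (hN : s.reg y = N)
    (I : ℕ → State → Prop) (Φ : State → ℕ) (c : ℕ) (h0 : I 0 (s.setReg x 0))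
    (step : ∀ k < N, ∀ s', Bdd W s' → Fr (forLt x y body) s s' → s'.reg x = k → I k s' →
      ∃ s'' i, Run W body s' i s'' ∧ I (k + 1) (s''.setReg x (k + 1)) ∧
        i + Φ (s''.setReg x (k + 1)) ≤ Φ s' + c) :
    ∃ s', Run W (forLt x y body) s (N * (c + 1) + Φ (s.setReg x 0)) s' ∧ I N s' ∧
      s'.reg x = N := by
  have h1 : 0 < W := by have := hb.one_lt; omega
  have hr₀ : Run W (x ≔ C 0) s 0 (s.setReg x 0) := run_den (p := x ≔ C 0) hb h1
  obtain ⟨s', i, hr, hI, he, hΦ⟩ := run_while (W := W) (e := V x ≺ₑ V y)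
    (p := body ⨾ x ≔ V x + C 1) (hr₀.bdd hb)
    (fun s' => s'.reg x ≤ N ∧ I (s'.reg x) s')
    -- Every remaining round has c iterations in advance and one for its own loop test.
    (fun s' => (N - s'.reg x) * (c + 1) + Φ s') (by simpa using h0)
    (by intros; simp)
    (by
      intro s' hb' hf ⟨hk, hI⟩ he
      have hf' : Fr (forLt x y body) s s' :=
        ((hr₀.frame).mono (by simp +contextual [Prog.wr, forLt])
          (by simp +contextual [Prog.wm])).trans
        (hf.mono (by simp +contextual [Prog.wr, forLt]) (by simp +contextual [Prog.wm, forLt]))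
      have hy' : s'.reg y = N := (hf'.reg y hy).trans hN
      simp only [val_less, val_V, hy'] at he
      have hk : s'.reg x < N := by
        by_contra h; simp [h] at he
      obtain ⟨s'', i, hr, hI', hΦ⟩ := step _ hk s' hb' hf' rfl hI
      have hx'' : s''.reg x = s'.reg x := hr.frame.reg x hx
      have hNW : N < W := hN ▸ hb.reg y
      have hd := run_den (p := x ≔ V x + C 1) (hr.bdd hb')
        (by simp [Prog.Safe, hx'']; constructor <;> omega)
      simp only [Prog.den, val_add, val_V, val_C, hx''] at hd
      refine ⟨_, _, hr.seq hd, ⟨by simpa using hk, by simpa using hI'⟩, ?_⟩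
      simp only [setReg_reg, if_true]
      have : (N - s'.reg x) * (c + 1) = (N - (s'.reg x + 1)) * (c + 1) + (c + 1) := by
        obtain ⟨d, hd⟩ : ∃ d, N = s'.reg x + 1 + d := ⟨N - (s'.reg x + 1), by omega⟩
        rw [hd, show s'.reg x + 1 + d - s'.reg x = d + 1 by omega, Nat.add_sub_cancel_left]
        ring
      omega)
  have hf := (hr₀.seq hr).frame
  have hy' : s'.reg y = N := (hf.reg y hy).trans hN
  have hxN : s'.reg x = N := by
    simp only [val_less, val_V, hy'] at he
    by_contra h
    have : s'.reg x < N := by omega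
    simp [this] at he
  refine ⟨s', (hr₀.seq hr).mono ?_, hxN ▸ hI.2, hxN⟩
  simp at hΦ
  omega

theorem run_for_straight {x y : ℕ} {body : Prog} {s : State} (hb : Bdd W s)
    (hx : body.wr x = false) (hy : (forLt x y body).wr y = false) {N : ℕ} (hN : s.reg y = N)
    (I : ℕ → State → Prop) (h0 : I 0 (s.setReg x 0))
    (step : ∀ k < N, ∀ s', Bdd W s' → Fr (forLt x y body) s s' → s'.reg x = k → I k s' →
      body.Safe W s' ∧ I (k + 1) ((body.den s').setReg x (k + 1))) :
    ∃ s', Run W (forLt x y body) s N s' ∧ I N s' ∧ s'.reg x = N := by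
  obtain ⟨s', hr, h⟩ := run_for hb hx hy hN I (fun _ => 0) 0 h0
    (fun k hk s' hb' hf hk' hI => by
      obtain ⟨hs, hI'⟩ := step k hk s' hb' hf hk' hI
      exact ⟨_, 0, run_den hb' hs, hI', by simp⟩)
  exact ⟨s', hr.mono (by simp), h⟩

end WordRAM

/-! ### Stable counting sort -/

namespace WordRAM

variable {W : ℕ}

/-- The position at which the stable sort by the keys `f 0, …, f (N - 1)` puts item `k`. -/
def sortPos (f : ℕ → ℕ) (N k : ℕ) : ℕ :=
  Nat.count (fun t => f t < f k) N + Nat.count (fun t => f t = f k) k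

theorem count_lt_add_count_eq (f : ℕ → ℕ) (v N : ℕ) :
    Nat.count (fun t => f t < v) N + Nat.count (fun t => f t = v) N =
      Nat.count (fun t => f t < v + 1) N := by
  induction N with
  | zero => simp
  | succ N ih =>
    simp only [Nat.count_succ]
    split_ifs <;> omega

theorem count_lt_mono (f : ℕ → ℕ) {u v : ℕ} (h : u ≤ v) (N : ℕ) :
    Nat.count (fun t => f t < u) N ≤ Nat.count (fun t => f t < v) N :=
  Nat.count_mono_left (fun _ _ ht => lt_of_lt_of_le ht h)

/-- Item k lands in the run of slots reserved for its key, and this run ends where the slots of the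
greater keys begin. -/
theorem sortPos_lt_succ_count (f : ℕ → ℕ) {N k : ℕ} (hk : k < N) :
    sortPos f N k < Nat.count (fun t => f t < f k + 1) N := by
  rw [← count_lt_add_count_eq, sortPos]
  have : Nat.count (fun t => f t = f k) (k + 1) ≤ Nat.count (fun t => f t = f k) N :=
    Nat.count_monotone _ hk
  rw [Nat.count_succ] at this
  simp at this
  omega

theorem sortPos_lt (f : ℕ → ℕ) {N k : ℕ} (hk : k < N) : sortPos f N k < N :=
  (sortPos_lt_succ_count f hk).trans_le (Nat.count_le _)

theorem sortPos_lt_of_key_lt (f : ℕ → ℕ) {N k l : ℕ} (hk : k < N) (h : f k < f l) :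
    sortPos f N k < sortPos f N l :=
  (sortPos_lt_succ_count f hk).trans_le ((count_lt_mono f h N).trans (Nat.le_add_right _ _))

theorem sortPos_lt_of_key_eq (f : ℕ → ℕ) {N k l : ℕ} (hkl : k < l) (h : f k = f l) :
    sortPos f N k < sortPos f N l := by
  have : Nat.count (fun t => f t = f l) (k + 1) ≤ Nat.count (fun t => f t = f l) l :=
    Nat.count_monotone _ hkl
  rw [Nat.count_succ] at this
  simp only [sortPos, h] at *
  simp at this
  omega

theorem sortPos_injOn (f : ℕ → ℕ) {N k l : ℕ} (hk : k < N) (hl : l < N)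
    (h : sortPos f N k = sortPos f N l) : k = l := by
  rcases lt_trichotomy (f k) (f l) with h1 | h1 | h1
  · have := sortPos_lt_of_key_lt f hk h1; omega
  · rcases lt_trichotomy k l with h2 | h2 | h2
    · have := sortPos_lt_of_key_eq f (N := N) h2 h1; omega
    · exact h2
    · have := sortPos_lt_of_key_eq f (N := N) h2 h1.symm; omega
  · have := sortPos_lt_of_key_lt f hl h1; omega

theorem exists_sortPos_eq (f : ℕ → ℕ) {N a : ℕ} (ha : a < N) : ∃ k < N, sortPos f N k = a := by
  have hinj : Function.Injective (fun k : Fin N => (⟨sortPos f N k, sortPos_lt f k.2⟩ : Fin N)) :=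
    fun k l h => Fin.ext (sortPos_injOn f k.2 l.2 (by simpa using h))
  obtain ⟨k, hk⟩ := (Finite.injective_iff_surjective.1 hinj) ⟨a, ha⟩
  exact ⟨k, k.2, by simpa using hk⟩

/-- `L'` is the list `L` of `N` items after a stable sort by `key`. -/
structure StableSort (key : ℕ → ℕ) (N : ℕ) (L L' : ℕ → ℕ) : Prop where
  old : ∀ a < N, ∃ b < N, L' a = L b
  new : ∀ b < N, ∃ a < N, L' a = L b
  sorted : ∀ r : ℕ → ℕ → Prop, (∀ a b, a < b → b < N → r (L a) (L b)) →
    ∀ a b, a < b → b < N →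
      key (L' a) < key (L' b) ∨ key (L' a) = key (L' b) ∧ r (L' a) (L' b)

/-- Clause `sorted` quantifies over every relation r respected by the old order. Stability in this
form iterates: the lexicographic relation obtained from one pass is the r of the next, which is the
correctness of least-significant-digit radix sort. -/
theorem StableSort.of_sortPos {key : ℕ → ℕ} {N : ℕ} {L L' : ℕ → ℕ}
    (h : ∀ k < N, L' (sortPos (fun t => key (L t)) N k) = L k) : StableSort key N L L' where
  old a ha := by
    obtain ⟨k, hk, rfl⟩ := exists_sortPos_eq (fun t => key (L t)) ha
    exact ⟨k, hk, h k hk⟩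
  new b hb := ⟨_, sortPos_lt _ hb, h b hb⟩
  sorted r hr a b hab hb := by
    obtain ⟨k, hk, rfl⟩ := exists_sortPos_eq (fun t => key (L t)) (hab.trans hb)
    obtain ⟨l, hl, rfl⟩ := exists_sortPos_eq (fun t => key (L t)) hb
    rw [h k hk, h l hl]
    rcases lt_trichotomy (key (L k)) (key (L l)) with h1 | h1 | h1
    · exact .inl h1
    · refine .inr ⟨h1, ?_⟩
      rcases lt_trichotomy k l with h2 | h2 | h2
      · exact hr k l h2 hl
      · subst h2; omega
      · have := sortPos_lt_of_key_eq (fun t => key (L t)) (N := N) h2 h1.symm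
        omega
    · have := sortPos_lt_of_key_lt (fun t => key (L t)) hl h1
      omega

/-- Clears the first `reg 11` counters. -/
def radixClear : Prog := forLt 20 11 (.store 6 (V 20) (C 0))

/-- Counts the keys of the items `mem 4`; the key of item `x` is cell `reg 15 + x` of array `3`. -/
def radixCount : Prog := forLt 20 14
  (21 ≔ Rd 3 (V 15 + Rd 4 (V 20)) ⨾ .store 6 (V 21) (Rd 6 (V 21) + C 1))

/-- Turns the counters into their prefix sums. -/
def radixSum : Prog := 22 ≔ C 0 ⨾ forLt 20 11
  (21 ≔ Rd 6 (V 20) ⨾ .store 6 (V 20) (V 22) ⨾ 22 ≔ V 22 + V 21)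

/-- Distributes the items to array `5`. -/
def radixScatter : Prog := forLt 20 14
  (21 ≔ Rd 3 (V 15 + Rd 4 (V 20)) ⨾ .store 5 (Rd 6 (V 21)) (Rd 4 (V 20)) ⨾
    .store 6 (V 21) (Rd 6 (V 21) + C 1))

/-- Copies the items back. -/
def radixCopy : Prog := forLt 20 14 (.store 4 (V 20) (Rd 5 (V 20)))

/-- Sorts the `reg 14` items of array `4` stably by their keys, which are below `reg 11`. -/
def radix : Prog := radixClear ⨾ radixCount ⨾ radixSum ⨾ radixScatter ⨾ radixCopy

theorem radixClear_run {s : State} (hb : Bdd W s) :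
    ∃ s', Run W radixClear s (s.reg 11) s' ∧ ∀ v < s.reg 11, s'.mem 6 v = 0 := by
  obtain ⟨s', hr, hI, -⟩ := run_for_straight (x := 20) (y := 11)
    (body := .store 6 (V 20) (C 0)) hb rfl rfl rfl
    (fun k s => ∀ v < k, s.mem 6 v = 0) (by simp)
    (by
      intro k hk s' hb' hf hk' hI
      have := hb.one_lt
      refine ⟨by simp [Prog.Safe]; omega, fun v hv => ?_⟩
      simp only [Prog.den, val_V, val_C, hk', setReg_mem, setMem_mem, if_true,
        Function.update_apply]
      split_ifs
      · rfl
      · exact hI v (by omega))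
  exact ⟨s', hr, hI⟩

theorem radixCount_run {s : State} (hb : Bdd W s) {N : ℕ} (hN : s.reg 14 = N) {A : ℕ}
    (hadd : ∀ k < N, s.reg 15 + s.mem 4 k < W)
    (hkey : ∀ k < N, s.mem 3 (s.reg 15 + s.mem 4 k) < A) (h0 : ∀ v < A, s.mem 6 v = 0) :
    ∃ s', Run W radixCount s N s' ∧
      ∀ v < A, s'.mem 6 v = Nat.count (fun t => s.mem 3 (s.reg 15 + s.mem 4 t) = v) N := by
  have hNW : N < W := hN ▸ hb.reg 14
  obtain ⟨s', hr, hI, -⟩ := run_for_straight (x := 20) (y := 14)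
    (body := (21 ≔ Rd 3 (V 15 + Rd 4 (V 20)) ⨾ .store 6 (V 21) (Rd 6 (V 21) + C 1)))
    hb rfl rfl hN
    (fun k s' => ∀ v < A, s'.mem 6 v =
      Nat.count (fun t => s.mem 3 (s.reg 15 + s.mem 4 t) = v) k) (by simpa using h0)
    (by
      intro k hk s' hb' hf hk' hI
      have f15 := hf.reg 15 rfl
      have f3 := hf.mem 3 rfl
      have f4 := hf.mem 4 rfl
      have hc := Nat.count_le (p := fun t => s.mem 3 (s.reg 15 + s.mem 4 t) =
        s.mem 3 (s.reg 15 + s.mem 4 k)) (n := k)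
      have h1 := hadd k hk
      refine ⟨?_, fun v hv => ?_⟩
      · simp [Prog.Safe, Prog.den, hk', f15, f3, f4, hI _ (hkey k hk)]
        omega
      · simp [Prog.den, hk', f15, f3, f4, Function.update_apply, Nat.count_succ, hI _ (hkey k hk)]
        split_ifs with h1 h2 h2
        · rw [h1]
        · exact absurd h1.symm h2
        · exact absurd h2.symm h1
        · simpa using hI v hv)
  exact ⟨s', hr, hI⟩

theorem radixSum_run {s : State} (hb : Bdd W s) {N A : ℕ} (hA : s.reg 11 = A) (hN : N < W)
    (f : ℕ → ℕ) (h : ∀ v < A, s.mem 6 v = Nat.count (fun t => f t = v) N) :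
    ∃ s', Run W radixSum s A s' ∧ ∀ v < A, s'.mem 6 v = Nat.count (fun t => f t < v) N := by
  have h1 := hb.one_lt
  have hr₀ := run_den (p := 22 ≔ C 0) hb (by simp [Prog.Safe]; omega)
  obtain ⟨s', hr, hI, -⟩ := run_for_straight (x := 20) (y := 11)
    (body := (21 ≔ Rd 6 (V 20) ⨾ .store 6 (V 20) (V 22) ⨾ 22 ≔ V 22 + V 21))
    (hr₀.bdd hb) rfl rfl (N := A) (by simpa [Prog.den] using hA)
    (fun k s' => s'.reg 22 = Nat.count (fun t => f t < k) N ∧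
      (∀ v < k, s'.mem 6 v = Nat.count (fun t => f t < v) N) ∧
      (∀ v, k ≤ v → v < A → s'.mem 6 v = Nat.count (fun t => f t = v) N))
    (by simpa [Prog.den] using h)
    (by
      intro k hk s' hb' hf hk' ⟨h22, hl, hg⟩
      have e := count_lt_add_count_eq f k N
      have hc := Nat.count_le (p := fun t => f t < k + 1) (n := N)
      have h6 := hg k le_rfl hk
      refine ⟨?_, ?_, fun v hv => ?_, fun v hv hvA => ?_⟩
      · simp [Prog.Safe, Prog.den, hk', h6, h22]; omega
      · simp [Prog.den, hk', h6, h22, e]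
      · simp [Prog.den, hk', h22, Function.update_apply]
        split_ifs with h2
        · rw [h2]
        · exact hl v (by omega)
      · simp [Prog.den, hk', h22, Function.update_apply]
        rw [if_neg (by omega)]
        exact hg v (by omega) hvA)
  exact ⟨s', (hr₀.seq hr).mono (by omega), hI.2.1⟩

theorem radixScatter_run {s : State} (hb : Bdd W s) {N A : ℕ} (hN : s.reg 14 = N)
    (hadd : ∀ k < N, s.reg 15 + s.mem 4 k < W)
    (hkey : ∀ k < N, s.mem 3 (s.reg 15 + s.mem 4 k) < A)
    (h : ∀ v < A, s.mem 6 v =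
      Nat.count (fun t => s.mem 3 (s.reg 15 + s.mem 4 t) < v) N) :
    ∃ s', Run W radixScatter s N s' ∧ ∀ k < N,
      s'.mem 5 (sortPos (fun t => s.mem 3 (s.reg 15 + s.mem 4 t)) N k) = s.mem 4 k := by
  have hNW : N < W := hN ▸ hb.reg 14
  set f := fun t => s.mem 3 (s.reg 15 + s.mem 4 t) with hfdef
  obtain ⟨s', hr, hI, -⟩ := run_for_straight (x := 20) (y := 14)
    (body := (21 ≔ Rd 3 (V 15 + Rd 4 (V 20)) ⨾ .store 5 (Rd 6 (V 21)) (Rd 4 (V 20)) ⨾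
      .store 6 (V 21) (Rd 6 (V 21) + C 1)))
    hb rfl rfl hN
    (fun k s' => (∀ v < A, s'.mem 6 v =
      Nat.count (fun t => f t < v) N + Nat.count (fun t => f t = v) k) ∧
      ∀ l < k, s'.mem 5 (sortPos f N l) = s.mem 4 l) (by simpa using h)
    (by
      intro k hk s' hb' hf hk' ⟨hI, hJ⟩
      have f15 := hf.reg 15 rfl
      have f3 := hf.mem 3 rfl
      have f4 := hf.mem 4 rfl
      have h1 := hadd k hk
      -- The counter of a key holds the number of smaller keys plus the number of equal keys already
      -- placed: exactly the target of the next item with that key.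
      have hk6 : s'.mem 6 (s.mem 3 (s.reg 15 + s.mem 4 k)) = sortPos f N k := hI _ (hkey k hk)
      have hp := sortPos_lt f hk
      refine ⟨?_, fun v hv => ?_, fun l hl => ?_⟩
      · simp [Prog.Safe, Prog.den, hk', f15, f3, f4, hk6]
        omega
      · simp [Prog.den, hk', f15, f3, f4, Function.update_apply, Nat.count_succ, hk6]
        split_ifs with h1 h2 h2
        · rw [h1]; simp only [sortPos, hfdef]; omega
        · exact absurd h1.symm h2
        · exact absurd h2.symm h1
        · simpa using hI v hv
      · simp [Prog.den, hk', f15, f3, f4, Function.update_apply, hk6]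
        split_ifs with h2
        · rw [sortPos_injOn f (by omega) hk h2]
        · rcases Nat.lt_succ_iff_lt_or_eq.1 hl with h3 | h3
          · exact hJ l h3
          · exact absurd (by rw [h3]) h2)
  exact ⟨s', hr, hI.2⟩

theorem radixCopy_run {s : State} (hb : Bdd W s) {N : ℕ} (hN : s.reg 14 = N) :
    ∃ s', Run W radixCopy s N s' ∧ ∀ k < N, s'.mem 4 k = s.mem 5 k := by
  obtain ⟨s', hr, hI, -⟩ := run_for_straight (x := 20) (y := 14)
    (body := .store 4 (V 20) (Rd 5 (V 20))) hb rfl rfl hN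
    (fun k s' => ∀ v < k, s'.mem 4 v = s.mem 5 v) (by simp)
    (by
      intro k hk s' hb' hf hk' hI
      have f5 := hf.mem 5 rfl
      refine ⟨by simp [Prog.Safe], fun v hv => ?_⟩
      simp [Prog.den, hk', f5, Function.update_apply]
      split_ifs with h
      · rw [h]
      · exact hI v (by omega))
  exact ⟨s', hr, hI⟩

theorem radix_run {s : State} (hb : Bdd W s) {N A o : ℕ} (hN : s.reg 14 = N) (hA : s.reg 11 = A)
    (ho : s.reg 15 = o) (hadd : ∀ k < N, o + s.mem 4 k < W)
    (hkey : ∀ k < N, s.mem 3 (o + s.mem 4 k) < A) :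
    ∃ s', Run W radix s (2 * A + 3 * N) s' ∧
      StableSort (fun x => s.mem 3 (o + x)) N (s.mem 4) (s'.mem 4) := by
  subst ho
  obtain ⟨s₁, r₁, h₁⟩ := radixClear_run hb
  have b₁ := r₁.bdd hb
  have f₁ := r₁.frame
  have e₁ := f₁.mem 3 rfl
  have e₁' := f₁.mem 4 rfl
  have e₁'' := f₁.reg 15 rfl
  obtain ⟨s₂, r₂, h₂⟩ := radixCount_run (W := W) (N := N) (A := A) b₁ (by rw [f₁.reg 14 rfl, hN])
    (by rwa [e₁', e₁'']) (by rwa [e₁', e₁'', e₁]) (by rwa [hA] at h₁)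
  have b₂ := r₂.bdd b₁
  have f₂ := (r₁.seq r₂).frame
  obtain ⟨s₃, r₃, h₃⟩ := radixSum_run (W := W) (N := N) (A := A) b₂ (by rw [f₂.reg 11 rfl, hA])
    (hN ▸ hb.reg 14) _ h₂
  rw [e₁, e₁', e₁''] at h₃
  have b₃ := r₃.bdd b₂
  have f₃ := (r₁.seq (r₂.seq r₃)).frame
  have e₃ := f₃.mem 3 rfl
  have e₃' := f₃.mem 4 rfl
  have e₃'' := f₃.reg 15 rfl
  obtain ⟨s₄, r₄, h₄⟩ := radixScatter_run (W := W) (N := N) (A := A) b₃ (by rw [f₃.reg 14 rfl, hN])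
    (by rwa [e₃', e₃'']) (by rwa [e₃', e₃'', e₃]) (by rwa [e₃', e₃'', e₃])
  rw [e₃, e₃', e₃''] at h₄
  have b₄ := r₄.bdd b₃
  have f₄ := (r₁.seq (r₂.seq (r₃.seq r₄))).frame
  obtain ⟨s₅, r₅, h₅⟩ := radixCopy_run (W := W) (N := N) b₄ (by rw [f₄.reg 14 rfl, hN])
  refine ⟨s₅, (r₁.seq (r₂.seq (r₃.seq (r₄.seq r₅)))).mono (by omega), ?_⟩
  exact .of_sortPos fun k hk => by rw [h₅ _ (sortPos_lt _ hk), h₄ k hk]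

end WordRAM

/-! ### Suffix order, suffix arrays and the reduction to two thirds of the suffixes -/

namespace WordRAM

/-- The suffix of `T` at `p` is lexicographically smaller than the one at `q`. -/
def SLt (T : ℕ → ℕ) (p q : ℕ) : Prop :=
  ∃ l, (∀ k < l, T (p + k) = T (q + k)) ∧ T (p + l) < T (q + l)

/-- The last symbol of the string `T` of length `N` occurs only once. -/
structure UniqLast (T : ℕ → ℕ) (N : ℕ) : Prop where
  pos : 0 < N
  ne : ∀ p, p + 1 < N → T p ≠ T (N - 1)

/-- `sa` is the suffix array of the string `T` of length `N`. -/
structure IsSA (T : ℕ → ℕ) (N : ℕ) (sa : ℕ → ℕ) : Prop where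
  lt : ∀ a < N, sa a < N
  sorted : ∀ a b, a < b → b < N → SLt T (sa a) (sa b)

/-! ### The lexicographic order of suffixes under a unique last symbol -/

section order

variable {T : ℕ → ℕ} {N p q r : ℕ}

theorem SLt.of_lt (h : T p < T q) : SLt T p q := ⟨0, by simp, h⟩

theorem SLt.cons (h : T p = T q) (hl : SLt T (p + 1) (q + 1)) : SLt T p q := by
  obtain ⟨l, h1, h2⟩ := hl
  refine ⟨l + 1, fun k hk => ?_, by rwa [← add_assoc, ← add_assoc, add_right_comm, add_right_comm q]⟩
  cases k with
  | zero => exact h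
  | succ k =>
    have := h1 k (by omega)
    rwa [add_right_comm, add_right_comm q] at this

theorem SLt.irrefl : ¬ SLt T p p := fun ⟨_, _, h⟩ => lt_irrefl _ h

theorem SLt.trans (h : SLt T p q) (h' : SLt T q r) : SLt T p r := by
  obtain ⟨l, h1, h2⟩ := h
  obtain ⟨m, h3, h4⟩ := h'
  rcases lt_trichotomy l m with h | h | h
  · exact ⟨l, fun k hk => (h1 k hk).trans (h3 k (hk.trans h)), (h3 l h) ▸ h2⟩
  · subst h
    exact ⟨l, fun k hk => (h1 k hk).trans (h3 k hk), h2.trans h4⟩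
  · exact ⟨m, fun k hk => (h1 k (hk.trans h)).trans (h3 k hk), (h1 m h) ▸ h4⟩

theorem SLt.asymm (h : SLt T p q) : ¬ SLt T q p := fun h' => (h.trans h').irrefl

theorem SLt.ne (h : SLt T p q) : p ≠ q := by
  rintro rfl; exact h.irrefl

/-- Equal symbols at different positions are followed by further symbols. -/
theorem UniqLast.succ_lt (h : UniqLast T N) (hp : p < N) (hq : q < N) (hpq : p ≠ q) {d : ℕ}
    (he : ∀ k ≤ d, T (p + k) = T (q + k)) : p + d + 1 < N ∧ q + d + 1 < N := by
  induction d with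
  | zero =>
    have h0 := he 0 le_rfl
    simp only [add_zero] at h0
    have h1 : p + 1 ≠ N := fun hN => h.ne q (by omega) (by
      rw [← h0]; congr 1; omega)
    have h2 : q + 1 ≠ N := fun hN => h.ne p (by omega) (by
      rw [h0]; congr 1; omega)
    omega
  | succ d ih =>
    have ih := ih fun k hk => he k (by omega)
    have h0 := he (d + 1) le_rfl
    have h1 : p + (d + 1) + 1 ≠ N := fun hN => h.ne (q + (d + 1)) (by omega) (by
      rw [← h0]; congr 1; omega)
    have h2 : q + (d + 1) + 1 ≠ N := fun hN => h.ne (p + (d + 1)) (by omega) (by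
      rw [h0]; congr 1; omega)
    omega

theorem UniqLast.exists_ne (h : UniqLast T N) (hp : p < N) (hq : q < N) (hpq : p ≠ q) :
    ∃ l, (∀ k < l, T (p + k) = T (q + k)) ∧ T (p + l) ≠ T (q + l) := by
  have : ∃ l, T (p + l) ≠ T (q + l) := by
    by_contra! hc
    have := (h.succ_lt hp hq hpq (d := N) fun k _ => hc k).1
    omega
  classical
  exact ⟨Nat.find this, fun k hk => not_not.1 (Nat.find_min this hk), Nat.find_spec this⟩

theorem UniqLast.total (h : UniqLast T N) (hp : p < N) (hq : q < N) (hpq : p ≠ q) :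
    SLt T p q ∨ SLt T q p := by
  obtain ⟨l, h1, h2⟩ := h.exists_ne hp hq hpq
  rcases Nat.lt_or_gt_of_ne h2 with h2 | h2
  · exact .inl ⟨l, h1, h2⟩
  · exact .inr ⟨l, fun k hk => (h1 k hk).symm, h2⟩

theorem UniqLast.congr {T' : ℕ → ℕ} (h : UniqLast T N) (he : ∀ k < N, T k = T' k) :
    UniqLast T' N :=
  ⟨h.pos, fun p hp => by
    have := h.pos
    rw [← he p (by omega), ← he _ (by omega)]; exact h.ne p hp⟩

/-- The first mismatch lies inside the string, so changing cells from N on does not affect the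
order. This lets results survive writes to pads and to deeper recursion levels. -/
theorem UniqLast.slt_congr {T' : ℕ → ℕ} (h : UniqLast T N) (he : ∀ k < N, T k = T' k)
    (hp : p < N) (hq : q < N) (hl : SLt T p q) : SLt T' p q := by
  have hpq := hl.ne
  obtain ⟨l, h1, h2⟩ := hl
  have hlt : p + l < N ∧ q + l < N := by
    cases l with
    | zero => exact ⟨hp, hq⟩
    | succ l => exact h.succ_lt hp hq hpq fun k hk => h1 k (by omega)
  exact ⟨l, fun k hk => by rw [← he _ (by omega), ← he _ (by omega)]; exact h1 k hk,
    by rwa [← he _ hlt.1, ← he _ hlt.2]⟩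

theorem IsSA.congr {T' sa : ℕ → ℕ} (h : IsSA T N sa) (hT : UniqLast T N)
    (he : ∀ k < N, T k = T' k) : IsSA T' N sa :=
  ⟨h.lt, fun a b hab hb => hT.slt_congr he (h.lt a (hab.trans hb)) (h.lt b hb) (h.sorted a b hab hb)⟩

theorem IsSA.injOn {sa : ℕ → ℕ} (h : IsSA T N sa) {a b : ℕ} (ha : a < N) (hb : b < N)
    (he : sa a = sa b) : a = b := by
  rcases lt_trichotomy a b with h1 | h1 | h1
  · exact absurd he (h.sorted a b h1 hb).ne
  · exact h1
  · exact absurd he.symm (h.sorted b a h1 ha).ne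

/-- Strict sortedness makes sa injective, and an injective self-map of a finite set is onto. Hence
`IsSA` needs no permutation clause. -/
theorem IsSA.exists_eq {sa : ℕ → ℕ} (h : IsSA T N sa) (hp : p < N) : ∃ a < N, sa a = p := by
  have hinj : Function.Injective (fun k : Fin N => (⟨sa k, h.lt k k.2⟩ : Fin N)) :=
    fun k l he => Fin.ext (h.injOn k.2 l.2 (by simpa using he))
  obtain ⟨k, hk⟩ := (Finite.injective_iff_surjective.1 hinj) ⟨p, hp⟩
  exact ⟨k, k.2, by simpa using hk⟩

theorem IsSA.lt_of_slt {sa : ℕ → ℕ} (h : IsSA T N sa) {a b : ℕ} (ha : a < N)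
    (hl : SLt T (sa a) (sa b)) : a < b := by
  rcases lt_trichotomy a b with h1 | h1 | h1
  · exact h1
  · subst h1; exact absurd hl SLt.irrefl
  · exact absurd hl (h.sorted b a h1 ha).asymm

end order

/-! ### Samples -/

/-- The number of positions below `N` that are `1` modulo `3`. -/
def half (N : ℕ) : ℕ := (N + 1) / 3

/-- The number of positions below `N` that are not divisible by `3`. -/
def samples (N : ℕ) : ℕ := (N + 1) / 3 + N / 3

/-- The `a`-th sample position. -/
def samplePos (N a : ℕ) : ℕ := if a < half N then 3 * a + 1 else 3 * (a - half N) + 2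

/-- The index of a sample position. -/
def sampleIdx (N p : ℕ) : ℕ := p / 3 + (p % 3 - 1) * half N

/-- Samples are indexed with all positions of residue 1 first and then those of residue 2. The
branch-free formula is the one that the naming program evaluates; the case split is what `omega` can
use. -/
theorem sampleIdx_eq {N p : ℕ} (hp : p % 3 ≠ 0) :
    p % 3 = 1 ∧ sampleIdx N p = p / 3 ∨ p % 3 = 2 ∧ sampleIdx N p = p / 3 + half N := by
  rcases (by omega : p % 3 = 1 ∨ p % 3 = 2) with h | h <;> simp [sampleIdx, h]

theorem samplePos_eq (N a : ℕ) : a < half N ∧ samplePos N a = 3 * a + 1 ∨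
    half N ≤ a ∧ samplePos N a = 3 * (a - half N) + 2 := by
  unfold samplePos
  split_ifs with h
  · exact .inl ⟨h, rfl⟩
  · exact .inr ⟨not_lt.1 h, rfl⟩

theorem half_eq (N : ℕ) : half N = (N + 1) / 3 := rfl

theorem samples_eq (N : ℕ) : samples N = half N + N / 3 := rfl

theorem samplePos_lt {N a : ℕ} (ha : a < samples N) : samplePos N a < N := by
  have := half_eq N
  have := samples_eq N
  rcases samplePos_eq N a with h | h <;> omega

theorem samplePos_mod {N a : ℕ} : samplePos N a % 3 ≠ 0 := by
  rcases samplePos_eq N a with h | h <;> omega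

theorem sampleIdx_samplePos {N a : ℕ} : sampleIdx N (samplePos N a) = a := by
  rcases sampleIdx_eq (N := N) (samplePos_mod (N := N) (a := a)) with h | h <;>
  rcases samplePos_eq N a with h' | h' <;> omega

theorem sampleIdx_lt {N p : ℕ} (hp : p < N) (h3 : p % 3 ≠ 0) : sampleIdx N p < samples N := by
  have := half_eq N
  have := samples_eq N
  rcases sampleIdx_eq (N := N) h3 with h | h <;> omega

theorem samplePos_sampleIdx {N p : ℕ} (hp : p < N) (h3 : p % 3 ≠ 0) :
    samplePos N (sampleIdx N p) = p := by
  have := half_eq N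
  rcases sampleIdx_eq (N := N) h3 with h | h <;>
  rcases samplePos_eq N (sampleIdx N p) with h' | h' <;> omega

theorem samples_le (N : ℕ) : 3 * samples N ≤ 2 * N := by
  simp only [samples]; omega

theorem samples_pos {N : ℕ} (h : 1 < N) : 0 < samples N := by
  simp only [samples]; omega

/-- The triples at `p` and `q` are equal. -/
def TripleEq (T : ℕ → ℕ) (p q : ℕ) : Prop :=
  T p = T q ∧ T (p + 1) = T (q + 1) ∧ T (p + 2) = T (q + 2)

/-- The triple at `p` is smaller than that at `q`. -/
def TripleLt (T : ℕ → ℕ) (p q : ℕ) : Prop :=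
  T p < T q ∨ T p = T q ∧ (T (p + 1) < T (q + 1) ∨
    T (p + 1) = T (q + 1) ∧ T (p + 2) < T (q + 2))

theorem TripleLt.slt {T : ℕ → ℕ} {p q : ℕ} (h : TripleLt T p q) : SLt T p q := by
  rcases h with h | ⟨h0, h | ⟨h1, h⟩⟩
  · exact .of_lt h
  · exact .cons h0 (.of_lt h)
  · exact .cons h0 (.cons h1 (.of_lt h))

theorem TripleEq.slt {T : ℕ → ℕ} {p q : ℕ} (h : TripleEq T p q) (h3 : SLt T (p + 3) (q + 3)) :
    SLt T p q := .cons h.1 (.cons h.2.1 (.cons h.2.2 h3))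

theorem tripleLt_or {T : ℕ → ℕ} (p q : ℕ) : TripleLt T p q ∨ TripleEq T p q ∨ TripleLt T q p := by
  simp only [TripleLt, TripleEq]; omega

/-- `R` is the string of the names of the triples at the sample positions of `T`. -/
structure Reduces (T : ℕ → ℕ) (N : ℕ) (R : ℕ → ℕ) : Prop where
  lt : ∀ a < samples N, ∀ b < samples N,
    TripleLt T (samplePos N a) (samplePos N b) → R a < R b
  eq : ∀ a < samples N, ∀ b < samples N,
    TripleEq T (samplePos N a) (samplePos N b) → R a = R b

/-! ### From the order of the names to the order of the sample suffixes -/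

section reduce

variable {T R : ℕ → ℕ} {N : ℕ}

theorem Reduces.tripleLt (h : Reduces T N R) {a b : ℕ} (ha : a < samples N) (hb : b < samples N)
    (hl : R a < R b) : TripleLt T (samplePos N a) (samplePos N b) := by
  rcases tripleLt_or (T := T) (samplePos N a) (samplePos N b) with h1 | h1 | h1
  · exact h1
  · have := h.eq a ha b hb h1; omega
  · have := h.lt b hb a ha h1; omega

theorem Reduces.tripleEq (h : Reduces T N R) {a b : ℕ} (ha : a < samples N) (hb : b < samples N)
    (hl : R a = R b) : TripleEq T (samplePos N a) (samplePos N b) := by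
  rcases tripleLt_or (T := T) (samplePos N a) (samplePos N b) with h1 | h1 | h1
  · have := h.lt a ha b hb h1; omega
  · exact h1
  · have := h.lt b hb a ha h1; omega

/-- Equal triples at different positions cannot reach the last symbol, so three positions further
one is still inside the string, at the next sample of the same residue class. Hence equal names
never straddle the border between the two classes, and no dummy sample is needed as a separator. -/
theorem Reduces.succ (h : Reduces T N R) (hT : UniqLast T N) {a b : ℕ} (ha : a < samples N)
    (hb : b < samples N) (hab : a ≠ b) (hl : R a = R b) :
    a + 1 < samples N ∧ samplePos N (a + 1) = samplePos N a + 3 := by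
  have he := h.tripleEq ha hb hl
  have hne : samplePos N a ≠ samplePos N b := fun h' => hab (by
    rw [← sampleIdx_samplePos (N := N) (a := a), h', sampleIdx_samplePos])
  have := (hT.succ_lt (samplePos_lt ha) (samplePos_lt hb) hne (d := 2) (by
    intro k hk
    interval_cases k
    exacts [he.1, he.2.1, he.2.2])).1
  have := half_eq N
  have := samples_eq N
  rcases samplePos_eq N a with h | h <;> rcases samplePos_eq N (a + 1) with h' | h' <;> omega

/-- A second occurrence of the last name would, by `Reduces.succ`, force a further sample. This lets
the recursion keep its sentinel property. -/
theorem Reduces.uniqLast (h : Reduces T N R) (hT : UniqLast T N) (hN : 1 < N) :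
    UniqLast R (samples N) :=
  ⟨samples_pos hN, fun p hp he => by
    have := h.succ hT (a := samples N - 1) (b := p) (by omega) (by omega) (by omega) he.symm
    omega⟩

/-- Induction on the place of the first mismatch: each equal name is an equal triple, and one step
in R is a step of three positions in T. -/
theorem Reduces.slt (h : Reduces T N R) (hT : UniqLast T N) {a b : ℕ} (ha : a < samples N)
    (hb : b < samples N) (hl : SLt R a b) : SLt T (samplePos N a) (samplePos N b) := by
  obtain ⟨l, h1, h2⟩ := hl
  induction l generalizing a b with
  | zero => exact (h.tripleLt ha hb h2).slt
  | succ l ih =>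
    have hab : a ≠ b := by rintro rfl; exact lt_irrefl _ h2
    have h0 : R a = R b := h1 0 (by omega)
    obtain ⟨ha1, ha2⟩ := h.succ hT ha hb hab h0
    obtain ⟨hb1, hb2⟩ := h.succ hT hb ha hab.symm h0.symm
    refine (h.tripleEq ha hb h0).slt ?_
    rw [← ha2, ← hb2]
    refine ih ha1 hb1 (fun k hk => ?_) ?_
    · have := h1 (k + 1) (by omega)
      rwa [← add_assoc, ← add_assoc, add_right_comm, add_right_comm b] at this
    · rwa [← add_assoc, ← add_assoc, add_right_comm, add_right_comm b] at h2

end reduce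

end WordRAM

/-! ### Suffix array construction: from a string to the string of its triples -/

namespace WordRAM

variable {W : ℕ}

/-- The registers describe the string of length `N` over `{0, …, A - 1}` at offset `o` of array `3`,
followed by two pads, as the string of recursion level `l`. -/
structure IsLevel (W : ℕ) (s : State) (o N A l : ℕ) : Prop where
  len : s.reg 10 = N
  alph : s.reg 11 = A
  off : s.reg 12 = o
  lev : s.reg 13 = l
  uniq : UniqLast (fun k => s.mem 3 (o + k)) N
  lt : ∀ k < N + 2, s.mem 3 (o + k) < A
  bound : o + 6 * N + 10 < W
  lev_bound : l + N < W

/-- Lists the sample positions. -/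
def saInit : Prog :=
  16 ≔ (V 10 + C 1) / C 3 ⨾ 14 ≔ V 16 + V 10 / C 3 ⨾
  forLt 20 14 (.cond (V 20 ≺ₑ V 16) (.store 4 (V 20) (C 3 * V 20 + C 1))
    (.store 4 (V 20) (C 3 * (V 20 - V 16) + C 2)))

/-- Sorts the sample positions by their triples. -/
def saSort : Prog :=
  15 ≔ V 12 + C 2 ⨾ radix ⨾ 15 ≔ V 12 + C 1 ⨾ radix ⨾ 15 ≔ V 12 ⨾ radix

/-- Names the triples. -/
def saName : Prog :=
  (17 ≔ V 12 + V 10 + C 2 ⨾ 22 ≔ C 0 ⨾ 23 ≔ Rd 4 (C 0)) ⨾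
  forLt 20 14
    (21 ≔ Rd 4 (V 20) ⨾
     22 ≔ V 22 + (C 1 - (Rd 3 (V 12 + V 21) ≡ₑ Rd 3 (V 12 + V 23)) *
       ((Rd 3 (V 12 + V 21 + C 1) ≡ₑ Rd 3 (V 12 + V 23 + C 1)) *
        (Rd 3 (V 12 + V 21 + C 2) ≡ₑ Rd 3 (V 12 + V 23 + C 2)))) ⨾
     23 ≔ V 21 ⨾
     .store 3 (V 17 + (V 21 / C 3 + (V 21 % C 3 - C 1) * V 16)) (V 22))

/-- Saves the level and makes the string of names the current one. -/
def saPush : Prog :=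
  .store 3 (V 17 + V 14) (C 0) ⨾ .store 3 (V 17 + V 14 + C 1) (C 0) ⨾
  .store 10 (V 13) (V 12) ⨾ .store 11 (V 13) (V 10) ⨾ .store 12 (V 13) (V 11) ⨾
  13 ≔ V 13 + C 1 ⨾ 12 ≔ V 17 ⨾ 10 ≔ V 14 ⨾ 11 ≔ V 14

/-- One step down in the recursion. -/
def saDown : Prog := saInit ⨾ saSort ⨾ saName ⨾ saPush

theorem saInit_run {s : State} (hb : Bdd W s) {N : ℕ} (hN : s.reg 10 = N) (hW : 6 * N + 10 < W) :
    ∃ s', Run W saInit s (samples N) s' ∧ s'.reg 14 = samples N ∧ s'.reg 16 = half N ∧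
      ∀ a < samples N, s'.mem 4 a = samplePos N a := by
  have hr₀ := run_den (p := 16 ≔ (V 10 + C 1) / C 3) hb (by simp [Prog.Safe, hN]; omega)
  have hb₀ := hr₀.bdd hb
  have hr₁ := run_den (p := 14 ≔ V 16 + V 10 / C 3) hb₀
    (by simp [Prog.Safe, Prog.den, hN]; omega)
  have hb₁ := hr₁.bdd hb₀
  simp only [Prog.den, val_div, val_add, val_V, val_C, hN, setReg_reg] at hr₀ hr₁ hb₁
  obtain ⟨s', hr, hI, -⟩ := run_for_straight (x := 20) (y := 14)
    (body := .cond (V 20 ≺ₑ V 16) (.store 4 (V 20) (C 3 * V 20 + C 1))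
      (.store 4 (V 20) (C 3 * (V 20 - V 16) + C 2))) hb₁ rfl rfl (N := samples N)
    (by simp [samples])
    (fun k s' => ∀ a < k, s'.mem 4 a = samplePos N a) (by simp)
    (by
      intro k hk s' hb' hf hk' hI
      have f16 : s'.reg 16 = half N := (hf.reg 16 rfl).trans (by simp [half])
      have := half_eq N
      have := samples_eq N
      refine ⟨?_, fun a ha => ?_⟩
      · simp [Prog.Safe, hk', f16]
        split_ifs <;> (try simp) <;> omega
      · by_cases h : k < half N <;>
        · simp [Prog.den, hk', f16, h, Function.update_apply]
          split_ifs with h1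
          · subst h1; simp [samplePos, h]
          · exact hI a (by omega))
  have e14 : s'.reg 14 = samples N :=
    (hr.frame.reg 14 rfl).trans (by simp [samples])
  have e16 : s'.reg 16 = half N :=
    (hr.frame.reg 16 rfl).trans (by simp [half])
  exact ⟨s', (hr₀.seq (hr₁.seq hr)).mono (by omega), e14, e16, hI⟩

/-- Three stable passes, by the third, second and first symbol of the triple, each read at a shifted
offset. The two pads keep the reads at the end of the string within the alphabet bound. -/
theorem saSort_run {s : State} (hb : Bdd W s) {o N A l : ℕ} (hs : IsLevel W s o N A l)
    (h14 : s.reg 14 = samples N) (hL : ∀ a < samples N, s.mem 4 a = samplePos N a) :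
    ∃ s', Run W saSort s (6 * A + 9 * samples N) s' ∧
      (∀ a < samples N, ∃ b < samples N, s'.mem 4 a = samplePos N b) ∧
      (∀ b < samples N, ∃ a < samples N, s'.mem 4 a = samplePos N b) ∧
      ∀ a b, a < b → b < samples N → TripleLt (fun k => s.mem 3 (o + k)) (s'.mem 4 a) (s'.mem 4 b) ∨
        TripleEq (fun k => s.mem 3 (o + k)) (s'.mem 4 a) (s'.mem 4 b) ∧ s'.mem 4 a ≠ s'.mem 4 b := by
  have hW := hs.bound
  have hr₀ := run_den (p := 15 ≔ V 12 + C 2) hb (by simp [Prog.Safe, hs.off]; omega)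
  simp only [Prog.den, val_add, val_V, val_C, hs.off] at hr₀
  have hb₀ := hr₀.bdd hb
  have hlt : ∀ a < samples N, samplePos N a < N := fun a ha => samplePos_lt ha
  obtain ⟨s₁, r₁, h₁⟩ := radix_run hb₀ (N := samples N) (A := A) (o := o + 2) (by simp [h14])
    (by simp [hs.alph]) (by simp) (fun k hk => by
      have := hlt k hk
      simp [hL k hk]; omega) (fun k hk => by
      have := hlt k hk
      simpa [hL k hk, add_assoc] using hs.lt (2 + samplePos N k) (by omega))
  have b₁ := r₁.bdd hb₀
  have f₁ := (hr₀.seq r₁).frame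
  have o₁ : ∀ a < samples N, ∃ b < samples N, s₁.mem 4 a = samplePos N b := fun a ha => by
    obtain ⟨b, hb, h⟩ := h₁.old a ha
    exact ⟨b, hb, h.trans (hL b hb)⟩
  have hr₂ := run_den (p := 15 ≔ V 12 + C 1) b₁
    (by simp [Prog.Safe, f₁.reg 12 rfl, hs.off]; omega)
  simp only [Prog.den, val_add, val_V, val_C, f₁.reg 12 rfl, hs.off] at hr₂
  have b₂ := hr₂.bdd b₁
  obtain ⟨s₃, r₃, h₃⟩ := radix_run b₂ (N := samples N) (A := A) (o := o + 1)
    (by simp [h14, f₁.reg 14 rfl])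
    (by simp [hs.alph, f₁.reg 11 rfl]) (by simp) (fun k hk => by
      obtain ⟨b, hb, h⟩ := o₁ k hk
      have := hlt b hb
      simp [h]; omega) (fun k hk => by
      obtain ⟨b, hb, h⟩ := o₁ k hk
      have := hlt b hb
      simpa [h, add_assoc, f₁.mem 3 rfl] using hs.lt (1 + samplePos N b) (by omega))
  have b₃ := r₃.bdd b₂
  have f₃ := ((hr₀.seq r₁).seq (hr₂.seq r₃)).frame
  have o₃ : ∀ a < samples N, ∃ b < samples N, s₃.mem 4 a = samplePos N b := fun a ha => by
    obtain ⟨b, hb, h⟩ := h₃.old a ha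
    obtain ⟨c, hc, h'⟩ := o₁ b hb
    exact ⟨c, hc, h.trans h'⟩
  have hr₄ := run_den (p := 15 ≔ V 12) b₃ (by simp [Prog.Safe])
  simp only [Prog.den, val_V, f₃.reg 12 rfl, hs.off] at hr₄
  have b₄ := hr₄.bdd b₃
  obtain ⟨s₅, r₅, h₅⟩ := radix_run b₄ (N := samples N) (A := A) (o := o)
    (by simp [h14, f₃.reg 14 rfl])
    (by simp [hs.alph, f₃.reg 11 rfl]) (by simp) (fun k hk => by
      obtain ⟨b, hb, h⟩ := o₃ k hk
      have := hlt b hb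
      simp [h]; omega) (fun k hk => by
      obtain ⟨b, hb, h⟩ := o₃ k hk
      have := hlt b hb
      simpa [h, add_assoc, f₃.mem 3 rfl] using hs.lt (samplePos N b) (by omega))
  simp only [setReg_mem, f₁.mem 3 rfl, f₃.mem 3 rfl] at h₁ h₃ h₅
  refine ⟨s₅, ((hr₀.seq (r₁.seq (hr₂.seq (r₃.seq (hr₄.seq r₅)))))).mono (by omega), ?_, ?_, ?_⟩
  · intro a ha
    obtain ⟨b, hb, h⟩ := h₅.old a ha
    obtain ⟨c, hc, h'⟩ := o₃ b hb
    exact ⟨c, hc, h.trans h'⟩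
  · intro b hb
    obtain ⟨a, ha, h⟩ := h₁.new b hb
    obtain ⟨a', ha', h'⟩ := h₃.new a ha
    obtain ⟨a'', ha'', h''⟩ := h₅.new a' ha'
    exact ⟨a'', ha'', h''.trans (h'.trans (h.trans (hL b hb)))⟩
  · intro a b hab hb
    -- Distinctness of the listed positions is the initial relation, carried as the last component
    -- through all three passes.
    have q₁ := h₁.sorted (fun p q => p ≠ q) (by
      intro a b hab hb h
      rw [hL a (hab.trans hb), hL b hb] at h
      have := congrArg (sampleIdx N) h
      rw [sampleIdx_samplePos, sampleIdx_samplePos] at this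
      omega)
    have q₃ := h₃.sorted (fun p q => s.mem 3 (o + 2 + p) < s.mem 3 (o + 2 + q) ∨
      s.mem 3 (o + 2 + p) = s.mem 3 (o + 2 + q) ∧ p ≠ q) q₁
    have q := h₅.sorted (fun p q => s.mem 3 (o + 1 + p) < s.mem 3 (o + 1 + q) ∨
      s.mem 3 (o + 1 + p) = s.mem 3 (o + 1 + q) ∧ (s.mem 3 (o + 2 + p) < s.mem 3 (o + 2 + q) ∨
      s.mem 3 (o + 2 + p) = s.mem 3 (o + 2 + q) ∧ p ≠ q)) q₃ a b hab hb
    have e : ∀ x d, s.mem 3 (o + (x + d)) = s.mem 3 (o + d + x) := fun x d => by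
      rw [add_comm x d, ← add_assoc]
    simp only [TripleLt, TripleEq, e]
    tauto

/-- The product of comparison bits is the conjunction. The equations on the logical side are turned
round because the program compares the current triple with the previous one, while `TripleEq` is
used with the previous one first. -/
theorem triple_test (x y x' y' x'' y'' : ℕ) :
    (if x = y then 1 else 0) * ((if x' = y' then 1 else 0) * (if x'' = y'' then 1 else 0)) = 0 ∧
      ¬ (y = x ∧ y' = x' ∧ y'' = x'') ∨
    (if x = y then 1 else 0) * ((if x' = y' then 1 else 0) * (if x'' = y'' then 1 else 0)) = 1 ∧
      (y = x ∧ y' = x' ∧ y'' = x'') := by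
  split_ifs <;> omega

/-- The name is a counter raised whenever a triple of the sorted list differs from its predecessor.
The a-th item gets a name at most a, so the names form an alphabet of size `samples N`. -/
theorem saName_run {s : State} (hb : Bdd W s) {o N A l : ℕ} (hs : IsLevel W s o N A l)
    (hN : 1 < N) (h14 : s.reg 14 = samples N) (h16 : s.reg 16 = half N)
    (hold : ∀ a < samples N, ∃ b < samples N, s.mem 4 a = samplePos N b)
    (hnew : ∀ b < samples N, ∃ a < samples N, s.mem 4 a = samplePos N b)
    (hsort : ∀ a b, a < b → b < samples N →
      TripleLt (fun k => s.mem 3 (o + k)) (s.mem 4 a) (s.mem 4 b) ∨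
      TripleEq (fun k => s.mem 3 (o + k)) (s.mem 4 a) (s.mem 4 b) ∧ s.mem 4 a ≠ s.mem 4 b) :
    ∃ s', Run W saName s (samples N) s' ∧ s'.reg 17 = o + N + 2 ∧
      (∀ k < o + N + 2, s'.mem 3 k = s.mem 3 k) ∧
      (∀ a < samples N, s'.mem 3 (o + N + 2 + a) < samples N) ∧
      Reduces (fun k => s.mem 3 (o + k)) N (fun k => s'.mem 3 (o + N + 2 + k)) := by
  have hW := hs.bound
  have hsl := samples_le N
  have hsp := samples_pos hN
  have hlt : ∀ a < samples N, s.mem 4 a < N ∧ s.mem 4 a % 3 ≠ 0 := fun a ha => by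
    obtain ⟨b, hb, h⟩ := hold a ha
    rw [h]; exact ⟨samplePos_lt hb, samplePos_mod⟩
  have hr₀ := run_den (p := (17 ≔ V 12 + V 10 + C 2 ⨾ 22 ≔ C 0 ⨾ 23 ≔ Rd 4 (C 0))) hb
    (by simp [Prog.Safe, Prog.den, hs.off, hs.len]; omega)
  have hb₀ := hr₀.bdd hb
  simp only [Prog.den, val_add, val_V, val_C, val_Rd, hs.off, hs.len, setReg_mem] at hr₀ hb₀
  set T := fun k => s.mem 3 (o + k) with hT
  obtain ⟨s', hr, ⟨hX, hn, hord, -, -⟩, -⟩ := run_for_straight (x := 20) (y := 14)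
    (body := (21 ≔ Rd 4 (V 20) ⨾
     22 ≔ V 22 + (C 1 - (Rd 3 (V 12 + V 21) ≡ₑ Rd 3 (V 12 + V 23)) *
       ((Rd 3 (V 12 + V 21 + C 1) ≡ₑ Rd 3 (V 12 + V 23 + C 1)) *
        (Rd 3 (V 12 + V 21 + C 2) ≡ₑ Rd 3 (V 12 + V 23 + C 2)))) ⨾
     23 ≔ V 21 ⨾
     .store 3 (V 17 + (V 21 / C 3 + (V 21 % C 3 - C 1) * V 16)) (V 22)))
    hb₀ rfl rfl (N := samples N) (by simp [h14])
    (fun k s' => (∀ x < o + N + 2, s'.mem 3 x = s.mem 3 x) ∧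
      (∀ a < k, s'.mem 3 (o + N + 2 + sampleIdx N (s.mem 4 a)) ≤ a) ∧
      (∀ a b, a < b → b < k →
        (TripleEq T (s.mem 4 a) (s.mem 4 b) ∧ s'.mem 3 (o + N + 2 + sampleIdx N (s.mem 4 a)) =
          s'.mem 3 (o + N + 2 + sampleIdx N (s.mem 4 b))) ∨
        (TripleLt T (s.mem 4 a) (s.mem 4 b) ∧ s'.mem 3 (o + N + 2 + sampleIdx N (s.mem 4 a)) <
          s'.mem 3 (o + N + 2 + sampleIdx N (s.mem 4 b)))) ∧
      s'.reg 23 = s.mem 4 (k - 1) ∧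
      s'.reg 22 = if k = 0 then 0 else s'.mem 3 (o + N + 2 + sampleIdx N (s.mem 4 (k - 1))))
    (by simp)
    (by
      intro k hk s' hb' hf hk' ⟨hX, hn, hord, h23, h22⟩
      have f12 : s'.reg 12 = o := (hf.reg 12 rfl).trans (by simp [hs.off])
      have f16 : s'.reg 16 = half N := (hf.reg 16 rfl).trans (by simp [h16])
      have f17 : s'.reg 17 = o + N + 2 := (hf.reg 17 rfl).trans (by simp)
      have f4 : s'.mem 4 = s.mem 4 := (hf.mem 4 rfl).trans (by simp)
      obtain ⟨l1, m1⟩ := hlt k hk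
      obtain ⟨l2, m2⟩ := hlt (k - 1) (by omega)
      have hi := sampleIdx_lt l1 m1
      have ediv : s.mem 4 k / 3 + (s.mem 4 k % 3 - 1) * half N = sampleIdx N (s.mem 4 k) := rfl
      have h22' : s'.reg 22 ≤ k - 1 := by
        rw [h22]; split_ifs with h
        · omega
        · exact hn _ (by omega)
      set e := (if T (s.mem 4 k) = T (s.mem 4 (k - 1)) then 1 else 0) *
        ((if T (s.mem 4 k + 1) = T (s.mem 4 (k - 1) + 1) then 1 else 0) *
        (if T (s.mem 4 k + 2) = T (s.mem 4 (k - 1) + 2) then 1 else 0)) with he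
      have hX' : ∀ x d, x < N → d < 3 → s'.mem 3 (o + x + d) = T (x + d) := fun x d hx hd => by
        rw [hX _ (by omega), hT, add_assoc]
      have hX0 : ∀ x, x < N → s'.mem 3 (o + x) = T x := fun x hx => hX' x 0 hx (by omega)
      have e01 : e = 0 ∧ ¬ TripleEq T (s.mem 4 (k - 1)) (s.mem 4 k) ∨
          e = 1 ∧ TripleEq T (s.mem 4 (k - 1)) (s.mem 4 k) := by
        exact triple_test _ _ _ _ _ _
      -- Different samples have different cells, so the new name overwrites no earlier one.
      have hinj : ∀ a < k, sampleIdx N (s.mem 4 a) ≠ sampleIdx N (s.mem 4 k) := by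
        intro a ha h
        obtain ⟨l3, m3⟩ := hlt a (by omega)
        have : s.mem 4 a = s.mem 4 k := by
          rw [← samplePos_sampleIdx l3 m3, h, samplePos_sampleIdx l1 m1]
        rcases hsort a k ha hk with h' | h'
        · exact h'.slt.ne this
        · exact h'.2 this
      have hden : ((21 ≔ Rd 4 (V 20) ⨾
         22 ≔ V 22 + (C 1 - (Rd 3 (V 12 + V 21) ≡ₑ Rd 3 (V 12 + V 23)) *
           ((Rd 3 (V 12 + V 21 + C 1) ≡ₑ Rd 3 (V 12 + V 23 + C 1)) *
            (Rd 3 (V 12 + V 21 + C 2) ≡ₑ Rd 3 (V 12 + V 23 + C 2)))) ⨾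
         23 ≔ V 21 ⨾
         .store 3 (V 17 + (V 21 / C 3 + (V 21 % C 3 - C 1) * V 16)) (V 22)) : Prog).den s' =
         (((s'.setReg 21 (s.mem 4 k)).setReg 22 (s'.reg 22 + (1 - e))).setReg 23
          (s.mem 4 k)).setMem 3 (o + N + 2 + sampleIdx N (s.mem 4 k)) (s'.reg 22 + (1 - e)) := by
        simp [Prog.den, hk', f4, f12, f17, f16, h23, hX0 _ l1, hX0 _ l2, hX' _ 1 l1, hX' _ 2 l1,
          hX' _ 1 l2, hX' _ 2 l2, ediv, he]
      have hee : ∀ b : Prop, ∀ [Decidable b], (if b then 1 else 0) ≤ 1 := by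
        intro b _; split_ifs <;> omega
      refine ⟨?_, ?_⟩
      · simp [Prog.Safe, Prog.den, hk', f4, f12, f17, f16, h23, hX0 _ l1, hX0 _ l2, hX' _ 1 l1,
          hX' _ 2 l1, hX' _ 1 l2, hX' _ 2 l2, ediv]
        rcases sampleIdx_eq (N := N) m1 with h | h <;> rw [h.1] <;> simp <;>
          split_ifs <;> simp <;> omega
      · rw [hden]
        have hν : ∀ a < k, Function.update (s'.mem 3) (o + N + 2 + sampleIdx N (s.mem 4 k))
            (s'.reg 22 + (1 - e)) (o + N + 2 + sampleIdx N (s.mem 4 a)) =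
            s'.mem 3 (o + N + 2 + sampleIdx N (s.mem 4 a)) := fun a ha => by
          rw [Function.update_apply, if_neg]
          have := hinj a ha
          omega
        have hlast : 0 < k →
            (TripleEq T (s.mem 4 (k - 1)) (s.mem 4 k) ∧
              s'.mem 3 (o + N + 2 + sampleIdx N (s.mem 4 (k - 1))) = s'.reg 22 + (1 - e)) ∨
            (TripleLt T (s.mem 4 (k - 1)) (s.mem 4 k) ∧
              s'.mem 3 (o + N + 2 + sampleIdx N (s.mem 4 (k - 1))) < s'.reg 22 + (1 - e)) := by
          intro h0
          rw [if_neg (by omega)] at h22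
          rcases e01 with h | h
          · refine .inr ⟨?_, by omega⟩
            rcases hsort (k - 1) k (by omega) hk with h' | h'
            · exact h'
            · exact absurd h'.1 h.2
          · exact .inl ⟨h.2, by omega⟩
        refine ⟨fun x hx => ?_, fun a ha => ?_, fun a b hab hb => ?_, by simp, ?_⟩
        · simp only [setReg_mem, setMem_mem, if_true]
          rw [Function.update_apply, if_neg (by omega)]
          exact hX x hx
        · simp only [setReg_mem, setMem_mem, if_true]
          rcases Nat.lt_succ_iff_lt_or_eq.1 ha with h | h
          · rw [hν a h]; exact hn a h
          · subst h
            rw [Function.update_self]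
            by_cases h0 : a = 0
            · subst h0
              -- The first item is compared with itself (register 23 was preset to it, and k - 1 = 0
              -- for k = 0), so its name is 0.
              have : e = 1 := by simp [he]
              rw [h22, this]; simp
            · omega
        · simp only [setReg_mem, setMem_mem, if_true]
          rcases Nat.lt_succ_iff_lt_or_eq.1 hb with h | h
          · rw [hν a (by omega), hν b h]; exact hord a b hab h
          · subst h
            rw [hν a hab, Function.update_self]
            have hl := hlast (by omega)
            rcases Nat.lt_or_ge a (b - 1) with h1 | h1
            · have hm := hord a (b - 1) h1 (by omega)
              simp only [TripleEq, TripleLt] at hl hm ⊢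
              omega
            · obtain rfl : a = b - 1 := by omega
              exact hl
        · simp)
  have hf := hr.frame
  refine ⟨s', (hr₀.seq hr).mono (by omega), (hf.reg 17 rfl).trans (by simp), hX, ?_, ?_⟩
  · intro a ha
    obtain ⟨k, hk, h⟩ := hnew a ha
    have := hn k hk
    rw [h, sampleIdx_samplePos] at this
    omega
  · have key : ∀ a < samples N, ∀ b < samples N,
        (TripleLt T (samplePos N a) (samplePos N b) →
          s'.mem 3 (o + N + 2 + a) < s'.mem 3 (o + N + 2 + b)) ∧
        (TripleEq T (samplePos N a) (samplePos N b) →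
          s'.mem 3 (o + N + 2 + a) = s'.mem 3 (o + N + 2 + b)) := by
      intro a ha b hb
      obtain ⟨k, hk, h⟩ := hnew a ha
      obtain ⟨m, hm, h'⟩ := hnew b hb
      rcases lt_trichotomy k m with hkm | hkm | hkm
      · have := hord k m hkm hm
        rw [h, h', sampleIdx_samplePos, sampleIdx_samplePos] at this
        simp only [TripleEq, TripleLt] at this ⊢
        omega
      · subst hkm
        have hab : a = b := by
          rw [← sampleIdx_samplePos (N := N) (a := a), ← h, h', sampleIdx_samplePos]
        subst hab
        exact ⟨fun h => absurd rfl h.slt.ne, fun _ => rfl⟩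
      · have := hord m k hkm hk
        rw [h, h', sampleIdx_samplePos, sampleIdx_samplePos] at this
        simp only [TripleEq, TripleLt] at this ⊢
        omega
    exact ⟨fun a ha b hb => (key a ha b hb).1, fun a ha b hb => (key a ha b hb).2⟩

end WordRAM

/-! ### Suffix array construction: from the samples to all suffixes -/

namespace WordRAM

variable {W : ℕ}

theorem saPush_run {s : State} (hb : Bdd W s) {o N A l : ℕ} (hs : IsLevel W s o N A l) {R : ℕ → ℕ}
    (hN : 1 < N) (h14 : s.reg 14 = samples N) (h17 : s.reg 17 = o + N + 2)
    (hR : ∀ a < samples N, s.mem 3 (o + N + 2 + a) < samples N)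
    (hRe : Reduces (fun k => s.mem 3 (o + k)) N R)
    (hRm : ∀ a < samples N, s.mem 3 (o + N + 2 + a) = R a) :
    ∃ s', Run W saPush s 0 s' ∧ IsLevel W s' (o + N + 2) (samples N) (samples N) (l + 1) ∧
      (∀ k < o + N + 2 + samples N, s'.mem 3 k = s.mem 3 k) ∧
      s'.mem 10 = Function.update (s.mem 10) l o ∧ s'.mem 11 = Function.update (s.mem 11) l N ∧
      s'.mem 12 = Function.update (s.mem 12) l A := by
  obtain ⟨h10, h11, h12, h13, hu, hlt, hW, hl⟩ := hs
  have hsl := samples_le N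
  have hsp := samples_pos hN
  have hr := run_den (p := saPush) hb
    (by simp [saPush, Prog.Safe, Prog.den, h14, h17, h13]; omega)
  simp only [saPush, Prog.den, val_V, val_C, val_add, setMem_reg, setReg_reg, h14, h17, h13, h10,
    h11, h12, Nat.reduceEqDiff, if_false] at hr
  -- The space bounds are inherited: since 3 * samples N ≤ 2 * N and N ≥ 2, one has (N + 2) + 6 *
  -- samples N ≤ 5N + 2 ≤ 6N and 1 + samples N ≤ N.
  refine ⟨_, hr, ⟨by simp, by simp, by simp, by simp, ?_, ?_, by omega, by omega⟩, ?_, by simp,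
    by simp, by simp⟩
  · refine (hRe.uniqLast hu hN).congr fun k hk => ?_
    simp [Function.update_apply, if_neg (show k ≠ samples N by omega),
      if_neg (show o + N + 2 + k ≠ o + N + 2 + samples N + 1 by omega), hRm k hk]
  · intro k hk
    simp [Function.update_apply]
    split_ifs with h1 h2
    · exact hsp
    · exact hsp
    · exact hR k (by omega)
  · intro k hk
    simp [Function.update_apply]
    rw [if_neg (by omega), if_neg (by omega)]

theorem saDown_run {s : State} (hb : Bdd W s) {o N A l : ℕ} (hs : IsLevel W s o N A l)
    (hN : 1 < N) :
    ∃ s', Run W saDown s (6 * A + 11 * samples N) s' ∧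
      IsLevel W s' (o + N + 2) (samples N) (samples N) (l + 1) ∧
      (∀ k < o + N + 2, s'.mem 3 k = s.mem 3 k) ∧
      Reduces (fun k => s.mem 3 (o + k)) N (fun k => s'.mem 3 (o + N + 2 + k)) ∧
      s'.mem 10 = Function.update (s.mem 10) l o ∧ s'.mem 11 = Function.update (s.mem 11) l N ∧
      s'.mem 12 = Function.update (s.mem 12) l A := by
  have lev : ∀ {s' : State}, s'.reg 10 = s.reg 10 → s'.reg 11 = s.reg 11 → s'.reg 12 = s.reg 12 →
      s'.reg 13 = s.reg 13 → (∀ k < o + N + 2, s'.mem 3 k = s.mem 3 k) → IsLevel W s' o N A l :=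
    fun h10 h11 h12 h13 h3 => ⟨h10.trans hs.len, h11.trans hs.alph, h12.trans hs.off,
      h13.trans hs.lev, hs.uniq.congr fun k hk => (h3 _ (by omega)).symm,
      fun k hk => by rw [h3 _ (by omega)]; exact hs.lt k hk, hs.bound, hs.lev_bound⟩
  obtain ⟨s₁, r₁, h14, h16, hL⟩ := saInit_run hb hs.len (by have := hs.bound; omega)
  have b₁ := r₁.bdd hb
  have f₁ := r₁.frame
  have l₁ := lev (f₁.reg 10 rfl) (f₁.reg 11 rfl) (f₁.reg 12 rfl) (f₁.reg 13 rfl)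
    (fun k _ => by rw [f₁.mem 3 rfl])
  obtain ⟨s₂, r₂, hold, hnew, hsort⟩ := saSort_run b₁ l₁ h14 hL
  have b₂ := r₂.bdd b₁
  have f₂ := r₂.frame
  have f₂' := (r₁.seq r₂).frame
  have l₂ := lev (f₂'.reg 10 rfl) (f₂'.reg 11 rfl) (f₂'.reg 12 rfl) (f₂'.reg 13 rfl)
    (fun k _ => by rw [f₂'.mem 3 rfl])
  rw [← f₂.mem 3 rfl] at hsort
  obtain ⟨s₃, r₃, h17, h3, hR, hRe⟩ := saName_run b₂ l₂ hN ((f₂.reg 14 rfl).trans h14)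
    ((f₂.reg 16 rfl).trans h16) hold hnew hsort
  have b₃ := r₃.bdd b₂
  have f₃ := r₃.frame
  have f₃' := (r₁.seq (r₂.seq r₃)).frame
  rw [f₂'.mem 3 rfl] at h3 hRe
  have l₃ := lev (f₃'.reg 10 rfl) (f₃'.reg 11 rfl) (f₃'.reg 12 rfl) (f₃'.reg 13 rfl) h3
  have hu := hs.uniq
  -- Triples at samples extend at most to the two pads, which lie below the region of the names and
  -- are unchanged.
  have hRe₃ : Reduces (fun k => s₃.mem 3 (o + k)) N (fun k => s₃.mem 3 (o + N + 2 + k)) := by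
    have e : ∀ p < samples N, ∀ d < 3,
        s₃.mem 3 (o + (samplePos N p + d)) = s.mem 3 (o + (samplePos N p + d)) := fun p hp d hd => by
      have := samplePos_lt hp
      exact h3 _ (by omega)
    have e0 := fun p hp => e p hp 0 (by omega)
    have e1 := fun p hp => e p hp 1 (by omega)
    have e2 := fun p hp => e p hp 2 (by omega)
    simp only [add_zero] at e0
    refine ⟨fun a ha b hb h => hRe.lt a ha b hb ?_, fun a ha b hb h => hRe.eq a ha b hb ?_⟩
    · simpa only [TripleLt, e0 a ha, e0 b hb, e1 a ha, e1 b hb, e2 a ha, e2 b hb] using h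
    · simpa only [TripleEq, e0 a ha, e0 b hb, e1 a ha, e1 b hb, e2 a ha, e2 b hb] using h
  obtain ⟨s₄, r₄, l₄, h3', h10, h11, h12⟩ := saPush_run b₃ l₃ hN
    ((f₃.reg 14 rfl).trans ((f₂.reg 14 rfl).trans h14)) h17 hR hRe₃ (fun _ _ => rfl)
  refine ⟨s₄, (r₁.seq (r₂.seq (r₃.seq r₄))).mono (by omega), l₄,
    fun k hk => (h3' k (by omega)).trans (h3 k hk), ?_, ?_, ?_, ?_⟩
  · exact ⟨fun a ha b hb h => by
      rw [h3' _ (by omega), h3' _ (by omega)]; exact hRe.lt a ha b hb h,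
      fun a ha b hb h => by
      rw [h3' _ (by omega), h3' _ (by omega)]; exact hRe.eq a ha b hb h⟩
  · rw [h10, f₃'.mem 10 rfl]
  · rw [h11, f₃'.mem 11 rfl]
  · rw [h12, f₃'.mem 12 rfl]

/-- Restores the saved level. -/
def saPop : Prog :=
  13 ≔ V 13 - C 1 ⨾ 12 ≔ Rd 10 (V 13) ⨾ 10 ≔ Rd 11 (V 13) ⨾ 11 ≔ Rd 12 (V 13) ⨾
  16 ≔ (V 10 + C 1) / C 3 ⨾ 18 ≔ V 16 + V 10 / C 3 ⨾ 19 ≔ (V 10 + C 2) / C 3 ⨾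
  17 ≔ V 12 + V 10 + C 2 ⨾ .store 3 (V 17 + V 10) (C 0)

/-- Lists the sorted sample positions in array `9`, and stores their ranks. -/
def saRank : Prog := forLt 20 18
  (21 ≔ Rd 7 (V 20) ⨾
   .cond (V 21 ≺ₑ V 16) (21 ≔ C 3 * V 21 + C 1) (21 ≔ C 3 * (V 21 - V 16) + C 2) ⨾
   .store 9 (V 20) (V 21) ⨾ .store 3 (V 17 + V 21) (V 20))

/-- Sorts the remaining positions. -/
def saZero : Prog :=
  (14 ≔ V 19 ⨾ 28 ≔ V 11 ⨾ 11 ≔ V 18 ⨾ 15 ≔ V 17 + C 1) ⨾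
  forLt 20 14 (.store 4 (V 20) (C 3 * V 20)) ⨾ radix ⨾ (11 ≔ V 28 ⨾ 15 ≔ V 12) ⨾ radix

theorem saPop_run {s : State} (hb : Bdd W s) {o N A l : ℕ} (h13 : s.reg 13 = l + 1)
    (h10 : s.mem 10 l = o) (h11 : s.mem 11 l = N) (h12 : s.mem 12 l = A)
    (hW : o + 6 * N + 10 < W) :
    ∃ s', Run W saPop s 0 s' ∧ s'.reg 13 = l ∧ s'.reg 12 = o ∧ s'.reg 10 = N ∧ s'.reg 11 = A ∧
      s'.reg 16 = half N ∧ s'.reg 18 = samples N ∧ s'.reg 19 = (N + 2) / 3 ∧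
      s'.reg 17 = o + N + 2 ∧ s'.mem 3 = Function.update (s.mem 3) (o + N + 2 + N) 0 := by
  have hr := run_den (p := saPop) hb
    (by simp [saPop, Prog.Safe, Prog.den, h10, h11, h12, h13]; omega)
  refine ⟨_, hr, ?_⟩
  simp [saPop, Prog.den, h10, h11, h12, h13, half, samples]

/-- The ranks, indexed by position, overwrite the names of the finished level. The reduced string
therefore enters as an abstract function R and not as memory contents. -/
theorem saRank_run {s : State} (hb : Bdd W s) {o N : ℕ} {R : ℕ → ℕ}
    (hW : o + 6 * N + 10 < W) (h16 : s.reg 16 = half N) (h18 : s.reg 18 = samples N)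
    (h17 : s.reg 17 = o + N + 2) (hsa : IsSA R (samples N) (s.mem 7)) :
    ∃ s', Run W saRank s (samples N) s' ∧
      (∀ a < samples N, s'.mem 9 a = samplePos N (s.mem 7 a)) ∧
      (∀ a < samples N, s'.mem 3 (o + N + 2 + samplePos N (s.mem 7 a)) = a) ∧
      s'.mem 3 (o + N + 2 + N) = s.mem 3 (o + N + 2 + N) ∧
      ∀ k < o + N + 2, s'.mem 3 k = s.mem 3 k := by
  obtain ⟨s', hr, hI, -⟩ := run_for_straight (x := 20) (y := 18)
    (body := (21 ≔ Rd 7 (V 20) ⨾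
     .cond (V 21 ≺ₑ V 16) (21 ≔ C 3 * V 21 + C 1) (21 ≔ C 3 * (V 21 - V 16) + C 2) ⨾
     .store 9 (V 20) (V 21) ⨾ .store 3 (V 17 + V 21) (V 20))) hb rfl rfl h18
    (fun k s' => (∀ a < k, s'.mem 9 a = samplePos N (s.mem 7 a)) ∧
      (∀ a < k, s'.mem 3 (o + N + 2 + samplePos N (s.mem 7 a)) = a) ∧
      s'.mem 3 (o + N + 2 + N) = s.mem 3 (o + N + 2 + N) ∧
      ∀ k < o + N + 2, s'.mem 3 k = s.mem 3 k) (by simp)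
    (by
      intro k hk s' hb' hf hk' ⟨h9, h3, hz, hX⟩
      have f16 : s'.reg 16 = half N := (hf.reg 16 rfl).trans h16
      have f17 : s'.reg 17 = o + N + 2 := (hf.reg 17 rfl).trans h17
      have f7 := hf.mem 7 rfl
      have hkl := hsa.lt k hk
      have hp := samplePos_lt hkl
      have hd : ((21 ≔ Rd 7 (V 20) ⨾
          .cond (V 21 ≺ₑ V 16) (21 ≔ C 3 * V 21 + C 1) (21 ≔ C 3 * (V 21 - V 16) + C 2) ⨾
          .store 9 (V 20) (V 21) ⨾ .store 3 (V 17 + V 21) (V 20)) : Prog).den s' =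
          (((s'.setReg 21 (s.mem 7 k)).setReg 21 (samplePos N (s.mem 7 k))).setMem 9 k
            (samplePos N (s.mem 7 k))).setMem 3 (o + N + 2 + samplePos N (s.mem 7 k)) k := by
        by_cases h : s.mem 7 k < half N <;>
          simp [Prog.den, hk', f7, f16, f17, samplePos, h]
      refine ⟨?_, ?_⟩
      · rcases samplePos_eq N (s.mem 7 k) with h | h
        · have := half_eq N
          simp [Prog.Safe, Prog.den, hk', f7, f16, f17, h.1]
          omega
        · have := half_eq N
          simp [Prog.Safe, Prog.den, hk', f7, f16, f17, if_neg (not_lt.2 h.1)]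
          omega
      · rw [hd]
        simp only [setReg_mem, setMem_mem, Nat.reduceEqDiff, if_true, if_false,
          Function.update_apply]
        refine ⟨fun a ha => ?_, fun a ha => ?_, ?_, fun x hx => ?_⟩
        · split_ifs with h
          · rw [h]
          · exact h9 a (by omega)
        · split_ifs with h
          · have h' : samplePos N (s.mem 7 a) = samplePos N (s.mem 7 k) := by omega
            have := congrArg (sampleIdx N) h'
            rw [sampleIdx_samplePos, sampleIdx_samplePos] at this
            exact (hsa.injOn (by omega) hk this).symm
          · refine h3 a ?_
            rcases Nat.lt_succ_iff_lt_or_eq.1 ha with h1 | h1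
            · exact h1
            · subst h1; exact absurd rfl h
        · rw [if_neg (by omega), hz]
        · rw [if_neg (by omega), hX x hx])
  exact ⟨s', hr, hI⟩

/-- A suffix at p ≡ 0 mod 3 is determined in order by its first symbol and the rank of the sample
suffix at p + 1; two stable passes sort by this pair. The offset o + N + 3 reads the rank at p + 1.
-/
theorem saZero_run {s : State} (hb : Bdd W s) {o N A : ℕ} (hN : 1 < N)
    (hW : o + 6 * N + 10 < W) (h11 : s.reg 11 = A) (h12 : s.reg 12 = o)
    (h17 : s.reg 17 = o + N + 2) (h18 : s.reg 18 = samples N) (h19 : s.reg 19 = (N + 2) / 3)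
    (hlt : ∀ k < N, s.mem 3 (o + k) < A)
    (hrk : ∀ p < N, p % 3 ≠ 0 → s.mem 3 (o + N + 2 + p) < samples N)
    (hz : s.mem 3 (o + N + 2 + N) = 0) :
    ∃ s', Run W saZero s (2 * A + 2 * samples N + 7 * ((N + 2) / 3)) s' ∧
      (∀ a < (N + 2) / 3, s'.mem 4 a < N ∧ s'.mem 4 a % 3 = 0) ∧
      ∀ a b, a < b → b < (N + 2) / 3 →
        s.mem 3 (o + s'.mem 4 a) < s.mem 3 (o + s'.mem 4 b) ∨
        s.mem 3 (o + s'.mem 4 a) = s.mem 3 (o + s'.mem 4 b) ∧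
        (s.mem 3 (o + N + 3 + s'.mem 4 a) < s.mem 3 (o + N + 3 + s'.mem 4 b) ∨
          s.mem 3 (o + N + 3 + s'.mem 4 a) = s.mem 3 (o + N + 3 + s'.mem 4 b) ∧
          s'.mem 4 a ≠ s'.mem 4 b) := by
  have hsp := samples_pos hN
  have r₁ := run_den (p := (14 ≔ V 19 ⨾ 28 ≔ V 11 ⨾ 11 ≔ V 18 ⨾ 15 ≔ V 17 + C 1)) hb
    (by simp [Prog.Safe, Prog.den, h17]; omega)
  have b₁ := r₁.bdd hb
  simp only [Prog.den, val_V, val_C, val_add, setReg_reg, h11, h17, h18, h19, Nat.reduceEqDiff,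
    if_false] at r₁ b₁
  obtain ⟨s₂, r₂, h₂, -⟩ := run_for_straight (x := 20) (y := 14)
    (body := .store 4 (V 20) (C 3 * V 20)) b₁ rfl rfl (N := (N + 2) / 3) (by simp)
    (fun k s' => ∀ a < k, s'.mem 4 a = 3 * a) (by simp)
    (by
      intro k hk s' hb' hf hk' hI
      refine ⟨by simp [Prog.Safe, hk']; omega, fun a ha => ?_⟩
      simp [Prog.den, hk', Function.update_apply]
      split_ifs with h
      · rw [h]
      · exact hI a (by omega))
  have b₂ := r₂.bdd b₁
  have f₂ := r₂.frame
  have e₂ : s₂.mem 3 = s.mem 3 := (f₂.mem 3 rfl).trans (by simp)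
  obtain ⟨s₃, r₃, h₃⟩ := radix_run b₂ (N := (N + 2) / 3) (A := samples N) (o := o + N + 3)
    (by simp [f₂.reg 14 rfl]) (by simp [f₂.reg 11 rfl]) (by simp [f₂.reg 15 rfl])
    (fun k hk => by rw [h₂ k hk]; omega) (fun k hk => by
      rw [h₂ k hk, e₂]
      -- If p = 3k is the last position, p + 1 = N has no rank; the cell there was preset to 0, a
      -- valid key.
      rcases Nat.lt_or_ge (3 * k + 1) N with h | h
      · have := hrk (3 * k + 1) h (by omega)
        rwa [show o + N + 2 + (3 * k + 1) = o + N + 3 + 3 * k by ring] at this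
      · rw [show o + N + 3 + 3 * k = o + N + 2 + N by omega, hz]; exact hsp)
  rw [e₂] at h₃
  have b₃ := r₃.bdd b₂
  have f₃ := r₃.frame
  have o₃ : ∀ a < (N + 2) / 3, s₃.mem 4 a < N ∧ s₃.mem 4 a % 3 = 0 := fun a ha => by
    obtain ⟨b, hb, h⟩ := h₃.old a ha
    rw [h, h₂ b hb]; omega
  have r₄ := run_den (p := (11 ≔ V 28 ⨾ 15 ≔ V 12)) b₃ (by simp [Prog.Safe])
  have b₄ := r₄.bdd b₃
  have f₄ := (r₂.seq r₃).frame
  have e12 : s₃.reg 12 = o := (f₄.reg 12 rfl).trans (by simp [h12])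
  have e28 : s₃.reg 28 = A := (f₄.reg 28 rfl).trans (by simp)
  have e14 : s₃.reg 14 = (N + 2) / 3 := (f₄.reg 14 rfl).trans (by simp)
  have e3 : s₃.mem 3 = s.mem 3 := (f₄.mem 3 rfl).trans (by simp)
  simp only [Prog.den, val_V, setReg_reg, e12, e28, Nat.reduceEqDiff, if_false] at r₄ b₄
  obtain ⟨s₅, r₅, h₅⟩ := radix_run b₄ (N := (N + 2) / 3) (A := A) (o := o)
    (by simp [e14]) (by simp) (by simp)
    (fun k hk => by have := o₃ k hk; simp; omega) (fun k hk => by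
      have := o₃ k hk
      simp [e3, hlt _ this.1])
  simp only [setReg_mem, e3] at h₅
  refine ⟨s₅, (r₁.seq (r₂.seq (r₃.seq (r₄.seq r₅)))).mono (by omega), fun a ha => ?_, ?_⟩
  · obtain ⟨b, hb, h⟩ := h₅.old a ha
    rw [h]; exact o₃ b hb
  · have q₁ := h₃.sorted (fun p q => p ≠ q) (by
      intro a b hab hb
      rw [h₂ a (by omega), h₂ b hb]; omega)
    exact h₅.sorted (fun p q => s.mem 3 (o + N + 3 + p) < s.mem 3 (o + N + 3 + q) ∨
      s.mem 3 (o + N + 3 + p) = s.mem 3 (o + N + 3 + q) ∧ p ≠ q) q₁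

end WordRAM

/-! ### Suffix array construction: merging, and the whole recursion -/

namespace WordRAM

variable {W : ℕ}

/-- Decides whether the next position is taken from array `4` (`reg 27 ≠ 0`) or array `9`. -/
def saPick : Prog :=
  (25 ≔ Rd 4 (V 23) ⨾ 26 ≔ Rd 9 (V 24)) ⨾
  .cond (V 24 ≺ₑ V 18)
    (.cond (V 23 ≺ₑ V 19)
      (.cond (V 26 % C 3 ≡ₑ C 1)
        (27 ≔ (Rd 3 (V 12 + V 25) ≺ₑ Rd 3 (V 12 + V 26)) +
          (Rd 3 (V 12 + V 25) ≡ₑ Rd 3 (V 12 + V 26)) *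
            (Rd 3 (V 17 + V 25 + C 1) ≺ₑ Rd 3 (V 17 + V 26 + C 1)))
        (27 ≔ (Rd 3 (V 12 + V 25) ≺ₑ Rd 3 (V 12 + V 26)) +
          (Rd 3 (V 12 + V 25) ≡ₑ Rd 3 (V 12 + V 26)) *
            ((Rd 3 (V 12 + V 25 + C 1) ≺ₑ Rd 3 (V 12 + V 26 + C 1)) +
             (Rd 3 (V 12 + V 25 + C 1) ≡ₑ Rd 3 (V 12 + V 26 + C 1)) *
              (Rd 3 (V 17 + V 25 + C 2) ≺ₑ Rd 3 (V 17 + V 26 + C 2)))))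
      (27 ≔ C 0))
    (27 ≔ C 1)

/-- Takes the position decided upon. -/
def saTake : Prog :=
  .cond (V 27) (.store 7 (V 20) (V 25) ⨾ 23 ≔ V 23 + C 1)
    (.store 7 (V 20) (V 26) ⨾ 24 ≔ V 24 + C 1)

/-- Merges the arrays `4` and `9` into array `7`. -/
def saMerge : Prog := (23 ≔ C 0 ⨾ 24 ≔ C 0) ⨾ forLt 20 10 (saPick ⨾ saTake)

/-- One step up in the recursion. -/
def saUp : Prog := saPop ⨾ saRank ⨾ saZero ⨾ saMerge

section compare

variable {T rk : ℕ → ℕ} {N p q : ℕ}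

/-- `rk` ranks the sample positions. -/
def IsRank (T : ℕ → ℕ) (N : ℕ) (rk : ℕ → ℕ) : Prop :=
  ∀ p < N, ∀ q < N, p % 3 ≠ 0 → q % 3 ≠ 0 → SLt T p q → rk p < rk q

theorem IsRank.slt (h : IsRank T N rk) (hT : UniqLast T N) (hp : p < N) (hq : q < N)
    (hp3 : p % 3 ≠ 0) (hq3 : q % 3 ≠ 0) (hl : rk p < rk q) : SLt T p q := by
  have hne : p ≠ q := by rintro rfl; omega
  rcases hT.total hp hq hne with h' | h'
  · exact h'
  · have := h q hq p hp hq3 hp3 h'; omega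

/-- For residues 0 and 1, one step leads to residues 1 and 2: both are samples with known ranks.
Equality of the first symbols ensures that both successors lie inside the string. -/
theorem IsRank.compare_one (h : IsRank T N rk) (hT : UniqLast T N) (hp : p < N) (hq : q < N)
    (hp3 : p % 3 = 0) (hq3 : q % 3 = 1) :
    (T p < T q ∨ T p = T q ∧ rk (p + 1) < rk (q + 1)) ↔ SLt T p q := by
  have key : T p = T q → (rk (p + 1) < rk (q + 1) ↔ SLt T (p + 1) (q + 1)) := fun he => by
    have := hT.succ_lt hp hq (by rintro rfl; omega) (d := 0) (by
      intro k hk; obtain rfl : k = 0 := by omega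
      exact he)
    exact ⟨h.slt hT (by omega) (by omega) (by omega) (by omega),
      h _ (by omega) _ (by omega) (by omega) (by omega)⟩
  constructor
  · rintro (h1 | ⟨h1, h2⟩)
    · exact .of_lt h1
    · exact .cons h1 ((key h1).1 h2)
  · intro hl
    by_contra! hc
    rcases lt_trichotomy (T p) (T q) with h1 | h1 | h1
    · omega
    · have hc := hc.2 h1
      have := hT.succ_lt hp hq (by rintro rfl; omega) (d := 0) (by
        intro k hk; obtain rfl : k = 0 := by omega
        exact h1)
      rcases hT.total (p := p + 1) (q := q + 1) (by omega) (by omega) (by omega) with h2 | h2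
      · have := (key h1).2 h2; omega
      · exact hl.asymm (.cons h1.symm h2)
    · exact hl.asymm (.of_lt h1)

/-- For residues 0 and 2, one step would lead to residue 0 on one side; after two steps the residues
are 2 and 1, and ranks are available. -/
theorem IsRank.compare_two (h : IsRank T N rk) (hT : UniqLast T N) (hp : p < N) (hq : q < N)
    (hp3 : p % 3 = 0) (hq3 : q % 3 = 2) :
    (T p < T q ∨ T p = T q ∧ (T (p + 1) < T (q + 1) ∨
      T (p + 1) = T (q + 1) ∧ rk (p + 2) < rk (q + 2))) ↔ SLt T p q := by
  have bound : T p = T q → T (p + 1) = T (q + 1) → p + 2 < N ∧ q + 2 < N := fun he he' =>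
    hT.succ_lt hp hq (by rintro rfl; omega) (d := 1) (by
      intro k hk
      interval_cases k
      exacts [he, he'])
  have key : T p = T q → T (p + 1) = T (q + 1) → (rk (p + 2) < rk (q + 2) ↔ SLt T (p + 2) (q + 2)) :=
    fun he he' => by
    have := bound he he'
    exact ⟨h.slt hT (by omega) (by omega) (by omega) (by omega),
      h _ (by omega) _ (by omega) (by omega) (by omega)⟩
  constructor
  · rintro (h1 | ⟨h1, h2 | ⟨h2, h3⟩⟩)
    · exact .of_lt h1
    · exact .cons h1 (.of_lt h2)
    · exact .cons h1 (.cons h2 ((key h1 h2).1 h3))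
  · intro hl
    by_contra! hc
    rcases lt_trichotomy (T p) (T q) with h1 | h1 | h1
    · omega
    · rcases lt_trichotomy (T (p + 1)) (T (q + 1)) with h2 | h2 | h2
      · have := hc.2 h1; omega
      · have hc := (hc.2 h1).2 h2
        have := bound h1 h2
        rcases hT.total (p := p + 2) (q := q + 2) (by omega) (by omega) (by omega) with h3 | h3
        · have := (key h1 h2).2 h3; omega
        · exact hl.asymm (.cons h1.symm (.cons h2.symm h3))
      · exact hl.asymm (.cons h1.symm (.of_lt h2))
    · exact hl.asymm (.of_lt h1)

end compare

/-- The situation in which two sorted lists are merged: array `4` lists the positions divisible by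
`3`, array `9` the others, and the ranks of the latter are stored at `o + N + 2` in array `3`. -/
structure MergeReady (W : ℕ) (s : State) (o N : ℕ) : Prop where
  len : s.reg 10 = N
  off : s.reg 12 = o
  roff : s.reg 17 = o + N + 2
  n12 : s.reg 18 = samples N
  n0 : s.reg 19 = (N + 2) / 3
  uniq : UniqLast (fun k => s.mem 3 (o + k)) N
  bound : o + 6 * N + 10 < W
  rank : IsRank (fun k => s.mem 3 (o + k)) N (fun k => s.mem 3 (o + N + 2 + k))
  zero : ∀ a < (N + 2) / 3, s.mem 4 a < N ∧ s.mem 4 a % 3 = 0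
  sample : ∀ a < samples N, s.mem 9 a < N ∧ s.mem 9 a % 3 ≠ 0
  sorted_zero : ∀ a b, a < b → b < (N + 2) / 3 →
    SLt (fun k => s.mem 3 (o + k)) (s.mem 4 a) (s.mem 4 b)
  sorted_sample : ∀ a b, a < b → b < samples N →
    SLt (fun k => s.mem 3 (o + k)) (s.mem 9 a) (s.mem 9 b)

theorem MergeReady.of_frame {s s' : State} {o N : ℕ} (h : MergeReady W s o N)
    (hf : Fr saMerge s s') : MergeReady W s' o N := by
  obtain ⟨h10, h12, h17, h18, h19, hu, hW, hr, h4, h9, hs, hs'⟩ := h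
  rw [← hf.reg 10 rfl] at h10
  rw [← hf.reg 12 rfl] at h12
  rw [← hf.reg 17 rfl] at h17
  rw [← hf.reg 18 rfl] at h18
  rw [← hf.reg 19 rfl] at h19
  rw [← hf.mem 3 rfl] at hu hr hs hs'
  rw [← hf.mem 4 rfl] at h4 hs
  rw [← hf.mem 9 rfl] at h9 hs'
  exact ⟨h10, h12, h17, h18, h19, hu, hW, hr, h4, h9, hs, hs'⟩

theorem saPick_run {s : State} (hb : Bdd W s) {o N u v : ℕ} (h : MergeReady W s o N)
    (hu : s.reg 23 = u) (hv : s.reg 24 = v) (huv : u + v < N) (hun : u ≤ (N + 2) / 3)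
    (hvn : v ≤ samples N) :
    ∃ s', Run W saPick s 0 s' ∧ s'.reg 25 = s.mem 4 u ∧ s'.reg 26 = s.mem 9 v ∧
      ((s'.reg 27 ≠ 0 ∧ u < (N + 2) / 3 ∧
        (v < samples N → SLt (fun k => s.mem 3 (o + k)) (s.mem 4 u) (s.mem 9 v))) ∨
       (s'.reg 27 = 0 ∧ v < samples N ∧
        (u < (N + 2) / 3 → SLt (fun k => s.mem 3 (o + k)) (s.mem 9 v) (s.mem 4 u)))) := by
  have hW := h.bound
  -- The two lists together have N entries, so with u + v < N at least one of them is not exhausted.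
  have hsum : (N + 2) / 3 + samples N = N := by simp only [samples]; omega
  have r₁ := run_den (p := (25 ≔ Rd 4 (V 23) ⨾ 26 ≔ Rd 9 (V 24))) hb (by simp [Prog.Safe])
  have b₁ := r₁.bdd hb
  simp only [Prog.den, val_V, val_Rd, setReg_reg, setReg_mem, hu, hv, Nat.reduceEqDiff,
    if_false] at r₁ b₁
  set s₁ := (s.setReg 25 (s.mem 4 u)).setReg 26 (s.mem 9 v) with hs₁
  have e25 : s₁.reg 25 = s.mem 4 u := by simp [hs₁]
  have e26 : s₁.reg 26 = s.mem 9 v := by simp [hs₁]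
  have e12 : s₁.reg 12 = o := by simp [hs₁, h.off]
  have e17 : s₁.reg 17 = o + N + 2 := by simp [hs₁, h.roff]
  have e18 : s₁.reg 18 = samples N := by simp [hs₁, h.n12]
  have e19 : s₁.reg 19 = (N + 2) / 3 := by simp [hs₁, h.n0]
  have e23 : s₁.reg 23 = u := by simp [hs₁, hu]
  have e24 : s₁.reg 24 = v := by simp [hs₁, hv]
  have e3 : s₁.mem 3 = s.mem 3 := by simp [hs₁]
  clear_value s₁
  by_cases c1 : v < samples N
  swap
  · have r := run_den (p := 27 ≔ C 1) b₁ (by simpa [Prog.Safe] using hb.one_lt)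
    refine ⟨_, r₁.seq (.cond_false b₁ (by simp) (by simp [e18, e24]; omega) r), by simp [Prog.den, e25],
      by simp [Prog.den, e26], .inl ⟨by simp [Prog.den], by omega, fun h => absurd h c1⟩⟩
  by_cases c2 : u < (N + 2) / 3
  swap
  · have r := run_den (p := 27 ≔ C 0) b₁ (by simp [Prog.Safe]; omega)
    refine ⟨_, r₁.seq (.cond_true b₁ (by simp) (by simp [e18, e24, c1])
      (.cond_false b₁ (by simp) (by simp [e19, e23]; omega) r)), by simp [Prog.den, e25],
      by simp [Prog.den, e26], .inr ⟨by simp [Prog.den], c1, fun h => absurd h c2⟩⟩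
  have hp := h.zero u c2
  have hq := h.sample v c1
  set T := fun k => s.mem 3 (o + k) with hT
  have fin : ∀ e : Expr, e.Safe W s₁ → (e.val s₁ ≠ 0 ↔ SLt T (s.mem 4 u) (s.mem 9 v)) →
      ((27 ≔ e : Prog).den s₁).reg 25 = s.mem 4 u ∧ ((27 ≔ e : Prog).den s₁).reg 26 = s.mem 9 v ∧
      ((((27 ≔ e : Prog).den s₁).reg 27 ≠ 0 ∧ u < (N + 2) / 3 ∧
        (v < samples N → SLt T (s.mem 4 u) (s.mem 9 v))) ∨
       (((27 ≔ e : Prog).den s₁).reg 27 = 0 ∧ v < samples N ∧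
        (u < (N + 2) / 3 → SLt T (s.mem 9 v) (s.mem 4 u)))) := by
    intro e _ he
    refine ⟨by simp [Prog.den, e25], by simp [Prog.den, e26], ?_⟩
    simp only [Prog.den, setReg_reg, if_true]
    by_cases h0 : e.val s₁ = 0
    · refine .inr ⟨h0, c1, fun _ => ?_⟩
      rcases h.uniq.total hq.1 hp.1 (by intro h'; rw [h'] at hq; exact hq.2 hp.2) with h' | h'
      · exact h'
      · exact absurd h0 (he.2 h')
    · exact .inl ⟨h0, c2, fun _ => he.1 h0⟩
  have h1W := hb.one_lt
  by_cases c3 : s.mem 9 v % 3 = 1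
  · set e : Expr := (Rd 3 (V 12 + V 25) ≺ₑ Rd 3 (V 12 + V 26)) +
          (Rd 3 (V 12 + V 25) ≡ₑ Rd 3 (V 12 + V 26)) *
            (Rd 3 (V 17 + V 25 + C 1) ≺ₑ Rd 3 (V 17 + V 26 + C 1)) with he
    have hsafe : e.Safe W s₁ := by
      simp only [he, safe_add, safe_less, safe_Rd, safe_V, safe_C, safe_mul, safe_equal, val_less,
        val_equal, val_mul, e25, e26, e12, e17, val_V, val_C, val_add]
      split_ifs <;> simp <;> omega
    have hval : e.val s₁ ≠ 0 ↔ SLt T (s.mem 4 u) (s.mem 9 v) := by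
      rw [← h.rank.compare_one h.uniq hp.1 hq.1 hp.2 c3]
      simp only [he, val_less, val_equal, val_mul, val_add, val_Rd, val_V, val_C, e25, e26, e12,
        e17, e3, ← add_assoc]
      split_ifs <;> simp <;> omega
    have r := run_den (p := 27 ≔ e) b₁ hsafe
    exact ⟨_, r₁.seq (.cond_true b₁ (by simp) (by simp [e18, e24, c1])
      (.cond_true b₁ (by simp) (by simp [e19, e23]; omega) (.cond_true b₁ (by simp; omega)
        (by simp [e26, c3]) r))), fin e hsafe hval⟩
  · set e : Expr := (Rd 3 (V 12 + V 25) ≺ₑ Rd 3 (V 12 + V 26)) +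
          (Rd 3 (V 12 + V 25) ≡ₑ Rd 3 (V 12 + V 26)) *
            ((Rd 3 (V 12 + V 25 + C 1) ≺ₑ Rd 3 (V 12 + V 26 + C 1)) +
             (Rd 3 (V 12 + V 25 + C 1) ≡ₑ Rd 3 (V 12 + V 26 + C 1)) *
              (Rd 3 (V 17 + V 25 + C 2) ≺ₑ Rd 3 (V 17 + V 26 + C 2))) with he
    have hsafe : e.Safe W s₁ := by
      simp only [he, safe_add, safe_less, safe_Rd, safe_V, safe_C, safe_mul, safe_equal, val_less,
        val_equal, val_mul, e25, e26, e12, e17, val_V, val_C, val_add]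
      split_ifs <;> simp <;> omega
    have hval : e.val s₁ ≠ 0 ↔ SLt T (s.mem 4 u) (s.mem 9 v) := by
      rw [← h.rank.compare_two h.uniq hp.1 hq.1 hp.2 (by omega)]
      simp only [he, val_less, val_equal, val_mul, val_add, val_Rd, val_V, val_C, e25, e26, e12,
        e17, e3, ← add_assoc]
      split_ifs <;> simp <;> omega
    have r := run_den (p := 27 ≔ e) b₁ hsafe
    exact ⟨_, r₁.seq (.cond_true b₁ (by simp) (by simp [e18, e24, c1])
      (.cond_true b₁ (by simp) (by simp [e19, e23]; omega) (.cond_false b₁ (by simp; omega)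
        (by simp [e26, c3]) r))), fin e hsafe hval⟩

/-- Invariant of the merge: whatever has been written is sorted and smaller than the heads of both
remaining lists. -/
theorem saMerge_run {s : State} (hb : Bdd W s) {o N : ℕ} (h : MergeReady W s o N) :
    ∃ s', Run W saMerge s N s' ∧ IsSA (fun k => s.mem 3 (o + k)) N (s'.mem 7) := by
  have hW := h.bound
  have hsum : (N + 2) / 3 + samples N = N := by simp only [samples]; omega
  have r₁ := run_den (p := (23 ≔ C 0 ⨾ 24 ≔ C 0)) hb (by simp [Prog.Safe]; omega)
  have b₁ := r₁.bdd hb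
  simp only [Prog.den, val_C] at r₁ b₁
  set T := fun k => s.mem 3 (o + k) with hT
  obtain ⟨s', hr, ⟨-, hlt, hsort⟩, -⟩ := run_for b₁ (x := 20) (y := 10)
    (body := saPick ⨾ saTake) rfl rfl (N := N) (by simp [h.len])
    (fun k s' => (∃ u v, s'.reg 23 = u ∧ s'.reg 24 = v ∧ u + v = k ∧ u ≤ (N + 2) / 3 ∧
        v ≤ samples N ∧
        (∀ a < k, u < (N + 2) / 3 → SLt T (s'.mem 7 a) (s.mem 4 u)) ∧
        (∀ a < k, v < samples N → SLt T (s'.mem 7 a) (s.mem 9 v))) ∧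
      (∀ a < k, s'.mem 7 a < N) ∧ ∀ a b, a < b → b < k → SLt T (s'.mem 7 a) (s'.mem 7 b))
    (fun _ => 0) 0 (by simp)
    (by
      rintro k hk s' hb' hf hk' ⟨⟨u, v, hu, hv, huv, hun, hvn, hIu, hIv⟩, hlt, hsort⟩
      have hf' : Fr saMerge s s' := (r₁.frame.mono (by simp +contextual [saMerge, Prog.wr])
        (by simp [saMerge, Prog.wm])).trans
        (hf.mono (by simp +contextual [saMerge, Prog.wr]) (by simp +contextual [saMerge, Prog.wm]))
      obtain ⟨s₁, q₁, e25, e26, hp⟩ := saPick_run hb' (h.of_frame hf') hu hv (by omega) hun hvn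
      rw [hf'.mem 3 rfl, hf'.mem 4 rfl, hf'.mem 9 rfl] at hp
      rw [hf'.mem 4 rfl] at e25
      rw [hf'.mem 9 rfl] at e26
      have c₁ := q₁.bdd hb'
      have g₁ := q₁.frame
      have e20 : s₁.reg 20 = k := (g₁.reg 20 rfl).trans hk'
      have e23 : s₁.reg 23 = u := (g₁.reg 23 rfl).trans hu
      have e24 : s₁.reg 24 = v := (g₁.reg 24 rfl).trans hv
      have e7 : s₁.mem 7 = s'.mem 7 := g₁.mem 7 rfl
      have done : ∀ x, x < N → (∀ a < k, SLt T (s'.mem 7 a) x) →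
          (∀ a < k + 1, Function.update (s'.mem 7) k x a < N) ∧
          ∀ a b, a < b → b < k + 1 → SLt T (Function.update (s'.mem 7) k x a)
            (Function.update (s'.mem 7) k x b) := by
        intro x hx hxs
        simp only [Function.update_apply]
        refine ⟨fun a ha => ?_, fun a b hab hb => ?_⟩
        · split_ifs
          · exact hx
          · exact hlt a (by omega)
        · rw [if_neg (by omega)]
          split_ifs
          · exact hxs a (by omega)
          · exact hsort a b hab (by omega)
      have next : ∀ x y, SLt T x y → (∀ a < k, SLt T (s'.mem 7 a) x) →
          ∀ a < k + 1, SLt T (Function.update (s'.mem 7) k x a) y := by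
        intro x y hxy hxs a ha
        simp only [Function.update_apply]
        split_ifs
        · exact hxy
        · exact (hxs a (by omega)).trans hxy
      rcases hp with ⟨h27, hu', hlt'⟩ | ⟨h27, hv', hlt'⟩
      · have q₂ := run_den (p := .store 7 (V 20) (V 25) ⨾ 23 ≔ V 23 + C 1) c₁
          (by simp [Prog.Safe, Prog.den, e23]; omega)
        refine ⟨_, _, q₁.seq (.cond_true c₁ (by simp) (by simpa using h27) q₂), ?_, by simp⟩
        simp only [Prog.den, val_V, val_C, val_add, setReg_reg, setMem_reg, setReg_mem, setMem_mem,
          e20, e23, e24, e25, e7, if_true, Nat.reduceEqDiff, if_false]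
        refine ⟨⟨u + 1, v, rfl, rfl, by omega, by omega, hvn, fun a ha hu1 => ?_,
          fun a ha hv1 => ?_⟩, done _ (h.zero u hu').1 fun a ha => hIu a ha hu'⟩
        · exact next _ _ (h.sorted_zero u (u + 1) (by omega) hu1) (fun a ha => hIu a ha hu') a ha
        · exact next _ _ (hlt' hv1) (fun a ha => hIu a ha hu') a ha
      · have q₂ := run_den (p := .store 7 (V 20) (V 26) ⨾ 24 ≔ V 24 + C 1) c₁
          (by simp [Prog.Safe, Prog.den, e24]; omega)
        refine ⟨_, _, q₁.seq (.cond_false c₁ (by simp) (by simpa using h27) q₂), ?_, by simp⟩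
        simp only [Prog.den, val_V, val_C, val_add, setReg_reg, setMem_reg, setReg_mem, setMem_mem,
          e20, e23, e24, e26, e7, if_true, Nat.reduceEqDiff, if_false]
        refine ⟨⟨u, v + 1, rfl, rfl, by omega, hun, by omega, fun a ha hu1 => ?_,
          fun a ha hv1 => ?_⟩, done _ (h.sample v hv').1 fun a ha => hIv a ha hv'⟩
        · exact next _ _ (hlt' hu1) (fun a ha => hIv a ha hv') a ha
        · exact next _ _ (h.sorted_sample v (v + 1) (by omega) hv1) (fun a ha => hIv a ha hv') a ha)
  exact ⟨s', (r₁.seq hr).mono (by simp), hlt, hsort⟩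

theorem saUp_run {s : State} (hb : Bdd W s) {o N A l : ℕ} {R : ℕ → ℕ} (h13 : s.reg 13 = l + 1)
    (h10 : s.mem 10 l = o) (h11 : s.mem 11 l = N) (h12 : s.mem 12 l = A) (hN : 1 < N)
    (hW : o + 6 * N + 10 < W) (hu : UniqLast (fun k => s.mem 3 (o + k)) N)
    (hlt : ∀ k < N + 2, s.mem 3 (o + k) < A) (hR : Reduces (fun k => s.mem 3 (o + k)) N R)
    (hsa : IsSA R (samples N) (s.mem 7)) :
    ∃ s', Run W saUp s (2 * A + 13 * N) s' ∧ s'.reg 13 = l ∧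
      IsSA (fun k => s.mem 3 (o + k)) N (s'.mem 7) ∧
      ∀ k < o + N + 2, s'.mem 3 k = s.mem 3 k := by
  obtain ⟨s₁, r₁, e13, e12, e10, e11, e16, e18, e19, e17, e3⟩ := saPop_run hb h13 h10 h11 h12 hW
  have b₁ := r₁.bdd hb
  have f₁ := r₁.frame
  have hsa₁ : IsSA R (samples N) (s₁.mem 7) := by rwa [f₁.mem 7 rfl]
  obtain ⟨s₂, r₂, h9, hrk, hz, hX⟩ := saRank_run b₁ hW e16 e18 e17 hsa₁
  have b₂ := r₂.bdd b₁
  have f₂ := r₂.frame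
  have hX₂ : ∀ k < o + N + 2, s₂.mem 3 k = s.mem 3 k := fun k hk => by
    rw [hX k hk, e3, Function.update_apply, if_neg (by omega)]
  have hT : ∀ k < N, s.mem 3 (o + k) = s₂.mem 3 (o + k) := fun k hk => (hX₂ _ (by omega)).symm
  have hu₂ := hu.congr (T' := fun k => s₂.mem 3 (o + k)) hT
  rw [f₁.mem 7 rfl] at h9 hrk hsa₁
  have hex : ∀ p < N, p % 3 ≠ 0 → ∃ a < samples N, p = samplePos N (s.mem 7 a) := fun p hp h3 => by
    obtain ⟨a, ha, h⟩ := hsa.exists_eq (sampleIdx_lt hp h3)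
    exact ⟨a, ha, by rw [h, samplePos_sampleIdx hp h3]⟩
  have hss : ∀ a b, a < b → b < samples N →
      SLt (fun k => s₂.mem 3 (o + k)) (samplePos N (s.mem 7 a)) (samplePos N (s.mem 7 b)) :=
    fun a b hab hb => hu.slt_congr hT (samplePos_lt (hsa.lt a (by omega)))
      (samplePos_lt (hsa.lt b hb)) (hR.slt hu (hsa.lt a (by omega)) (hsa.lt b hb)
        (hsa.sorted a b hab hb))
  have hrank : IsRank (fun k => s₂.mem 3 (o + k)) N (fun k => s₂.mem 3 (o + N + 2 + k)) := by
    intro p hp q hq hp3 hq3 hl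
    obtain ⟨a, ha, rfl⟩ := hex p hp hp3
    obtain ⟨b, hb, rfl⟩ := hex q hq hq3
    simp only [hrk a ha, hrk b hb]
    by_contra! hc
    rcases hc.lt_or_eq with h | h
    · exact hl.asymm (hss b a h ha)
    · subst h; exact hl.irrefl
  obtain ⟨s₃, r₃, h4, hs4⟩ := saZero_run b₂ hN hW ((f₂.reg 11 rfl).trans e11)
    ((f₂.reg 12 rfl).trans e12) ((f₂.reg 17 rfl).trans e17) ((f₂.reg 18 rfl).trans e18)
    ((f₂.reg 19 rfl).trans e19) (fun k hk => by rw [← hT k hk]; exact hlt k (by omega))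
    (fun p hp h3 => by
      obtain ⟨a, ha, rfl⟩ := hex p hp h3
      rw [hrk a ha]; exact ha) (by rw [hz, e3]; simp)
  have b₃ := r₃.bdd b₂
  have f₃ := r₃.frame
  have f₃' := (r₂.seq r₃).frame
  have hm : MergeReady W s₃ o N := by
    refine ⟨(f₃'.reg 10 rfl).trans e10, (f₃'.reg 12 rfl).trans e12, (f₃'.reg 17 rfl).trans e17,
      (f₃'.reg 18 rfl).trans e18, (f₃'.reg 19 rfl).trans e19, ?_, hW, ?_, h4, ?_, ?_, ?_⟩
    · rwa [f₃.mem 3 rfl]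
    · rwa [f₃.mem 3 rfl]
    · intro a ha
      rw [f₃.mem 9 rfl, h9 a ha]
      exact ⟨samplePos_lt (hsa.lt a ha), samplePos_mod⟩
    · intro a b hab hb
      rw [f₃.mem 3 rfl]
      rcases hs4 a b hab hb with h | ⟨h, h'⟩
      · exact .of_lt h
      · have ha4 := h4 a (by omega)
        have hb4 := h4 b hb
        have hne : s₃.mem 4 a ≠ s₃.mem 4 b := by
          rcases h' with h' | h'
          · intro he; rw [he] at h'; exact lt_irrefl _ h'
          · exact h'.2
        have hs := hu₂.succ_lt ha4.1 hb4.1 hne (d := 0) (by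
          intro k hk; obtain rfl : k = 0 := by omega
          exact h)
        refine .cons h ?_
        -- With equal first symbols both successors are samples inside the string. The wrong order
        -- of their suffixes would reverse the ranks by which the list was sorted.
        rcases hu₂.total (p := s₃.mem 4 a + 1) (q := s₃.mem 4 b + 1) (by omega) (by omega)
          (by omega) with h1 | h1
        · exact h1
        · have := hrank _ (by omega) _ (by omega) (by omega) (by omega) h1
          simp only [show ∀ x, o + N + 2 + (x + 1) = o + N + 3 + x by intro x; ring] at this
          omega
    · intro a b hab hb
      rw [f₃.mem 3 rfl, f₃.mem 9 rfl, h9 a (by omega), h9 b hb]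
      exact hss a b hab hb
  obtain ⟨s₄, r₄, h₄⟩ := saMerge_run b₃ hm
  have f₄ := r₄.frame
  have f₄' := (r₂.seq (r₃.seq r₄)).frame
  refine ⟨s₄, (r₁.seq (r₂.seq (r₃.seq r₄))).mono ?_, (f₄'.reg 13 rfl).trans e13, ?_, ?_⟩
  · have := samples_le N
    omega
  · rw [f₃.mem 3 rfl] at h₄
    exact h₄.congr hu₂ fun k hk => (hT k hk).symm
  · intro k hk
    rw [f₄.mem 3 rfl, f₃.mem 3 rfl, hX₂ k hk]

/-- The way down. -/
def saDownLoop : Prog := .loop (C 1 ≺ₑ V 10) saDown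
/-- The way up. -/
def saUpLoop : Prog := .loop (C 0 ≺ₑ V 13) saUp

/-- Constructs in array `7` the suffix array of the string that the registers describe. -/
def suffixArray : Prog := saDownLoop ⨾ .store 7 (C 0) (C 0) ⨾ saUpLoop

/-- The recursion is run by two consecutive loops, so one level contributes the first round of the
way down and the last of its rounds on the way up. The statement is in continuation form: any run of
the upward loop from s₂, where this level is solved, extends to a run from the bottom state s₁. This
allows induction on N although the rounds are nested like brackets. -/
theorem suffixArray_rec : ∀ N, ∀ {s : State}, Bdd W s → ∀ {o A l : ℕ}, IsLevel W s o N A l →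
    ∃ s₁ s₂ i j, Run W saDownLoop s i s₁ ∧ Bdd W s₂ ∧
      (∀ k s₃, Run W saUpLoop s₂ k s₃ → Run W (.store 7 (C 0) (C 0) ⨾ saUpLoop) s₁ (k + j) s₃) ∧
      i + j ≤ 8 * A + 80 * N ∧ s₂.reg 13 = l ∧
      IsSA (fun k => s.mem 3 (o + k)) N (s₂.mem 7) ∧
      (∀ k < o + N + 2, s₂.mem 3 k = s.mem 3 k) ∧
      (∀ k < l, s₂.mem 10 k = s.mem 10 k ∧ s₂.mem 11 k = s.mem 11 k ∧
        s₂.mem 12 k = s.mem 12 k) := by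
  intro N
  induction N using Nat.strong_induction_on with
  | _ N ih =>
  intro s hb o A l hs
  have h1W := hb.one_lt
  by_cases hN : 1 < N
  swap
  -- The descent always continues to length 1, even if the names are already distinct; there the
  -- suffix array is the single entry 0.
  · have hN1 : N = 1 := by have := hs.uniq.pos; omega
    have r := Run.loop_done (p := saDown) hb (e := C 1 ≺ₑ V 10) (by simp; omega)
      (by simp [hs.len]; omega)
    have r₂ := run_den (p := .store 7 (C 0) (C 0)) hb (by simp [Prog.Safe]; omega)
    refine ⟨_, _, 0, 0, r, r₂.bdd hb, fun k s₃ h => (r₂.seq h).mono (by omega), by omega,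
      by simp [Prog.den, hs.lev], ?_, by simp [Prog.den], by simp [Prog.den]⟩
    subst hN1
    refine ⟨fun a ha => ?_, fun a b _ _ => by omega⟩
    obtain rfl : a = 0 := by omega
    simp [Prog.den]
  obtain ⟨s₁, r₁, l₁, hX, hR, h10, h11, h12⟩ := saDown_run hb hs hN
  have b₁ := r₁.bdd hb
  have hsl := samples_le N
  have hsp := samples_pos hN
  obtain ⟨t₁, t₂, i, j, d, b₂, up, hij, e13, hsa, hX₂, hst⟩ := ih (samples N) (by omega) b₁ l₁
  have hX' : ∀ k < o + N + 2, t₂.mem 3 k = s.mem 3 k := fun k hk =>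
    (hX₂ k (by omega)).trans (hX k hk)
  have hTeq : ∀ k < N, s.mem 3 (o + k) = t₂.mem 3 (o + k) := fun k hk => (hX' _ (by omega)).symm
  have hR₂ : Reduces (fun k => t₂.mem 3 (o + k)) N (fun k => s₁.mem 3 (o + N + 2 + k)) := by
    have e : ∀ p < samples N, ∀ d < 3,
        t₂.mem 3 (o + (samplePos N p + d)) = s.mem 3 (o + (samplePos N p + d)) := fun p hp d hd => by
      have := samplePos_lt hp
      exact hX' _ (by omega)
    have e0 := fun p hp => e p hp 0 (by omega)
    have e1 := fun p hp => e p hp 1 (by omega)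
    have e2 := fun p hp => e p hp 2 (by omega)
    simp only [add_zero] at e0
    refine ⟨fun a ha b hb h => hR.lt a ha b hb ?_, fun a ha b hb h => hR.eq a ha b hb ?_⟩
    · simpa only [TripleLt, e0 a ha, e0 b hb, e1 a ha, e1 b hb, e2 a ha, e2 b hb] using h
    · simpa only [TripleEq, e0 a ha, e0 b hb, e1 a ha, e1 b hb, e2 a ha, e2 b hb] using h
  have hl := hst l (by omega)
  have hu₂ := hs.uniq.congr (T' := fun k => t₂.mem 3 (o + k)) hTeq
  obtain ⟨s₂, r₂, g13, gsa, gX⟩ := saUp_run (A := A) b₂ e13 (by rw [hl.1, h10]; simp)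
    (by rw [hl.2.1, h11]; simp) (by rw [hl.2.2, h12]; simp) hN hs.bound hu₂
    (fun k hk => by rw [hX' _ (by omega)]; exact hs.lt k hk) hR₂ hsa
  have f₂ := r₂.frame
  refine ⟨t₁, s₂, _, j + (2 * A + 13 * N) + 1, Run.loop_step hb (by simp; omega)
    (by simp [hs.len, hN]) r₁ d, r₂.bdd b₂, fun k s₃ h => ?_, ?_, g13, ?_, ?_, ?_⟩
  · exact (up _ _ (Run.loop_step b₂ (by simp; omega) (by simp [e13]) r₂ h)).mono (by omega)
  -- The level costs 6A + 11 samples down and 2A + 13N up, plus 2 tests; the recursive call costs at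
  -- most 88 samples, its alphabet having size samples. As 99 samples ≤ 66N, the total is at most 8A
  -- + 79N + 2 ≤ 8A + 80N.
  · omega
  · exact gsa.congr hu₂ fun k hk => (hTeq k hk).symm
  · exact fun k hk => (gX k hk).trans (hX' k hk)
  · intro k hk
    obtain ⟨q1, q2, q3⟩ := hst k (by omega)
    rw [f₂.mem 10 rfl, f₂.mem 11 rfl, f₂.mem 12 rfl, q1, q2, q3, h10, h11, h12]
    simp [Function.update_apply, if_neg (show k ≠ l by omega)]

theorem suffixArray_run {s : State} (hb : Bdd W s) {N A : ℕ} (hs : IsLevel W s 0 N A 0) :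
    ∃ s', Run W suffixArray s (8 * A + 80 * N) s' ∧ IsSA (s.mem 3) N (s'.mem 7) ∧
      ∀ k < N + 2, s'.mem 3 k = s.mem 3 k := by
  obtain ⟨s₁, s₂, i, j, d, b₂, up, hij, e13, hsa, hX, -⟩ := suffixArray_rec N hb hs
  have h1W := hb.one_lt
  have r := Run.loop_done (p := saUp) b₂ (e := C 0 ≺ₑ V 13) (by simp; omega) (by simp [e13])
  refine ⟨s₂, (d.seq (up 0 s₂ r)).mono (by omega), by simpa using hsa, by simpa using hX⟩

end WordRAM

/-! ### Ranks and longest common prefixes -/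

namespace WordRAM

variable {W : ℕ}

/-- The longest common prefix of the suffixes at `p` and `q` has length `L`. -/
structure Lce (T : ℕ → ℕ) (p q L : ℕ) : Prop where
  eq : ∀ k < L, T (p + k) = T (q + k)
  ne : T (p + L) ≠ T (q + L)

/-! ### Common prefixes along the sorted order -/

section Lce

variable {T : ℕ → ℕ} {p q r L L' : ℕ}

theorem Lce.symm (h : Lce T p q L) : Lce T q p L :=
  ⟨fun k hk => (h.eq k hk).symm, h.ne.symm⟩

theorem Lce.lt_of_slt (h : Lce T p q L) (hl : SLt T p q) : T (p + L) < T (q + L) := by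
  obtain ⟨l, h1, h2⟩ := hl
  rcases lt_trichotomy l L with h' | h' | h'
  · exact absurd (h.eq l h') h2.ne
  · exact h' ▸ h2
  · exact absurd (h1 L h') h.ne

/-- Sortedness is needed for L = L': then both mismatches are increases at the same place and cannot
cancel. -/
theorem Lce.trans (h : Lce T p q L) (h' : Lce T q r L') (hl : SLt T p q) (hl' : SLt T q r) :
    Lce T p r (min L L') := by
  have h1 := h.lt_of_slt hl
  have h2 := h'.lt_of_slt hl'
  refine ⟨fun k hk => (h.eq k (by omega)).trans (h'.eq k (by omega)), ?_⟩
  rcases lt_trichotomy L L' with c | c | c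
  · rw [min_eq_left c.le, ← h'.eq L c]; exact h1.ne
  · subst c; rw [min_self]; exact (h1.trans h2).ne
  · rw [min_eq_right c.le, h.eq L' c]; exact h2.ne

/-- A suffix between two others shares every prefix common to both. -/
theorem SLt.sandwich (h : SLt T p q) (h' : SLt T q r) (he : ∀ k < L, T (p + k) = T (r + k)) :
    ∀ k < L, T (r + k) = T (q + k) := by
  obtain ⟨l, h1, h2⟩ := h
  obtain ⟨m, h3, h4⟩ := h'
  have hm : L ≤ m := by
    by_contra! hm
    have := he m hm
    rcases lt_trichotomy l m with c | c | c
    · have := he l (by omega)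
      have := h3 l c
      omega
    · subst c; omega
    · have := h1 m c
      omega
  exact fun k hk => (h3 k (by omega)).symm

end Lce

/-- Stores the ranks of the suffixes in array `20`. -/
def ranks : Prog := forLt 20 10 (.store 20 (Rd 7 (V 20)) (V 20))

theorem ranks_run {s : State} (hb : Bdd W s) {T : ℕ → ℕ} {N : ℕ} (h10 : s.reg 10 = N)
    (hsa : IsSA T N (s.mem 7)) :
    ∃ s', Run W ranks s N s' ∧ ∀ a < N, s'.mem 20 (s.mem 7 a) = a := by
  obtain ⟨s', hr, hI, -⟩ := run_for_straight (x := 20) (y := 10)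
    (body := .store 20 (Rd 7 (V 20)) (V 20)) hb rfl rfl h10
    (fun k s' => ∀ a < k, s'.mem 20 (s.mem 7 a) = a) (by simp)
    (by
      intro k hk s' hb' hf hk' hI
      have f7 := hf.mem 7 rfl
      refine ⟨by simp [Prog.Safe], fun a ha => ?_⟩
      simp [Prog.den, hk', f7, Function.update_apply]
      split_ifs with h
      · exact (hsa.injOn (by omega) hk h).symm
      · rcases Nat.lt_succ_iff_lt_or_eq.1 ha with h1 | h1
        · exact hI a h1
        · subst h1; exact absurd rfl h)
  exact ⟨s', hr, hI⟩

/-- Extends the common prefix of the suffixes at `reg 20` and `reg 21`. -/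
def lcpExtend : Prog := .loop (Rd 3 (V 20 + V 22) ≡ₑ Rd 3 (V 21 + V 22)) (22 ≔ V 22 + C 1)

/-- Computes in array `21` the common prefix lengths of the neighbours in the suffix array. -/
def kasai : Prog := 22 ≔ C 0 ⨾ forLt 20 2
  (21 ≔ Rd 7 (Rd 20 (V 20) - C 1) ⨾ lcpExtend ⨾
    .store 21 (Rd 20 (V 20)) (V 22) ⨾ 22 ≔ V 22 - C 1)

/-- The scan needs no bounds check, since the unique last symbol forces a mismatch inside the
string. Its iterations are paid for by the growth of register 22. -/
theorem lcpExtend_run {s : State} (hb : Bdd W s) {N p q : ℕ} (hu : UniqLast (s.mem 3) N)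
    (hW : 2 * N < W) (hp : s.reg 20 = p) (hq : s.reg 21 = q) (hpN : p < N) (hqN : q < N)
    (hpq : p ≠ q) (he : ∀ k < s.reg 22, s.mem 3 (p + k) = s.mem 3 (q + k)) :
    ∃ s' i, Run W lcpExtend s i s' ∧ Lce (s.mem 3) p q (s'.reg 22) ∧ s'.reg 22 < N ∧
      i + s.reg 22 ≤ s'.reg 22 := by
  have hlt : ∀ h, (∀ k < h, s.mem 3 (p + k) = s.mem 3 (q + k)) → p + h < N ∧ q + h < N := by
    intro h hh
    cases h with
    | zero => exact ⟨hpN, hqN⟩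
    | succ h => exact hu.succ_lt hpN hqN hpq fun k hk => hh k (by omega)
  obtain ⟨s', i, hr, hI, h0, hΦ⟩ := run_while (W := W)
    (e := Rd 3 (V 20 + V 22) ≡ₑ Rd 3 (V 21 + V 22)) (p := 22 ≔ V 22 + C 1) hb
    (fun s' => s.reg 22 ≤ s'.reg 22 ∧ ∀ k < s'.reg 22, s.mem 3 (p + k) = s.mem 3 (q + k))
    (fun s' => N - s'.reg 22) ⟨le_rfl, he⟩
    (by
      intro s' hb' hf hI
      have := hlt _ hI.2
      simp [hf.reg 20 rfl, hf.reg 21 rfl, hp, hq]; omega)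
    (by
      intro s' hb' hf hI h0
      have := hlt _ hI.2
      simp only [val_equal, val_Rd, val_add, val_V, hf.reg 20 rfl, hf.reg 21 rfl, hf.mem 3 rfl, hp,
        hq] at h0
      have h0 : s.mem 3 (p + s'.reg 22) = s.mem 3 (q + s'.reg 22) := by
        by_contra hc; simp [hc] at h0
      refine ⟨_, 0, run_den hb' (by simp [Prog.Safe]; omega), ?_, ?_⟩
      · simp only [Prog.den, val_add, val_V, val_C, setReg_reg, if_true]
        refine ⟨by omega, fun k hk => ?_⟩
        rcases Nat.lt_succ_iff_lt_or_eq.1 hk with h1 | h1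
        · exact hI.2 k h1
        · rw [h1]; exact h0
      · simp [Prog.den]; omega)
  have f := hr.frame
  have := hlt _ hI.2
  have := hlt _ he
  simp only [val_equal, val_Rd, val_add, val_V, f.reg 20 rfl, f.reg 21 rfl, f.mem 3 rfl, hp,
    hq] at h0
  refine ⟨s', i, hr, ⟨hI.2, fun hc => by simp [hc] at h0⟩, by omega, by omega⟩

/-- If q precedes k in the suffix array with common prefix L ≥ 1, then q + 1 comes somewhere before
k + 1 with common prefix L - 1, and the immediate predecessor of k + 1 shares at least as much. So
the scan for k + 1 may start at L - 1. -/
theorem kasai_run {s : State} (hb : Bdd W s) {n : ℕ} (hu : UniqLast (s.mem 3) (n + 1))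
    (hW : 2 * (n + 1) < W) (h2 : s.reg 2 = n) (hsa : IsSA (s.mem 3) (n + 1) (s.mem 7))
    (hrk : ∀ a < n + 1, s.mem 20 (s.mem 7 a) = a) (hpos : ∀ p < n, 0 < s.mem 20 p) :
    ∃ s', Run W kasai s (3 * n + 1) s' ∧
      ∀ p < n, Lce (s.mem 3) p (s.mem 7 (s.mem 20 p - 1)) (s'.mem 21 (s.mem 20 p)) := by
  set T := s.mem 3 with hT
  set sa := s.mem 7 with hsa'
  set rk := s.mem 20 with hrk'
  have inv : ∀ p < n + 1, rk p < n + 1 ∧ sa (rk p) = p := fun p hp => by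
    obtain ⟨a, ha, rfl⟩ := hsa.exists_eq hp
    rw [hrk a ha]; exact ⟨ha, rfl⟩
  have r₁ := run_den (p := 22 ≔ C 0) hb (by simp [Prog.Safe]; omega)
  have b₁ := r₁.bdd hb
  simp only [Prog.den, val_C] at r₁ b₁
  obtain ⟨s', hr, hI, -⟩ := run_for b₁ (x := 20) (y := 2)
    (body := (21 ≔ Rd 7 (Rd 20 (V 20) - C 1) ⨾ lcpExtend ⨾
      .store 21 (Rd 20 (V 20)) (V 22) ⨾ 22 ≔ V 22 - C 1)) rfl rfl (N := n) (by simp [h2])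
    (fun k s' => s'.reg 22 ≤ n ∧
      (k < n → ∀ t < s'.reg 22, T (k + t) = T (sa (rk k - 1) + t)) ∧
      ∀ p < k, Lce T p (sa (rk p - 1)) (s'.mem 21 (rk p)))
    -- Extensions lower this potential, and each round raises it by at most 1; the total is 2n + (n
    -- + 1).
    (fun s' => n + 1 - s'.reg 22) 1 (by simp)
    (by
      intro k hk s' hb' hf hk' ⟨hn, hpre, hlce⟩
      have f3 : s'.mem 3 = T := (hf.mem 3 rfl).trans (by simp [hT])
      have f7 : s'.mem 7 = sa := (hf.mem 7 rfl).trans (by simp [hsa'])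
      have f20 : s'.mem 20 = rk := (hf.mem 20 rfl).trans (by simp [hrk'])
      obtain ⟨hk1, hk2⟩ := inv k (by omega)
      have hk0 := hpos k hk
      have hqN := hsa.lt (rk k - 1) (by omega)
      have hqk : SLt T (sa (rk k - 1)) k := by
        have := hsa.sorted (rk k - 1) (rk k) (by omega) hk1
        rwa [hk2] at this
      set q := sa (rk k - 1) with hq
      have r₂ := run_den (p := 21 ≔ Rd 7 (Rd 20 (V 20) - C 1)) hb' (by simp [Prog.Safe]; omega)
      have b₂ := r₂.bdd hb'
      simp only [Prog.den, val_sub, val_Rd, val_V, val_C, hk', f7, f20, ← hq] at r₂ b₂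
      obtain ⟨s₃, i, r₃, hL, hLN, hi⟩ := lcpExtend_run b₂ (N := n + 1) (p := k) (q := q)
        (by simpa [f3] using hu) hW (by simp [hk']) (by simp) (by omega) hqN hqk.ne.symm
        (by simpa [f3] using hpre hk)
      have b₃ := r₃.bdd b₂
      have f₃ := r₃.frame
      have g20 : s₃.reg 20 = k := (f₃.reg 20 rfl).trans (by simp [hk'])
      have g20m : s₃.mem 20 = rk := (f₃.mem 20 rfl).trans (by simp [f20])
      have g21 : s₃.mem 21 = s'.mem 21 := (f₃.mem 21 rfl).trans (by simp)
      simp only [setReg_mem, f3, setReg_reg, Nat.reduceEqDiff, if_false] at hL hi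
      have r₄ := run_den (p := (.store 21 (Rd 20 (V 20)) (V 22) ⨾ 22 ≔ V 22 - C 1)) b₃
        (by simp [Prog.Safe]; omega)
      simp only [Prog.den, val_sub, val_Rd, val_V, val_C, g20, g20m, setMem_reg] at r₄
      refine ⟨_, _, r₂.seq (r₃.seq r₄), ?_, by simp; omega⟩
      simp only [setReg_mem, setMem_mem, setReg_reg, setMem_reg, Nat.reduceEqDiff, if_true,
        if_false, g21]
      refine ⟨by omega, fun hk1n t ht => ?_, fun p hp => ?_⟩
      · obtain ⟨c1, c2⟩ := inv (k + 1) (by omega)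
        have c0 := hpos (k + 1) hk1n
        have e0 : T q = T k := (hL.eq 0 (by omega)).symm
        have hq1 : q + 1 < n + 1 := (hu.succ_lt (d := 0) hqN (by omega) hqk.ne (by
          intro x hx; obtain rfl : x = 0 := by omega
          exact e0)).1
        have hpre' : ∀ t < s₃.reg 22 - 1, T (q + 1 + t) = T (k + 1 + t) := fun t ht => by
          have := hL.eq (1 + t) (by omega)
          rw [← add_assoc, ← add_assoc] at this
          exact this.symm
        have hl : SLt T (q + 1) (k + 1) := by
          rcases hu.total hq1 (by omega : k + 1 < n + 1)
            (by have := hqk.ne; omega) with h | h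
          · exact h
          · exact absurd (SLt.cons e0.symm h) hqk.asymm
        obtain ⟨d1, d2⟩ := inv (q + 1) hq1
        have hlt : rk (q + 1) < rk (k + 1) := hsa.lt_of_slt d1 (by rwa [c2, d2])
        -- Either the predecessor of k + 1 lies strictly between q + 1 and k + 1, or it is q + 1
        -- itself.
        rcases Nat.lt_or_ge (rk (q + 1)) (rk (k + 1) - 1) with h | h
        · have s1 := hsa.sorted _ _ h (by omega)
          have s2 := hsa.sorted (rk (k + 1) - 1) (rk (k + 1)) (by omega) c1
          rw [d2] at s1
          rw [c2] at s2
          exact s1.sandwich s2 hpre' t ht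
        · have h' : rk (k + 1) - 1 = rk (q + 1) := by omega
          rw [h', d2]
          exact (hpre' t ht).symm
      · rw [Function.update_apply]
        split_ifs with h
        · have hpk : p = k := by
            rw [← (inv p (by omega)).2, h, hk2]
          subst hpk
          exact hL
        · rcases Nat.lt_succ_iff_lt_or_eq.1 hp with h1 | h1
          · exact hlce p h1
          · subst h1; exact absurd rfl h)
  exact ⟨s', (r₁.seq hr).mono (by simp; omega), hI.2.2⟩

end WordRAM

/-! ### Range minimum queries -/

namespace WordRAM

variable {W : ℕ}

/-- `v` is the minimum of `A l, …, A r`. -/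
structure IsMin (A : ℕ → ℕ) (l r v : ℕ) : Prop where
  attained : ∃ q, l ≤ q ∧ q ≤ r ∧ A q = v
  le : ∀ q, l ≤ q → q ≤ r → v ≤ A q

/-- The ranges may overlap, as minimum is idempotent; the sparse table depends on this. -/
theorem IsMin.union {A : ℕ → ℕ} {l r l' r' u v : ℕ} (h : IsMin A l r u) (h' : IsMin A l' r' v)
    (h1 : l ≤ l') (h2 : r ≤ r') (h3 : l' ≤ r + 1) : IsMin A l r' (min u v) := by
  obtain ⟨⟨p, p1, p2, p3⟩, hl⟩ := h
  obtain ⟨⟨q, q1, q2, q3⟩, hl'⟩ := h'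
  refine ⟨?_, fun x hx hx' => ?_⟩
  · rcases le_total u v with c | c
    · exact ⟨p, p1, by omega, by rw [p3, min_eq_left c]⟩
    · exact ⟨q, by omega, q2, by rw [q3, min_eq_right c]⟩
  · rcases Nat.lt_or_ge r x with c | c
    · exact (min_le_right _ _).trans (hl' x (by omega) hx')
    · exact (min_le_left _ _).trans (hl x hx c)

theorem IsMin.unique {A : ℕ → ℕ} {l r u v : ℕ} (h : IsMin A l r u) (h' : IsMin A l r v) :
    u = v := by
  obtain ⟨⟨p, p1, p2, p3⟩, hl⟩ := h
  obtain ⟨⟨q, q1, q2, q3⟩, hl'⟩ := h'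
  have := hl q q1 q2
  have := hl' p p1 p2
  omega

theorem sub_sub_eq_min (a b : ℕ) : a - (a - b) = min a b := by omega

/-- `t` is the position of the lowest bit of `x`. -/
structure IsLsb (x t : ℕ) : Prop where
  bit : x.testBit t = true
  low : ∀ u < t, x.testBit u = false

/-- The bit mask `m` describes the strict suffix minima of `A b, …, A r`. -/
def IsMask (A : ℕ → ℕ) (b r m : ℕ) : Prop :=
  ∀ t, m.testBit t = true ↔ b + t ≤ r ∧ ∀ q, b + t < q → q ≤ r → A (b + t) < A q

theorem exists_last_min (A : ℕ → ℕ) (l d : ℕ) :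
    ∃ q, l ≤ q ∧ q ≤ l + d ∧ (∀ x, l ≤ x → x ≤ l + d → A q ≤ A x) ∧
      ∀ x, q < x → x ≤ l + d → A q < A x := by
  induction d with
  | zero => exact ⟨l, le_rfl, le_rfl, fun x h h' => by rw [show x = l by omega], by omega⟩
  | succ d ih =>
    obtain ⟨q, h1, h2, h3, h4⟩ := ih
    rcases Nat.lt_or_ge (A q) (A (l + (d + 1))) with h | h
    · refine ⟨q, h1, by omega, fun x hx hx' => ?_, fun x hx hx' => ?_⟩
      · rcases Nat.lt_or_ge (l + d) x with c | c
        · rw [show x = l + (d + 1) by omega]; exact h.le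
        · exact h3 x hx c
      · rcases Nat.lt_or_ge (l + d) x with c | c
        · rw [show x = l + (d + 1) by omega]; exact h
        · exact h4 x hx c
    · refine ⟨l + (d + 1), by omega, le_rfl, fun x hx hx' => ?_, by omega⟩
      rcases Nat.lt_or_ge (l + d) x with c | c
      · rw [show x = l + (d + 1) by omega]
      · exact h.trans (h3 x hx c)

/-- The last minimum of A l, …, A r is a strict suffix minimum, and no earlier position from l on is
one, because a strict suffix minimum is smaller than everything after it. So it is the lowest bit
left after shifting away the positions before l. -/
theorem IsMask.isMin {A : ℕ → ℕ} {b r m l t : ℕ} (h : IsMask A b r m) (hbl : b ≤ l) (hlr : l ≤ r)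
    (ht : IsLsb (m / 2 ^ (l - b)) t) : IsMin A l r (A (l + t)) ∧ l + t ≤ r := by
  obtain ⟨q, h1, h2, h3, h4⟩ := exists_last_min A l (r - l)
  rw [Nat.add_sub_cancel' hlr] at h2 h3 h4
  have hq : (m / 2 ^ (l - b)).testBit (q - l) = true := by
    rw [Nat.testBit_div_two_pow, h, show b + (q - l + (l - b)) = q by omega]
    exact ⟨h2, h4⟩
  have htq : t ≤ q - l := by
    by_contra! hc
    rw [ht.low _ hc] at hq
    simp at hq
  have hb := ht.bit
  rw [Nat.testBit_div_two_pow, h, show b + (t + (l - b)) = l + t by omega] at hb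
  have hlt : l + t = q := by
    by_contra hne
    have := hb.2 q (by omega) h2
    have := h3 (l + t) (by omega) hb.1
    omega
  rw [hlt]
  exact ⟨⟨⟨q, h1, h2, rfl⟩, h3⟩, h2⟩

theorem IsMask.ne_zero {A : ℕ → ℕ} {b r m l : ℕ} (h : IsMask A b r m) (hbl : b ≤ l) (hlr : l ≤ r) :
    m / 2 ^ (l - b) ≠ 0 := by
  obtain ⟨q, h1, h2, h3, h4⟩ := exists_last_min A l (r - l)
  rw [Nat.add_sub_cancel' hlr] at h2 h3 h4
  have hq : (m / 2 ^ (l - b)).testBit (q - l) = true := by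
    rw [Nat.testBit_div_two_pow, h, show b + (q - l + (l - b)) = q by omega]
    exact ⟨h2, h4⟩
  intro h0
  simp [h0] at hq

theorem IsMask.lt {A : ℕ → ℕ} {b r m B : ℕ} (h : IsMask A b r m) (hr : r < b + B) : m < 2 ^ B :=
  Nat.lt_pow_two_of_testBit _ fun i hi => by
    by_contra hc
    have := ((h i).1 (by simpa using hc)).1
    omega

/-! #### Tables -/

/-- Computes the block length `reg 3` and a table of powers of two. -/
def rmqPow : Prog :=
  (3 ≔ C 0 ⨾ .store 22 (C 0) (C 1)) ⨾
  .loop (Rd 22 (V 3) ≺ₑ V 10 + C 1) (.store 22 (V 3 + C 1) (Rd 22 (V 3) + Rd 22 (V 3)) ⨾ 3 ≔ V 3 + C 1)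

/-- Computes the sizes of the tables. -/
def rmqSizes : Prog :=
  4 ≔ V 10 / V 3 + C 1 ⨾ 29 ≔ Rd 22 (V 3) ⨾ 14 ≔ V 4 * V 3 ⨾ 18 ≔ V 4 + C 1

/-- A table of binary logarithms. -/
def rmqLog : Prog := forLt 20 18
  (.cond (V 20 ≺ₑ C 2) (.store 24 (V 20) (C 0)) (.store 24 (V 20) (Rd 24 (V 20 / C 2) + C 1)))

/-- A table of lowest bits. -/
def rmqLsb : Prog := forLt 20 29
  (.cond (V 20 % C 2 + (V 20 ≡ₑ C 0)) (.store 23 (V 20) (C 0))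
    (.store 23 (V 20) (Rd 23 (V 20 / C 2) + C 1)))

/-- Block length B is about log N: large enough that a sparse table over the blocks is linear, small
enough that tables indexed by B-bit masks have at most 2N entries. -/
theorem rmqPow_run {s : State} (hb : Bdd W s) {N : ℕ} (h10 : s.reg 10 = N) (hN : 0 < N)
    (hW : 8 * N + 20 < W) :
    ∃ s', Run W rmqPow s (N + 1) s' ∧ ∃ B, s'.reg 3 = B ∧ 0 < B ∧ B ≤ N ∧ N < 2 ^ B ∧
      2 ^ B ≤ 2 * N ∧ ∀ k ≤ B, s'.mem 22 k = 2 ^ k := by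
  have r₁ := run_den (p := (3 ≔ C 0 ⨾ .store 22 (C 0) (C 1))) hb
    (by simp [Prog.Safe]; omega)
  have b₁ := r₁.bdd hb
  simp only [Prog.den, val_C] at r₁ b₁
  obtain ⟨s', i, hr, hI, h0, hΦ⟩ := run_while (W := W) b₁ (e := Rd 22 (V 3) ≺ₑ V 10 + C 1)
    (p := .store 22 (V 3 + C 1) (Rd 22 (V 3) + Rd 22 (V 3)) ⨾ 3 ≔ V 3 + C 1)
    (fun s' => 2 ^ s'.reg 3 ≤ 2 * N ∧ ∀ k ≤ s'.reg 3, s'.mem 22 k = 2 ^ k)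
    (fun s' => N + 1 - s'.reg 3) (by simp; omega)
    (by
      intro s' hb' hf hI
      have : s'.reg 10 = N := (hf.reg 10 rfl).trans (by simp [h10])
      simp [this]; omega)
    (by
      intro s' hb' hf ⟨hI1, hI2⟩ h0
      have e10 : s'.reg 10 = N := (hf.reg 10 rfl).trans (by simp [h10])
      have e22 := hI2 _ le_rfl
      have hle : 2 ^ s'.reg 3 ≤ N := by
        by_contra hc
        simp [e10, e22] at h0
        omega
      have hlt := Nat.lt_two_pow_self (n := s'.reg 3)
      refine ⟨_, 0, run_den hb' ?_, ?_, ?_⟩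
      · simp [Prog.Safe, Prog.den, e22]; omega
      · simp only [Prog.den, val_add, val_Rd, val_V, val_C, setReg_reg, setMem_reg, setReg_mem,
          setMem_mem, if_true, Function.update_apply, e22]
        refine ⟨by rw [pow_succ]; omega, fun k hk => ?_⟩
        split_ifs with h
        · rw [h, pow_succ]; omega
        · exact hI2 k (by omega)
      · simp [Prog.den]; omega)
  have f := hr.frame
  have e10 : s'.reg 10 = N := (f.reg 10 rfl).trans (by simp [h10])
  have e22 := hI.2 _ le_rfl
  have hlt : N < 2 ^ s'.reg 3 := by
    by_contra hc
    simp [e10, e22] at h0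
    omega
  have hpos : 0 < s'.reg 3 := by
    by_contra hc
    rw [show s'.reg 3 = 0 by omega] at hlt
    omega
  have hBN : s'.reg 3 ≤ N := by
    have h1 := Nat.lt_two_pow_self (n := s'.reg 3 - 1)
    have h2 : 2 ^ s'.reg 3 = 2 ^ (s'.reg 3 - 1) * 2 := by rw [← pow_succ]; congr 1; omega
    omega
  exact ⟨s', (r₁.seq hr).mono (by simp at hΦ; omega), _, rfl, hpos, hBN, hlt, hI.1, hI.2⟩

theorem rmqLog_run {s : State} (hb : Bdd W s) {N : ℕ} (h18 : s.reg 18 = N) (hW : N + 10 < W) :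
    ∃ s', Run W rmqLog s N s' ∧ ∀ k < N, s'.mem 24 k = Nat.log 2 k := by
  obtain ⟨s', hr, hI, -⟩ := run_for_straight (x := 20) (y := 18)
    (body := .cond (V 20 ≺ₑ C 2) (.store 24 (V 20) (C 0))
      (.store 24 (V 20) (Rd 24 (V 20 / C 2) + C 1))) hb rfl rfl h18
    (fun k s' => ∀ a < k, s'.mem 24 a = Nat.log 2 a) (by simp)
    (by
      intro k hk s' hb' hf hk' hI
      by_cases h2 : k < 2
      · refine ⟨by simp [Prog.Safe, hk', h2]; omega, fun a ha => ?_⟩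
        simp [Prog.den, hk', h2, Function.update_apply]
        split_ifs with h
        · rw [h, Nat.log_of_lt h2]
        · exact hI a (by omega)
      · have e := hI (k / 2) (by omega)
        have hl := Nat.log_le_self 2 k
        refine ⟨by simp [Prog.Safe, hk', h2, e]; omega, fun a ha => ?_⟩
        simp [Prog.den, hk', h2, Function.update_apply]
        split_ifs with h
        · rw [h, e, Nat.log_of_one_lt_of_le (b := 2) (n := k) (by omega) (by omega)]
        · exact hI a (by omega))
  exact ⟨s', hr, hI⟩

theorem isLsb_zero {x : ℕ} (h : x % 2 = 1) : IsLsb x 0 :=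
  ⟨by simp [Nat.testBit_zero, h], by simp⟩

theorem IsLsb.succ {x t : ℕ} (h : x % 2 = 0) (ht : IsLsb (x / 2) t) : IsLsb x (t + 1) := by
  refine ⟨by rw [Nat.testBit_succ]; exact ht.bit, fun u hu => ?_⟩
  cases u with
  | zero => simp [Nat.testBit_zero, h]
  | succ u => rw [Nat.testBit_succ]; exact ht.low u (by omega)

theorem rmqLsb_run {s : State} (hb : Bdd W s) {N : ℕ} (h29 : s.reg 29 = N) (hW : N + 10 < W) :
    ∃ s', Run W rmqLsb s N s' ∧ ∀ k < N, k ≠ 0 → IsLsb k (s'.mem 23 k) := by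
  obtain ⟨s', hr, hI, -⟩ := run_for_straight (x := 20) (y := 29)
    (body := .cond (V 20 % C 2 + (V 20 ≡ₑ C 0)) (.store 23 (V 20) (C 0))
      (.store 23 (V 20) (Rd 23 (V 20 / C 2) + C 1))) hb rfl rfl h29
    -- The crude bound by a is kept only to exclude overflow when 1 is added.
    (fun k s' => ∀ a < k, s'.mem 23 a ≤ a ∧ (a ≠ 0 → IsLsb a (s'.mem 23 a))) (by simp)
    (by
      intro k hk s' hb' hf hk' hI
      -- Zero is treated with the odd numbers, since halving would refer it to itself; its entry has
      -- no meaning.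
      by_cases h2 : k % 2 = 1 ∨ k = 0
      · have hv : k % 2 + (if k = 0 then 1 else 0) ≠ 0 := by split_ifs <;> omega
        refine ⟨?_, fun a ha => ?_⟩
        · simp only [Prog.Safe, val_add, val_mod, val_V, val_C, val_equal, hk', if_pos hv]
          simp [hk']
          split_ifs <;> omega
        · simp only [Prog.den, val_add, val_mod, val_V, val_C, val_equal, hk', if_pos hv]
          simp only [setReg_mem, setMem_mem, if_true, Function.update_apply]
          split_ifs with h
          · exact ⟨by omega, fun h0 => isLsb_zero (by omega)⟩
          · exact hI a (by omega)
      · have hv : ¬ (k % 2 + (if k = 0 then 1 else 0) ≠ 0) := by split_ifs <;> omega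
        have e := hI (k / 2) (by omega)
        refine ⟨?_, fun a ha => ?_⟩
        · simp only [Prog.Safe, val_add, val_mod, val_V, val_C, val_equal, hk', if_neg hv]
          simp [hk']
          split_ifs <;> omega
        · simp only [Prog.den, val_add, val_mod, val_V, val_C, val_equal, hk', if_neg hv]
          simp only [setReg_mem, setMem_mem, if_true, Function.update_apply, val_Rd, val_div,
            val_V, val_C, hk']
          split_ifs with h
          · exact ⟨by omega, fun h0 => by
              rw [h]; exact (e.2 (by omega)).succ (by omega)⟩
          · exact hI a (by omega))
  exact ⟨s', hr, fun k hk => (hI k hk).2⟩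

/-! #### Masks -/

/-- Removes from the stack the entries that are not smaller than the current one. -/
def rmqPop : Prog := .loop ((C 0 ≺ₑ V 24) * (C 1 - (Rd 21 (Rd 27 (V 24 - C 1)) ≺ₑ Rd 21 (V 20))))
  (24 ≔ V 24 - C 1)

/-- Puts the current entry on the stack and stores the mask. -/
def rmqPush : Prog :=
  .store 27 (V 24) (V 20) ⨾ .store 28 (V 24 + C 1) (Rd 28 (V 24) + Rd 22 (V 20 % V 3)) ⨾
  24 ≔ V 24 + C 1 ⨾ .store 25 (V 20) (Rd 28 (V 24))

/-- Computes the masks. -/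
def rmqMask : Prog := .store 28 (C 0) (C 0) ⨾ 24 ≔ C 0 ⨾
  forLt 20 14 (.cond (V 20 % V 3 ≡ₑ C 0) (24 ≔ C 0) .skip ⨾ rmqPop ⨾ rmqPush)

/-- `q` is a strict suffix minimum of the entries before `r`. -/
def OnStack (A : ℕ → ℕ) (r q : ℕ) : Prop := q < r ∧ ∀ x, q < x → x < r → A q < A x

/-- The stack `st` of depth `d` holds some strict suffix minima of `A b, …, A (r - 1)`, among them
those that satisfy `P`; the prefixes of the stack have the masks `mk`. -/
structure StackInv (A : ℕ → ℕ) (b r d : ℕ) (st mk : ℕ → ℕ) (P : ℕ → Prop) : Prop where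
  depth : b + d ≤ r
  mem : ∀ e < d, b ≤ st e ∧ OnStack A r (st e)
  all : ∀ q, b ≤ q → OnStack A r q → P q → ∃ e < d, st e = q
  mono : ∀ e f, e < f → f < d → st e < st f
  mask : ∀ e ≤ d, ∀ t, (mk e).testBit t = true ↔ ∃ f < e, st f = b + t

theorem StackInv.empty {A : ℕ → ℕ} {r : ℕ} {st mk : ℕ → ℕ} (h : mk 0 = 0) (P : ℕ → Prop) :
    StackInv A r r 0 st mk P :=
  ⟨le_rfl, by simp, fun q h1 h2 => by have := h2.1; omega, by simp, fun e he t => by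
    obtain rfl : e = 0 := by omega
    simp [h]⟩

/-- After popping, the surviving entries are exactly the old strict suffix minima below A r, and r
is a new one. Every stack prefix keeps its own mask, so popping needs no update and pushing adds one
bit. -/
theorem StackInv.push {A : ℕ → ℕ} {b r d : ℕ} {st mk : ℕ → ℕ}
    (h : StackInv A b r d st mk (fun q => A q < A r)) (hbr : b ≤ r)
    (htop : 0 < d → A (st (d - 1)) < A r) :
    mk d < 2 ^ (r - b) ∧
    StackInv A b (r + 1) (d + 1) (Function.update st d r)
      (Function.update mk (d + 1) (mk d + 2 ^ (r - b))) (fun _ => True) := by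
  have hlt : mk d < 2 ^ (r - b) := Nat.lt_pow_two_of_testBit _ fun i hi => by
    by_contra hc
    obtain ⟨f, hf, hf'⟩ := (h.mask d le_rfl i).1 (by simpa using hc)
    have := (h.mem f hf).2.1
    omega
  have hall : ∀ e < d, A (st e) < A r := fun e he => by
    rcases Nat.lt_or_ge e (d - 1) with h1 | h1
    · have := (h.mem e he).2.2 _ (h.mono e (d - 1) h1 (by omega)) (h.mem (d - 1) (by omega)).2.1
      have := htop (by omega)
      omega
    · rw [show e = d - 1 by omega]; exact htop (by omega)
  refine ⟨hlt, by have := h.depth; omega, fun e he => ?_, fun q hq hq' _ => ?_,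
    fun e f hef hf => ?_, fun e he t => ?_⟩
  · rw [Function.update_apply]
    split_ifs with c
    · exact ⟨hbr, by omega, fun x hx hx' => by omega⟩
    · obtain ⟨h1, h2, h3⟩ := h.mem e (by omega)
      refine ⟨h1, by omega, fun x hx hx' => ?_⟩
      rcases Nat.lt_succ_iff_lt_or_eq.1 hx' with c' | c'
      · exact h3 x hx c'
      · rw [c']; exact hall e (by omega)
  · rcases Nat.lt_succ_iff_lt_or_eq.1 hq'.1 with c | c
    · obtain ⟨e, he, he'⟩ := h.all q hq ⟨c, fun x hx hx' => hq'.2 x hx (by omega)⟩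
        (hq'.2 r c (by omega))
      exact ⟨e, by omega, by rw [Function.update_apply, if_neg (by omega), he']⟩
    · exact ⟨d, by omega, by rw [Function.update_self, c]⟩
  · rw [Function.update_apply, Function.update_apply, if_neg (by omega)]
    split_ifs with c
    · exact (h.mem e (by omega)).2.1
    · exact h.mono e f hef (by omega)
  · rw [Function.update_apply]
    split_ifs with c
    · subst c
      rw [add_comm (mk d)]
      rcases lt_trichotomy t (r - b) with c | c | c
      · rw [Nat.testBit_two_pow_add_gt c, h.mask d le_rfl]
        constructor
        · rintro ⟨f, hf, hf'⟩
          exact ⟨f, by omega, by rw [Function.update_apply, if_neg (by omega), hf']⟩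
        · rintro ⟨f, hf, hf'⟩
          rw [Function.update_apply] at hf'
          split_ifs at hf' with c'
          · omega
          · exact ⟨f, by omega, hf'⟩
      · subst c
        rw [Nat.testBit_two_pow_add_eq, Nat.testBit_lt_two_pow hlt]
        simp only [Bool.not_false, true_iff]
        exact ⟨d, by omega, by rw [Function.update_self]; omega⟩
      · rw [Nat.testBit_lt_two_pow (lt_of_lt_of_le
          (show 2 ^ (r - b) + mk d < 2 ^ (r - b + 1) by rw [pow_succ]; omega)
          (Nat.pow_le_pow_right (by omega) c))]
        simp only [Bool.false_eq_true, false_iff]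
        rintro ⟨f, hf, hf'⟩
        rw [Function.update_apply] at hf'
        split_ifs at hf' with c'
        · omega
        · have := (h.mem f (by omega)).2.1
          omega
    · rw [h.mask e (by omega)]
      constructor
      · rintro ⟨f, hf, hf'⟩
        exact ⟨f, hf, by rw [Function.update_apply, if_neg (by omega), hf']⟩
      · rintro ⟨f, hf, hf'⟩
        rw [Function.update_apply, if_neg (by omega)] at hf'
        exact ⟨f, hf, hf'⟩

theorem StackInv.isMask {A : ℕ → ℕ} {b r d : ℕ} {st mk : ℕ → ℕ}
    (h : StackInv A b (r + 1) d st mk (fun _ => True)) : IsMask A b r (mk d) := fun t => by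
  rw [h.mask d le_rfl]
  constructor
  · rintro ⟨f, hf, hf'⟩
    have := (h.mem f hf).2
    rw [hf'] at this
    exact ⟨by have := this.1; omega, fun q h1 h2 => this.2 q h1 (by omega)⟩
  · rintro ⟨h1, h2⟩
    exact h.all _ (by omega) ⟨by omega, fun x hx hx' => h2 x hx (by omega)⟩ trivial

theorem ite_le_one (P : Prop) [Decidable P] : (if P then 1 else 0) ≤ 1 := by
  split_ifs <;> omega

theorem rmqPop_run {s : State} (hb : Bdd W s) {b r : ℕ} (hr : s.reg 20 = r)
    (h : StackInv (s.mem 21) b r (s.reg 24) (s.mem 27) (s.mem 28) (fun _ => True)) :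
    ∃ s' i, Run W rmqPop s i s' ∧ i + s'.reg 24 ≤ s.reg 24 ∧
      StackInv (s.mem 21) b r (s'.reg 24) (s.mem 27) (s.mem 28) (fun q => s.mem 21 q < s.mem 21 r) ∧
      (0 < s'.reg 24 → s.mem 21 (s.mem 27 (s'.reg 24 - 1)) < s.mem 21 r) := by
  have h1W := hb.one_lt
  obtain ⟨s', i, hrun, hI, h0, hΦ⟩ := run_while (W := W) hb
    (e := (C 0 ≺ₑ V 24) * (C 1 - (Rd 21 (Rd 27 (V 24 - C 1)) ≺ₑ Rd 21 (V 20))))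
    (p := 24 ≔ V 24 - C 1)
    (fun s' => StackInv (s.mem 21) b r (s'.reg 24) (s.mem 27) (s.mem 28)
      (fun q => s.mem 21 q < s.mem 21 r)) (fun s' => s'.reg 24)
    ⟨h.depth, h.mem, fun q h1 h2 _ => h.all q h1 h2 trivial, h.mono, h.mask⟩
    (by
      intro s' hb' hf hI
      -- The test is a product of two bits, hence at most 1.
      refine ⟨⟨h1W.trans' one_pos, trivial, trivial⟩,
        ⟨h1W, ⟨⟨trivial, h1W, trivial⟩, trivial, trivial⟩, trivial⟩, ?_⟩
      exact (Nat.mul_le_mul (ite_le_one _) (Nat.sub_le 1 _)).trans_lt h1W)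
    (by
      intro s' hb' hf hI h0
      simp only [val_mul, val_less, val_sub, val_V, val_C, val_Rd, hf.mem 21 rfl, hf.mem 27 rfl,
        hf.reg 20 rfl, hr] at h0
      have hd : 0 < s'.reg 24 ∧ ¬ s.mem 21 (s.mem 27 (s'.reg 24 - 1)) < s.mem 21 r := by
        refine ⟨?_, fun hc => by simp [hc] at h0⟩
        by_contra hc
        simp [hc] at h0
      refine ⟨_, 0, run_den hb' (by simp [Prog.Safe]; omega), ?_, by simp [Prog.den]; omega⟩
      simp only [Prog.den, val_sub, val_V, val_C, setReg_reg, if_true]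
      refine ⟨by have := hI.depth; omega, fun e he => hI.mem e (by omega), fun q h1 h2 h3 => ?_,
        fun e f h1 h2 => hI.mono e f h1 (by omega), fun e he => hI.mask e (by omega)⟩
      -- The popped entry is not below A r, so it is not among those that the weakened completeness
      -- clause demands.
      obtain ⟨e, he, he'⟩ := hI.all q h1 h2 h3
      refine ⟨e, ?_, he'⟩
      by_contra hc
      rw [show s'.reg 24 - 1 = e by omega, he'] at hd
      exact hd.2 h3)
  have hf := hrun.frame
  refine ⟨s', i, hrun, hΦ, hI, fun hd => ?_⟩
  simp only [val_mul, val_less, val_sub, val_V, val_C, val_Rd, hf.mem 21 rfl, hf.mem 27 rfl,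
    hf.reg 20 rfl, hr] at h0
  by_contra hc
  simp [hc, hd] at h0

theorem block_succ {B k : ℕ} (h : (k + 1) % B ≠ 0) : (k + 1) / B * B = k / B * B := by
  rw [Nat.succ_div, if_neg (by rwa [Nat.dvd_iff_mod_eq_zero]), add_zero]

theorem rmqMask_run {s : State} (hb : Bdd W s) {B M : ℕ} (hB : 0 < B) (h3 : s.reg 3 = B)
    (h14 : s.reg 14 = M) (hW : M + 2 * 2 ^ B < W) (hp : ∀ k ≤ B, s.mem 22 k = 2 ^ k) :
    ∃ s', Run W rmqMask s (2 * M) s' ∧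
      ∀ r < M, IsMask (s.mem 21) (r / B * B) r (s'.mem 25 r) := by
  have h1W := hb.one_lt
  have r₁ := run_den (p := .store 28 (C 0) (C 0)) hb (by simp [Prog.Safe]; omega)
  have b₁ := r₁.bdd hb
  have r₂ := run_den (p := 24 ≔ C 0) b₁ (by simp [Prog.Safe]; omega)
  have b₂ := r₂.bdd b₁
  simp only [Prog.den, val_C] at r₁ r₂ b₂
  obtain ⟨s', hr, hI, -⟩ := run_for b₂ (x := 20) (y := 14)
    (body := .cond (V 20 % V 3 ≡ₑ C 0) (24 ≔ C 0) .skip ⨾ rmqPop ⨾ rmqPush) rfl rfl (N := M)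
    (by simp [h14])
    -- At a block boundary nothing is asserted about the stack, because it is emptied there. The
    -- cell for the empty mask has to stay 0. The potential is the depth, so pops are paid for by
    -- pushes.
    (fun k s' => (k % B ≠ 0 → StackInv (s.mem 21) (k / B * B) k (s'.reg 24) (s'.mem 27) (s'.mem 28)
        (fun _ => True)) ∧ s'.mem 28 0 = 0 ∧
      ∀ r < k, IsMask (s.mem 21) (r / B * B) r (s'.mem 25 r))
    (fun s' => s'.reg 24) 1 (by simp)
    (by
      intro k hk s' hb' hf hk' ⟨hst, h28, hm⟩
      have e3 : s'.reg 3 = B := (hf.reg 3 rfl).trans (by simp [h3])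
      have e21 : s'.mem 21 = s.mem 21 := (hf.mem 21 rfl).trans (by simp)
      have e22 : s'.mem 22 = s.mem 22 := (hf.mem 22 rfl).trans (by simp)
      have hkB := Nat.mod_lt k hB
      have hdiv := Nat.div_add_mod' k B
      have start : ∃ s₁, Run W (.cond (V 20 % V 3 ≡ₑ C 0) (24 ≔ C 0) .skip) s' 0 s₁ ∧
          s₁.reg 24 ≤ s'.reg 24 ∧ StackInv (s.mem 21) (k / B * B) k (s₁.reg 24) (s'.mem 27)
            (s'.mem 28) (fun _ => True) := by
        by_cases h0 : k % B = 0
        · refine ⟨_, .cond_true hb' (by simp; omega) (by simp [hk', e3, h0])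
            (run_den (p := 24 ≔ C 0) hb' (by simp [Prog.Safe]; omega)), by simp [Prog.den], ?_⟩
          rw [show k / B * B = k by omega]
          simpa [Prog.den] using StackInv.empty h28 _
        · exact ⟨_, .cond_false hb' (by simp; omega) (by simp [hk', e3, h0])
            (run_den (p := .skip) hb' trivial), le_rfl, hst h0⟩
      obtain ⟨s₁, q₁, hd₁, hst₁⟩ := start
      have c₁ := q₁.bdd hb'
      have f₁ := q₁.frame
      rw [← f₁.mem 27 rfl, ← f₁.mem 28 rfl, ← e21, ← f₁.mem 21 rfl] at hst₁
      obtain ⟨s₂, i, q₂, hi, hst₂, htop⟩ := rmqPop_run c₁ ((f₁.reg 20 rfl).trans hk') hst₁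
      have c₂ := q₂.bdd c₁
      have f₂ := q₂.frame
      have f₂' := (q₁.seq q₂).frame
      obtain ⟨hlt, hst₃⟩ := hst₂.push (by omega) htop
      rw [f₁.mem 27 rfl, f₁.mem 28 rfl, f₁.mem 21 rfl, e21] at hst₃
      rw [f₁.mem 28 rfl] at hlt
      have hdep := hst₂.depth
      have g20 : s₂.reg 20 = k := (f₂'.reg 20 rfl).trans hk'
      have g3 : s₂.reg 3 = B := (f₂'.reg 3 rfl).trans e3
      have g28 := f₂'.mem 28 rfl
      have g27 := f₂'.mem 27 rfl
      have g25 := f₂'.mem 25 rfl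
      have g22 : s₂.mem 22 (k % B) = 2 ^ (k - k / B * B) := by
        rw [f₂'.mem 22 rfl, e22, hp _ (by omega)]
        congr 1; omega
      have hpow : 2 ^ (k - k / B * B) ≤ 2 ^ B := Nat.pow_le_pow_right (by omega) (by omega)
      have q₃ := run_den (p := rmqPush) c₂ (by
        simp [rmqPush, Prog.Safe, Prog.den, g20, g3, g22, g28]; omega)
      simp only [rmqPush, Prog.den, val_V, val_C, val_add, val_mod, val_Rd, setMem_reg, setReg_reg,
        setReg_mem, setMem_mem, g20, g3, g22, g28, Nat.reduceEqDiff, if_true, if_false,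
        Function.update_self] at q₃
      refine ⟨_, _, q₁.seq (q₂.seq q₃), ?_, by simp; omega⟩
      simp only [setMem_reg, setReg_reg, setReg_mem, setMem_mem, Nat.reduceEqDiff, if_true,
        if_false, g25, g27, g28]
      refine ⟨fun h0 => ?_, ?_, fun r hr => ?_⟩
      · rw [block_succ h0]; exact hst₃
      · rw [Function.update_apply, if_neg (by omega), h28]
      · rw [Function.update_apply]
        split_ifs with h
        · have := hst₃.isMask
          rw [Function.update_self] at this
          rw [h]; exact this
        · exact hm r (by omega))
  refine ⟨s', (r₁.seq (r₂.seq hr)).mono (by simp; omega), hI.2.2⟩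

end WordRAM

/-! ### The sparse table and queries -/

namespace WordRAM

variable {W : ℕ}

/-- The tables for the blocks of length `B`, of which there are `nb`. -/
structure Blocks (W : ℕ) (s : State) (B nb : ℕ) : Prop where
  len : s.reg 3 = B
  num : s.reg 4 = nb
  pos : 0 < B
  bound : nb * B + 2 * 2 ^ B < W
  bound' : (B + 1) * nb + 2 ^ B < W
  num_le : nb ≤ 2 ^ B
  pow : ∀ k ≤ B, s.mem 22 k = 2 ^ k
  log : ∀ k ≤ nb, s.mem 24 k = Nat.log 2 k
  lsb : ∀ x < 2 ^ B, x ≠ 0 → IsLsb x (s.mem 23 x)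
  mask : ∀ r < nb * B, IsMask (s.mem 21) (r / B * B) r (s.mem 25 r)

theorem Blocks.congr {s s' : State} {B nb : ℕ} (h : Blocks W s B nb) (r3 : s'.reg 3 = s.reg 3)
    (r4 : s'.reg 4 = s.reg 4) (m21 : s'.mem 21 = s.mem 21) (m22 : s'.mem 22 = s.mem 22)
    (m23 : s'.mem 23 = s.mem 23) (m24 : s'.mem 24 = s.mem 24) (m25 : s'.mem 25 = s.mem 25) :
    Blocks W s' B nb := by
  obtain ⟨a, b, c, d, e, f, g, h, i, j⟩ := h
  exact ⟨r3.trans a, r4.trans b, c, d, e, f, by rw [m22]; exact g, by rw [m24]; exact h,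
    by rw [m23]; exact i, by rw [m21, m25]; exact j⟩

/-- The tables for range minimum queries in the first `nb * B` cells of array `21`. -/
structure IsRMQ (W : ℕ) (s : State) (B nb : ℕ) : Prop extends Blocks W s B nb where
  sparse : ∀ k ≤ B, ∀ b, b + 2 ^ k ≤ nb →
    IsMin (s.mem 21) (b * B) ((b + 2 ^ k) * B - 1) (s.mem 26 (k * nb + b))

theorem IsRMQ.congr {s s' : State} {B nb : ℕ} (h : IsRMQ W s B nb) (r3 : s'.reg 3 = s.reg 3)
    (r4 : s'.reg 4 = s.reg 4) (m21 : s'.mem 21 = s.mem 21) (m22 : s'.mem 22 = s.mem 22)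
    (m23 : s'.mem 23 = s.mem 23) (m24 : s'.mem 24 = s.mem 24) (m25 : s'.mem 25 = s.mem 25)
    (m26 : s'.mem 26 = s.mem 26) : IsRMQ W s' B nb :=
  ⟨h.toBlocks.congr r3 r4 m21 m22 m23 m24 m25, by rw [m21, m26]; exact h.sparse⟩

/-- A minimum within a block. -/
def inBlock (e f : Expr) : Expr := Rd 21 (e + Rd 23 (Rd 25 f / Rd 22 (e % V 3)))

/-- The smaller of two values. -/
def emin (e f : Expr) : Expr := e - (e - f)

@[simp] theorem val_emin (s : State) (e f : Expr) :
    (emin e f).val s = min (e.val s) (f.val s) := sub_sub_eq_min _ _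

@[simp] theorem safe_emin (s : State) (e f : Expr) :
    (emin e f).Safe W s ↔ e.Safe W s ∧ f.Safe W s := by simp [emin]

theorem Blocks.inBlock {s : State} {B nb : ℕ} (h : Blocks W s B nb) {e f : Expr}
    (he : e.Safe W s) (hf : f.Safe W s) {l r : ℕ} (hl : e.val s = l) (hr : f.val s = r)
    (hlr : l ≤ r) (hrn : r < nb * B) (hd : l / B = r / B) :
    (inBlock e f).Safe W s ∧ IsMin (s.mem 21) l r ((inBlock e f).val s) := by
  have hm := h.mask r hrn
  have h1 := Nat.div_add_mod' l B
  have h2 := Nat.div_add_mod' r B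
  have h3 := Nat.mod_lt l h.pos
  have h4 := Nat.mod_lt r h.pos
  have hbl : r / B * B ≤ l := by rw [← hd]; omega
  have hlb : l - r / B * B = l % B := by rw [← hd]; omega
  have hne := hm.ne_zero hbl hlr
  have hlt : s.mem 25 r / 2 ^ (l - r / B * B) < 2 ^ B :=
    (Nat.div_le_self _ _).trans_lt (hm.lt (by omega))
  obtain ⟨hmin, hle⟩ := hm.isMin hbl hlr (h.lsb _ hlt hne)
  have hp : s.mem 22 (l % B) = 2 ^ (l - r / B * B) := by rw [hlb, h.pow _ (by omega)]
  have hW := h.bound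
  simp only [WordRAM.inBlock, safe_Rd, safe_add, safe_div, safe_mod, safe_V, val_Rd, val_add,
    val_div, val_mod, val_V, hl, hr, h.len, hp]
  exact ⟨⟨he, ⟨hf, he, trivial⟩, by omega⟩, hmin⟩

/-- The first row of the sparse table: the minima of the blocks. -/
def rmqRow : Prog := forLt 20 4
  (.store 26 (V 20) (inBlock (V 20 * V 3) (V 20 * V 3 + V 3 - C 1)))

/-- The next row of the sparse table. -/
def rmqNextRow : Prog := forLt 21 4
  (.store 26 ((V 20 + C 1) * V 4 + V 21)
    (emin (Rd 26 (V 20 * V 4 + V 21)) (Rd 26 (V 20 * V 4 + V 21 + Rd 22 (V 20)))))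

/-- Builds the tables for range minimum queries in the first `reg 10` cells of array `21`. -/
def rmqBuild : Prog :=
  rmqPow ⨾ rmqSizes ⨾ rmqLog ⨾ rmqLsb ⨾ rmqMask ⨾ rmqRow ⨾ forLt 20 3 rmqNextRow

theorem rmqRow_run {s : State} (hb : Bdd W s) {B nb : ℕ} (h : Blocks W s B nb) :
    ∃ s', Run W rmqRow s nb s' ∧
      ∀ b < nb, IsMin (s.mem 21) (b * B) ((b + 1) * B - 1) (s'.mem 26 b) := by
  obtain ⟨s', hr, hI, -⟩ := run_for_straight (x := 20) (y := 4)
    (body := .store 26 (V 20) (inBlock (V 20 * V 3) (V 20 * V 3 + V 3 - C 1))) hb rfl rfl h.num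
    (fun k s' => ∀ b < k, IsMin (s.mem 21) (b * B) ((b + 1) * B - 1) (s'.mem 26 b)) (by simp)
    (by
      intro k hk s' hb' hf hk' hI
      have h' := h.congr (hf.reg 3 rfl) (hf.reg 4 rfl) (hf.mem 21 rfl) (hf.mem 22 rfl)
        (hf.mem 23 rfl) (hf.mem 24 rfl) (hf.mem 25 rfl)
      have hB := h.pos
      have hW := h.bound
      have hpw : 0 < 2 ^ B := by positivity
      have hkB : k * B + B ≤ nb * B := by rw [← Nat.succ_mul]; exact Nat.mul_le_mul_right _ hk
      have hd : (k * B + B - 1) / B = k := Nat.div_eq_of_lt_le (by omega) (by rw [Nat.succ_mul]; omega)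
      obtain ⟨hs, hm⟩ := h'.inBlock (e := V 20 * V 3) (f := V 20 * V 3 + V 3 - C 1)
        (l := k * B) (r := k * B + B - 1) (by simp [hk', h'.len]; omega)
        (by simp [hk', h'.len]; omega) (by simp [hk', h'.len]) (by simp [hk', h'.len]) (by omega)
        (by omega) (by rw [hd, Nat.mul_div_cancel _ hB])
      refine ⟨⟨by simp, hs⟩, fun b hb => ?_⟩
      simp only [Prog.den, setReg_mem, setMem_mem, if_true, val_V, hk', Function.update_apply]
      split_ifs with hbk
      · rw [hbk, Nat.succ_mul, ← hf.mem 21 rfl]; exact hm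
      · exact hI b (by omega))
  exact ⟨s', hr, hI⟩

theorem rmqNextRow_run {s : State} (hb : Bdd W s) {B nb k : ℕ} (h : Blocks W s B nb) (hk : k < B)
    (h20 : s.reg 20 = k)
    (hrow : ∀ b, b + 2 ^ k ≤ nb →
      IsMin (s.mem 21) (b * B) ((b + 2 ^ k) * B - 1) (s.mem 26 (k * nb + b))) :
    ∃ s', Run W rmqNextRow s nb s' ∧ (∀ x < (k + 1) * nb, s'.mem 26 x = s.mem 26 x) ∧
      ∀ b, b + 2 ^ (k + 1) ≤ nb →
      IsMin (s.mem 21) (b * B) ((b + 2 ^ (k + 1)) * B - 1) (s'.mem 26 ((k + 1) * nb + b)) := by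
  have hB := h.pos
  have hW := h.bound'
  have hpw : 2 ^ k ≤ 2 ^ B := Nat.pow_le_pow_right (by omega) (by omega)
  have hpw0 : 0 < 2 ^ k := by positivity
  have hkk : (k + 1) * nb = k * nb + nb := Nat.succ_mul _ _
  have hkB : (k + 1) * nb + nb ≤ (B + 1) * nb := by
    rw [← Nat.succ_mul]; exact Nat.mul_le_mul_right _ (by omega)
  obtain ⟨s', hr, hI, -⟩ := run_for_straight (x := 21) (y := 4)
    (body := .store 26 ((V 20 + C 1) * V 4 + V 21)
      (emin (Rd 26 (V 20 * V 4 + V 21)) (Rd 26 (V 20 * V 4 + V 21 + Rd 22 (V 20)))))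
    hb rfl rfl h.num
    (fun j s' => (∀ x < (k + 1) * nb, s'.mem 26 x = s.mem 26 x) ∧
      ∀ b < j, b + 2 ^ (k + 1) ≤ nb →
      IsMin (s.mem 21) (b * B) ((b + 2 ^ (k + 1)) * B - 1) (s'.mem 26 ((k + 1) * nb + b)))
    (by simp)
    (by
      intro j hj s' hb' hf hj' ⟨hx, hI⟩
      have e20 : s'.reg 20 = k := (hf.reg 20 rfl).trans h20
      have e4 : s'.reg 4 = nb := (hf.reg 4 rfl).trans h.num
      have e22 : s'.mem 22 k = 2 ^ k := by rw [hf.mem 22 rfl]; exact h.pow k (by omega)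
      have h1B : nb ≤ (B + 1) * nb := by nlinarith
      have hBp := Nat.lt_two_pow_self (n := B)
      refine ⟨?_, fun x hx' => ?_, fun b hb hbn => ?_⟩
      -- Entries whose range would exceed the last block are filled with meaningless values; only
      -- absence of overflow matters for them.
      · simp [Prog.Safe, e20, e4, e22, hj']; omega
      · simp only [Prog.den, setReg_mem, setMem_mem, if_true, val_V, val_add, val_mul, val_C, e20,
          e4, hj', Function.update_apply]
        rw [if_neg (by omega), hx x hx']
      · simp only [Prog.den, setReg_mem, setMem_mem, if_true, val_V, val_add, val_mul, val_C, e20,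
          e4, hj', e22, val_emin, val_Rd, Function.update_apply]
        split_ifs with hbj
        · obtain rfl : b = j := by omega
          rw [pow_succ] at hbn ⊢
          rw [hx _ (by omega), hx _ (by omega)]
          have m1 := hrow b (by omega)
          have m2 := hrow (b + 2 ^ k) (by omega)
          rw [show b + 2 ^ k + 2 ^ k = b + 2 ^ k * 2 by ring, ← add_assoc] at m2
          have e1 : (b + 2 ^ k) * B = b * B + 2 ^ k * B := by ring
          have e2 : (b + 2 ^ k * 2) * B = b * B + 2 ^ k * B + 2 ^ k * B := by ring
          exact m1.union m2 (by omega) (by omega) (by omega)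
        · exact hI b (by omega) hbn)
  refine ⟨s', hr, hI.1, fun b hb => hI.2 b ?_ hb⟩
  have : 0 < 2 ^ (k + 1) := by positivity
  omega

/-- The time is linear as 2^B ≤ 2N and nb * B ≤ N + B: the sparse table has B + 1 rows of nb cells.
Its rows suffice for all ranges of blocks since nb ≤ 2^B. -/
theorem rmqBuild_run {s : State} (hb : Bdd W s) {N : ℕ} (h10 : s.reg 10 = N) (hN : 0 < N)
    (hW : 8 * N + 20 < W) :
    ∃ s' B nb, Run W rmqBuild s (20 * N + 20) s' ∧ IsRMQ W s' B nb ∧ N ≤ nb * B := by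
  obtain ⟨s₁, r₁, B, e3, hB, hBN, hlt, hle, hp⟩ := rmqPow_run hb h10 hN hW
  have b₁ := r₁.bdd hb
  have f₁ := r₁.frame
  set nb := N / B + 1 with hnb
  have hdm := Nat.div_add_mod' N B
  have hmod := Nat.mod_lt N hB
  have hnbB : nb * B = N / B * B + B := Nat.succ_mul _ _
  have hdiv := Nat.div_le_self N B
  have hBnb : (B + 1) * nb = nb * B + nb := by ring
  have e22 : s₁.mem 22 B = 2 ^ B := hp B le_rfl
  have r₂ := run_den (p := rmqSizes) b₁ (by
    simp [rmqSizes, Prog.Safe, Prog.den, f₁.reg 10 rfl, h10, e3, e22, ← hnb]; omega)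
  have b₂ := r₂.bdd b₁
  simp only [rmqSizes, Prog.den, val_V, val_C, val_add, val_mul, val_div, val_Rd, setReg_reg,
    setReg_mem, f₁.reg 10 rfl, h10, e3, e22, ← hnb, if_true, Nat.reduceEqDiff, if_false] at r₂ b₂
  obtain ⟨s₃, r₃, h24⟩ := rmqLog_run b₂ (N := nb + 1) (by simp) (by omega)
  have b₃ := r₃.bdd b₂
  have f₃ := r₃.frame
  obtain ⟨s₄, r₄, h23⟩ := rmqLsb_run b₃ (N := 2 ^ B) (by simp [f₃.reg 29 rfl]) (by omega)
  have b₄ := r₄.bdd b₃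
  have f₄ := (r₃.seq r₄).frame
  have e22' : s₄.mem 22 = s₁.mem 22 := (f₄.mem 22 rfl).trans (by simp)
  obtain ⟨s₅, r₅, h25⟩ := rmqMask_run b₄ hB ((f₄.reg 3 rfl).trans (by simp [e3])) (M := nb * B)
    ((f₄.reg 14 rfl).trans (by simp)) (by omega) (by rwa [e22'])
  have b₅ := r₅.bdd b₄
  have f₅ := r₅.frame
  have f₅' := (r₃.seq (r₄.seq r₅)).frame
  have hbl : Blocks W s₅ B nb := by
    refine ⟨(f₅'.reg 3 rfl).trans (by simp [e3]), (f₅'.reg 4 rfl).trans (by simp), hB, by omega,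
      by omega, by omega, ?_, ?_, ?_, ?_⟩
    · rwa [f₅.mem 22 rfl, e22']
    · rw [(r₄.seq r₅).frame.mem 24 rfl]
      exact fun k hk => h24 k (by omega)
    · rwa [f₅.mem 23 rfl]
    · rwa [f₅.mem 21 rfl]
  obtain ⟨s₆, r₆, h26⟩ := rmqRow_run b₅ hbl
  have b₆ := r₆.bdd b₅
  have f₆ := r₆.frame
  have hbl₆ : Blocks W s₆ B nb := hbl.congr (f₆.reg 3 rfl) (f₆.reg 4 rfl) (f₆.mem 21 rfl)
    (f₆.mem 22 rfl) (f₆.mem 23 rfl) (f₆.mem 24 rfl) (f₆.mem 25 rfl)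
  rw [← f₆.mem 21 rfl] at h26
  obtain ⟨s₇, r₇, h₇, -⟩ := run_for b₆ (x := 20) (y := 3) (body := rmqNextRow) rfl rfl hbl₆.len
    (fun k s' => ∀ j ≤ k, ∀ b, b + 2 ^ j ≤ nb →
      IsMin (s₆.mem 21) (b * B) ((b + 2 ^ j) * B - 1) (s'.mem 26 (j * nb + b)))
    (fun _ => 0) nb
    (by
      intro j hj b hb
      obtain rfl : j = 0 := by omega
      simpa using h26 b (by simpa using hb))
    (by
      intro k hk s' hb' hf hk' hI
      have h' := hbl₆.congr (hf.reg 3 rfl) (hf.reg 4 rfl) (hf.mem 21 rfl) (hf.mem 22 rfl)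
        (hf.mem 23 rfl) (hf.mem 24 rfl) (hf.mem 25 rfl)
      obtain ⟨s'', r, hx, hrow⟩ := rmqNextRow_run hb' h' hk hk' (by
        rw [hf.mem 21 rfl]; exact hI k le_rfl)
      rw [hf.mem 21 rfl] at hrow
      refine ⟨s'', _, r, fun j hj b hb => ?_, by omega⟩
      rcases Nat.lt_or_ge k j with c | c
      · obtain rfl : j = k + 1 := by omega
        exact hrow b hb
      · have : 0 < 2 ^ j := by positivity
        have : (j + 1) * nb ≤ (k + 1) * nb := Nat.mul_le_mul_right _ (by omega)
        rw [Nat.succ_mul] at this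
        simp only [setReg_mem]
        rw [hx _ (by omega)]
        exact hI j c b hb)
  have f₇ := r₇.frame
  refine ⟨s₇, B, nb, (r₁.seq (r₂.seq (r₃.seq (r₄.seq (r₅.seq (r₆.seq r₇)))))).mono ?_,
    ⟨hbl₆.congr (f₇.reg 3 rfl) (f₇.reg 4 rfl) (f₇.mem 21 rfl) (f₇.mem 22 rfl) (f₇.mem 23 rfl)
      (f₇.mem 24 rfl) (f₇.mem 25 rfl), ?_⟩, by omega⟩
  · have : B * (nb + 1) = nb * B + B := by ring
    omega
  · rw [f₇.mem 21 rfl]; exact h₇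

/-- Computes in `reg 32` the minimum of the cells `reg 30, …, reg 31` of array `21`. -/
def rmqQuery : Prog :=
  .cond (V 30 / V 3 ≡ₑ V 31 / V 3) (32 ≔ inBlock (V 30) (V 31))
    ((33 ≔ V 30 / V 3 + C 1 ⨾ 34 ≔ V 31 / V 3 ⨾
      32 ≔ emin (inBlock (V 30) (V 33 * V 3 - C 1)) (inBlock (V 34 * V 3) (V 31))) ⨾
     .cond (V 33 ≺ₑ V 34)
      (35 ≔ Rd 24 (V 34 - V 33) ⨾ 32 ≔ emin (V 32) (emin (Rd 26 (V 35 * V 4 + V 33))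
        (Rd 26 (V 35 * V 4 + V 34 - Rd 22 (V 35))))) .skip)

/-- A range inside one block is a mask lookup. Otherwise it splits into the end of the left block,
the start of the right block, and the full blocks between them, if any. -/
theorem rmqQuery_run {s : State} (hb : Bdd W s) {B nb l r : ℕ} (h : IsRMQ W s B nb)
    (hl : s.reg 30 = l) (hr : s.reg 31 = r) (hlr : l ≤ r) (hrn : r < nb * B) :
    ∃ s', Run W rmqQuery s 0 s' ∧ IsMin (s.mem 21) l r (s'.reg 32) := by
  have hB := h.pos
  have h1W := hb.one_lt
  have hW := h.bound
  have hW' := h.bound'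
  have hpw : 0 < 2 ^ B := by positivity
  have hnb := h.num_le
  by_cases hd : l / B = r / B
  · obtain ⟨hs, hm⟩ := h.inBlock (e := V 30) (f := V 31) (by simp) (by simp) hl hr hlr hrn hd
    refine ⟨_, .cond_true hb (by simp) (by simp [hl, hr, h.len, hd])
      (run_den (p := 32 ≔ inBlock (V 30) (V 31)) hb hs), ?_⟩
    simpa [Prog.den] using hm
  have hlt : l / B < r / B := lt_of_le_of_ne (Nat.div_le_div_right hlr) hd
  have hrb : r / B < nb := Nat.div_lt_of_lt_mul (by rwa [mul_comm])
  have l1 := Nat.div_add_mod' l B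
  have l2 := Nat.div_add_mod' r B
  have l3 := Nat.mod_lt l hB
  have l4 := Nat.mod_lt r hB
  have l5 : (l / B + 1) * B ≤ r / B * B := Nat.mul_le_mul_right _ hlt
  have l6 : (l / B + 1) * B = l / B * B + B := Nat.succ_mul _ _
  have r₁ := run_den (p := (33 ≔ V 30 / V 3 + C 1 ⨾ 34 ≔ V 31 / V 3)) hb
    (by simp [Prog.Safe, Prog.den, hl, h.len]; omega)
  have b₁ := r₁.bdd hb
  simp only [Prog.den, val_V, val_C, val_add, val_div, setReg_reg, hl, hr, h.len, Nat.reduceEqDiff,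
    if_false] at r₁ b₁
  set s₁ := (s.setReg 33 (l / B + 1)).setReg 34 (r / B) with hs₁
  have h₁ : IsRMQ W s₁ B nb := h.congr (by simp [hs₁]) (by simp [hs₁]) rfl rfl rfl rfl rfl rfl
  have e33 : s₁.reg 33 = l / B + 1 := by simp [hs₁]
  have e34 : s₁.reg 34 = r / B := by simp [hs₁]
  obtain ⟨q₁, m₁⟩ := h₁.inBlock (e := V 30) (f := V 33 * V 3 - C 1) (l := l)
    (r := (l / B + 1) * B - 1) (by simp) (by simp [e33, h₁.len]; omega) (by simp [hs₁, hl])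
    (by simp [e33, h₁.len]) (by omega) (by omega)
    (Nat.div_eq_of_lt_le (by omega) (by rw [Nat.succ_mul]; omega)).symm
  obtain ⟨q₂, m₂⟩ := h₁.inBlock (e := V 34 * V 3) (f := V 31) (l := r / B * B)
    (r := r) (by simp [e34, h₁.len]; omega) (by simp) (by simp [e34, h₁.len])
    (by simp [hs₁, hr]) (by omega) (by omega) (by rw [Nat.mul_div_cancel _ hB])
  have r₂ := run_den (p := 32 ≔ emin (inBlock (V 30) (V 33 * V 3 - C 1)) (inBlock (V 34 * V 3) (V 31)))
    b₁ (by simpa [Prog.Safe] using ⟨q₁, q₂⟩)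
  have b₂ := r₂.bdd b₁
  simp only [Prog.den, val_emin] at r₂ b₂
  set u := (inBlock (V 30) (V 33 * V 3 - C 1)).val s₁ with hu
  set v := (inBlock (V 34 * V 3) (V 31)).val s₁ with hv
  have r₁₂ : Run W (33 ≔ V 30 / V 3 + C 1 ⨾ 34 ≔ V 31 / V 3 ⨾
      32 ≔ emin (inBlock (V 30) (V 33 * V 3 - C 1)) (inBlock (V 34 * V 3) (V 31))) s 0
      (s₁.setReg 32 (min u v)) := by
    have q₁ : Run W (33 ≔ V 30 / V 3 + C 1) s 0 (s.setReg 33 (l / B + 1)) := by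
      have := run_den (p := 33 ≔ V 30 / V 3 + C 1) hb (by simp [Prog.Safe, hl, h.len]; omega)
      simpa [Prog.den, hl, h.len] using this
    have q₂ : Run W (34 ≔ V 31 / V 3) (s.setReg 33 (l / B + 1)) 0 s₁ := by
      have := run_den (p := 34 ≔ V 31 / V 3) (s := s.setReg 33 (l / B + 1))
        (hb.setReg (by omega)) (by simp [Prog.Safe])
      simpa [Prog.den, hr, h.len] using this
    exact (q₁.seq (q₂.seq r₂)).mono le_rfl
  have notd : (V 30 / V 3 ≡ₑ V 31 / V 3).val s = 0 := by simp [hl, hr, h.len, hd]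
  by_cases hc : l / B + 1 < r / B
  swap
  · refine ⟨_, .cond_false hb (by simp) notd (r₁₂.seq (.cond_false b₂ (by simp)
      (by simp [e33, e34]; omega) (run_den (p := .skip) b₂ trivial))), ?_⟩
    simp only [Prog.den, setReg_reg, if_true]
    have : l / B + 1 = r / B := by omega
    exact m₁.union m₂ (by omega) (by omega) (by rw [← this]; omega)
  -- The d full blocks in the middle are covered by two overlapping runs of 2^k blocks, with 2^k ≤ d
  -- < 2^(k+1).
  set d := r / B - (l / B + 1) with hdd
  set k := Nat.log 2 d with hk
  have hd0 : d ≠ 0 := by omega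
  have hk1 : 2 ^ k ≤ d := Nat.pow_log_le_self 2 hd0
  have hk2 : d < 2 ^ (k + 1) := Nat.lt_pow_succ_log_self (by omega) d
  have hkB : k ≤ B := by
    by_contra! hc
    have : 2 ^ B < 2 ^ k := Nat.pow_lt_pow_right (by omega) hc
    omega
  rw [pow_succ] at hk2
  have hp := h.pow k hkB
  have hlog := h.log d (by omega)
  have hknb : k * nb + nb ≤ (B + 1) * nb := by
    rw [← Nat.succ_mul]; exact Nat.mul_le_mul_right _ (by omega)
  have s1 := h.sparse k hkB (l / B + 1) (by omega)
  have s2 := h.sparse k hkB (r / B - 2 ^ k) (by omega)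
  rw [show r / B - 2 ^ k + 2 ^ k = r / B by omega] at s2
  have r₃ := run_den (p := (35 ≔ Rd 24 (V 34 - V 33) ⨾ 32 ≔ emin (V 32)
    (emin (Rd 26 (V 35 * V 4 + V 33)) (Rd 26 (V 35 * V 4 + V 34 - Rd 22 (V 35)))))) b₂
    (by
      simp [Prog.Safe, Prog.den, e33, e34, ← hdd, h₁.num]
      simp only [hs₁, setReg_mem, hlog, ← hk]
      omega)
  refine ⟨_, .cond_false hb (by simp) notd (r₁₂.seq (.cond_true b₂ (by simp)
      (by simp [e33, e34]; omega) r₃)), ?_⟩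
  simp only [Prog.den, val_emin, val_V, val_Rd, val_add, val_mul, val_sub, setReg_reg, setReg_mem,
    e33, e34, ← hdd, h₁.num, Nat.reduceEqDiff, if_true, if_false]
  have g24 : s₁.mem 24 = s.mem 24 := rfl
  have g26 : s₁.mem 26 = s.mem 26 := rfl
  have g22 : s₁.mem 22 = s.mem 22 := rfl
  have g21 : s₁.mem 21 = s.mem 21 := rfl
  rw [g21] at m₁ m₂
  rw [g24, g26, g22, hlog, ← hk, hp, show k * nb + r / B - 2 ^ k = k * nb + (r / B - 2 ^ k) by omega]
  have n1 : (r / B - 2 ^ k) * B ≤ (l / B + 1 + 2 ^ k) * B := Nat.mul_le_mul_right _ (by omega)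
  have n2 : (l / B + 1) * B ≤ (r / B - 2 ^ k) * B := Nat.mul_le_mul_right _ (by omega)
  have n3 : (l / B + 1 + 2 ^ k) * B ≤ r / B * B := Nat.mul_le_mul_right _ (by omega)
  have n4 : (l / B + 1) * B ≤ (l / B + 1 + 2 ^ k) * B := Nat.mul_le_mul_right _ (by omega)
  have mid := s1.union s2 n2 (by omega) (by omega)
  have := (m₁.union mid (by omega) (by omega) (by omega)).union m₂ (by omega) (by omega) (by omega)
  rwa [show min (min u v) (min (s.mem 26 (k * nb + (l / B + 1))) (s.mem 26 (k * nb + (r / B - 2 ^ k)))) =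
    min (min u (min (s.mem 26 (k * nb + (l / B + 1))) (s.mem 26 (k * nb + (r / B - 2 ^ k))))) v by
    omega]

end WordRAM

/-! ### The preprocessing program -/

namespace SuffixSorting

open WordRAM

variable {W : ℕ}

/-- The string `S` with all symbols increased by one, followed by a sentinel. -/
def text (S : List ℕ) (k : ℕ) : ℕ := if k < S.length then S.getD k 0 + 1 else 0

theorem text_of_lt {S : List ℕ} {k : ℕ} (h : k < S.length) : text S k = S.getD k 0 + 1 := if_pos h

theorem text_of_ge {S : List ℕ} {k : ℕ} (h : S.length ≤ k) : text S k = 0 := if_neg (not_lt.2 h)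

theorem text_uniqLast (S : List ℕ) : UniqLast (text S) (S.length + 1) :=
  ⟨by omega, fun p hp => by
    rw [text_of_lt (by omega), text_of_ge (by omega)]; omega⟩

theorem Lce.congr {T T' : ℕ → ℕ} {N p q L : ℕ} (h : Lce T p q L) (hu : UniqLast T N)
    (he : ∀ k < N, T k = T' k) (hp : p < N) (hq : q < N) : Lce T' p q L := by
  have hpq : p ≠ q := by
    rintro rfl; exact h.ne rfl
  have hlt : p + L < N ∧ q + L < N := by
    cases L with
    | zero => exact ⟨hp, hq⟩
    | succ l => exact hu.succ_lt hp hq hpq fun k hk => h.eq k (by omega)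
  exact ⟨fun k hk => by rw [← he _ (by omega), ← he _ (by omega)]; exact h.eq k hk,
    by rw [← he _ hlt.1, ← he _ hlt.2]; exact h.ne⟩

/-- The common prefix of two suffixes is the minimum of those of the neighbours between them. -/
theorem lce_of_isMin {T sa lcp : ℕ → ℕ} {N : ℕ} (hsa : IsSA T N sa)
    (hl : ∀ t, 0 < t → t < N → Lce T (sa (t - 1)) (sa t) (lcp t)) (a d v : ℕ) (hd : a + d + 1 < N)
    (hv : IsMin lcp (a + 1) (a + d + 1) v) : Lce T (sa a) (sa (a + d + 1)) v := by
  induction d generalizing v with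
  | zero =>
    obtain ⟨⟨q, h1, h2, h3⟩, -⟩ := hv
    obtain rfl : q = a + 1 := by omega
    exact h3 ▸ hl (a + 1) (by omega) hd
  | succ d ih =>
    obtain ⟨q, h1, h2, h3, -⟩ := exists_last_min lcp (a + 1) d
    have hm : IsMin lcp (a + 1) (a + d + 1) (lcp q) :=
      ⟨⟨q, h1, by omega, rfl⟩, fun x hx hx' => h3 x hx (by omega)⟩
    have hlast : IsMin lcp (a + d + 2) (a + d + 2) (lcp (a + d + 2)) :=
      ⟨⟨_, le_rfl, le_rfl, rfl⟩, fun x hx hx' => by rw [show x = a + d + 2 by omega]⟩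
    have e := hv.unique (hm.union hlast (by omega) (by omega) (by omega))
    -- The minimum up to the last neighbour is the minimum of the shorter range and one more entry;
    -- prefixes in sorted order compose in the same way by `Lce.trans`.
    rw [e]
    exact (ih _ (by omega) hm).trans (hl (a + d + 2) (by omega) (by omega))
      (hsa.sorted _ _ (by omega) (by omega)) (hsa.sorted _ _ (by omega) (by omega))

/-- What the preprocessing leaves in the store for the sorting requests. -/
structure IsReady (W : ℕ) (S : List ℕ) (s : State) : Prop where
  bdd : Bdd W s
  len : s.reg 2 = S.length
  str : ∀ k < S.length, s.mem 0 k = S.getD k 0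
  rmq : ∃ B nb, IsRMQ W s B nb ∧ S.length + 1 ≤ nb * B
  rank_lt : ∀ p < S.length, s.mem 20 p < S.length + 1
  rank_inj : ∀ p < S.length, ∀ q < S.length, s.mem 20 p = s.mem 20 q → p = q
  lce : ∀ p < S.length, ∀ q < S.length, s.mem 20 p < s.mem 20 q →
    ∀ v, IsMin (s.mem 21) (s.mem 20 p + 1) (s.mem 20 q) v → Lce (text S) p q v

/-- Copies the string. -/
def preCopy : Prog := 2 ≔ V 0 ⨾ forLt 20 2 (.store 3 (V 20) (Rd 0 (V 20) + C 1))

/-- Appends the sentinel and the pads. -/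
def prePad : Prog :=
  .store 3 (V 2) (C 0) ⨾ .store 3 (V 2 + C 1) (C 0) ⨾ .store 3 (V 2 + C 2) (C 0) ⨾
  10 ≔ V 2 + C 1 ⨾ 11 ≔ V 1 + C 1 ⨾ 12 ≔ C 0 ⨾ 13 ≔ C 0

/-- The preprocessing program. -/
def preprocess : Prog :=
  preCopy ⨾ prePad ⨾ suffixArray ⨾ 10 ≔ V 2 + C 1 ⨾ ranks ⨾ kasai ⨾ rmqBuild

theorem preCopy_run {s : State} (hb : Bdd W s) {S : List ℕ} (h0 : s.reg 0 = S.length)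
    (hS : ∀ k < S.length, s.mem 0 k = S.getD k 0) (hW : ∀ k < S.length, S.getD k 0 + 1 < W) :
    ∃ s', Run W preCopy s S.length s' ∧ s'.reg 2 = S.length ∧
      ∀ k < S.length, s'.mem 3 k = text S k := by
  have r₁ := run_den (p := 2 ≔ V 0) hb (by simp [Prog.Safe])
  have b₁ := r₁.bdd hb
  simp only [Prog.den, val_V, h0] at r₁ b₁
  obtain ⟨s', hr, hI, -⟩ := run_for_straight (x := 20) (y := 2)
    (body := .store 3 (V 20) (Rd 0 (V 20) + C 1)) b₁ rfl rfl (N := S.length) (by simp)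
    (fun k s' => ∀ a < k, s'.mem 3 a = text S a) (by simp)
    (by
      intro k hk s' hb' hf hk' hI
      have e0 : s'.mem 0 k = S.getD k 0 := by rw [hf.mem 0 rfl]; simpa using hS k hk
      have := hW k hk
      have := hb.one_lt
      refine ⟨by simp only [Prog.Safe, safe_add, safe_V, safe_Rd, safe_C, val_Rd, val_V, val_C, hk', e0,
        true_and]; omega, fun a ha => ?_⟩
      simp only [Prog.den, val_add, val_Rd, val_V, val_C, hk', e0, setReg_mem, setMem_mem, if_true,
        Function.update_apply]
      split_ifs with h
      · rw [h, text_of_lt hk]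
      · exact hI a (by omega))
  exact ⟨s', (r₁.seq hr).mono (by omega), (hr.frame.reg 2 rfl).trans (by simp), hI⟩

theorem prePad_run {s : State} (hb : Bdd W s) {S : List ℕ} {σ : ℕ} (hσ : ∀ a ∈ S, a < σ)
    (hW : 6 * (S.length + 1) + 20 < W) (hσW : σ + 1 < W) (h1 : s.reg 1 = σ)
    (h2 : s.reg 2 = S.length) (h3 : ∀ k < S.length, s.mem 3 k = text S k) :
    ∃ s', Run W prePad s 0 s' ∧ IsLevel W s' 0 (S.length + 1) (σ + 1) 0 ∧
      ∀ k < S.length + 3, s'.mem 3 k = text S k := by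
  have r := run_den (p := prePad) hb (by simp [prePad, Prog.Safe, Prog.den, h1, h2]; omega)
  simp only [prePad, Prog.den, val_V, val_C, val_add, setReg_reg, setMem_reg, h1, h2,
    Nat.reduceEqDiff, if_false] at r
  have hmem : ∀ k < S.length + 3, Function.update (Function.update (Function.update (s.mem 3)
      S.length 0) (S.length + 1) 0) (S.length + 2) 0 k = text S k := by
    intro k hk
    simp only [Function.update_apply]
    split_ifs
    · rw [text_of_ge (by omega)]
    · rw [text_of_ge (by omega)]
    · rw [text_of_ge (by omega)]
    · exact h3 k (by omega)
  have hmem' : ∀ k < S.length + 3, text S k < σ + 1 := by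
    intro k hk
    rcases Nat.lt_or_ge k S.length with c | c
    · have : S.getD k 0 ∈ S := by
        rw [List.getD_eq_getElem _ _ c]; exact List.getElem_mem c
      rw [text_of_lt c]
      have := hσ _ this
      omega
    · rw [text_of_ge c]; omega
  refine ⟨_, r, ⟨by simp, by simp, by simp, by simp, ?_, ?_, by omega, by omega⟩, ?_⟩
  · refine (text_uniqLast S).congr fun k hk => ?_
    simp [hmem k (by omega)]
  · intro k hk
    simpa [hmem k (by omega)] using hmem' k (by omega)
  · intro k hk
    simpa using hmem k hk

theorem preprocess_run {s : State} (hb : Bdd W s) {S : List ℕ} {σ : ℕ} (hσ : ∀ a ∈ S, a < σ)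
    (hW : 8 * (S.length + 1) + 20 < W) (hσW : σ + 1 < W) (h0 : s.reg 0 = S.length)
    (h1 : s.reg 1 = σ) (hS : ∀ k < S.length, s.mem 0 k = S.getD k 0) :
    ∃ s', Run W preprocess s (8 * (σ + 1) + 130 * (S.length + 1)) s' ∧ IsReady W S s' := by
  have hSσ : ∀ k < S.length, S.getD k 0 + 1 < W := fun k hk => by
    have : S.getD k 0 ∈ S := by
      rw [List.getD_eq_getElem _ _ hk]; exact List.getElem_mem hk
    have := hσ _ this
    omega
  set n := S.length with hn
  have hu := text_uniqLast S
  obtain ⟨s₁, r₁, e2, e3⟩ := preCopy_run hb h0 hS hSσ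
  have b₁ := r₁.bdd hb
  have f₁ := r₁.frame
  obtain ⟨s₂, r₂, hl, e3'⟩ := prePad_run b₁ hσ (by omega) hσW ((f₁.reg 1 rfl).trans h1) e2 e3
  have b₂ := r₂.bdd b₁
  have f₂ := (r₁.seq r₂).frame
  obtain ⟨s₃, r₃, hsa, hX⟩ := suffixArray_run b₂ hl
  have b₃ := r₃.bdd b₂
  have f₃ := (r₂.seq r₃).frame
  have e2₃ : s₃.reg 2 = n := (f₃.reg 2 rfl).trans e2
  have hT : ∀ k < n + 1, text S k = s₃.mem 3 k := fun k hk => by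
    rw [hX k (by omega), e3' k (by omega)]
  have hu₃ := hu.congr hT
  have hsa₃ : IsSA (s₃.mem 3) (n + 1) (s₃.mem 7) :=
    hsa.congr (hu.congr fun k hk => (e3' k (by omega)).symm) fun k hk => (hX k (by omega)).symm
  have r₄ := run_den (p := 10 ≔ V 2 + C 1) b₃ (by simp [Prog.Safe, e2₃]; omega)
  have b₄ := r₄.bdd b₃
  simp only [Prog.den, val_add, val_V, val_C, e2₃] at r₄ b₄
  obtain ⟨s₅, r₅, hrk⟩ := ranks_run b₄ (T := s₃.mem 3) (N := n + 1) (by simp) (by simpa using hsa₃)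
  have b₅ := r₅.bdd b₄
  have f₅ := r₅.frame
  have m3 : s₅.mem 3 = s₃.mem 3 := f₅.mem 3 rfl
  have m7 : s₅.mem 7 = s₃.mem 7 := f₅.mem 7 rfl
  simp only [setReg_mem] at hrk
  have inv : ∀ p < n + 1, s₅.mem 20 p < n + 1 ∧ s₃.mem 7 (s₅.mem 20 p) = p := fun p hp => by
    obtain ⟨a, ha, rfl⟩ := hsa₃.exists_eq hp
    rw [hrk a ha]; exact ⟨ha, rfl⟩
  -- The sentinel suffix is the smallest and occupies rank 0, so every other suffix has a
  -- predecessor.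
  have hpos : ∀ p < n, 0 < s₅.mem 20 p := fun p hp => by
    obtain ⟨c1, c2⟩ := inv p (by omega)
    obtain ⟨d1, d2⟩ := inv n (by omega)
    have : SLt (s₃.mem 3) n p := .of_lt (by
      rw [← hT n (by omega), ← hT p (by omega), text_of_ge le_rfl, text_of_lt hp]; omega)
    have := hsa₃.lt_of_slt d1 (b := s₅.mem 20 p) (by rwa [c2, d2])
    omega
  obtain ⟨s₆, r₆, hlcp⟩ := kasai_run b₅ (n := n) (by rwa [m3]) (by omega)
    ((f₅.reg 2 rfl).trans (by simpa using e2₃)) (by rwa [m3, m7]) (by rwa [m7]) hpos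
  rw [m3, m7] at hlcp
  have b₆ := r₆.bdd b₅
  have f₆ := r₆.frame
  obtain ⟨s₇, B, nb, r₇, hrmq, hNB⟩ := rmqBuild_run b₆ (N := n + 1)
    ((f₆.reg 10 rfl).trans ((f₅.reg 10 rfl).trans (by simp))) (by omega) hW
  have f₇ := r₇.frame
  have f := (r₁.seq (r₂.seq (r₃.seq (r₄.seq (r₅.seq (r₆.seq r₇)))))).frame
  have m20 : s₇.mem 20 = s₅.mem 20 := (r₆.seq r₇).frame.mem 20 rfl
  have hadj : ∀ t, 0 < t → t < n + 1 →
      Lce (text S) (s₃.mem 7 (t - 1)) (s₃.mem 7 t) (s₆.mem 21 t) := by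
    intro t h0 ht
    have hlt := hsa₃.lt t ht
    have hrt := hrk t ht
    rcases Nat.lt_or_ge (s₃.mem 7 t) n with c | c
    · have := hlcp _ c
      rw [hrt] at this
      exact (Lce.congr this hu₃ (fun k hk => (hT k hk).symm) hlt (hsa₃.lt _ (by omega))).symm
    -- Kasai's loop skips the sentinel; this is harmless, as the sentinel stands at rank 0 and t is
    -- positive.
    · have h0n := hsa₃.lt 0 (by omega)
      have hr0 := hrk 0 (by omega)
      rcases Nat.lt_or_ge (s₃.mem 7 0) n with c' | c'
      · have := hpos _ c'
        omega
      · have := hsa₃.injOn (by omega) ht (show s₃.mem 7 0 = s₃.mem 7 t by omega)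
        omega
  have hsaT : IsSA (text S) (n + 1) (s₃.mem 7) :=
    hsa₃.congr hu₃ fun k hk => (hT k hk).symm
  refine ⟨s₇, (r₁.seq (r₂.seq (r₃.seq (r₄.seq (r₅.seq (r₆.seq r₇)))))).mono (by omega),
    r₇.bdd b₆, ?_, ?_, ⟨B, nb, hrmq, hNB⟩, ?_, ?_, ?_⟩
  · exact ((r₅.seq (r₆.seq r₇)).frame.reg 2 rfl).trans (by simpa using e2₃)
  · rw [f.mem 0 rfl]; exact hS
  · rw [m20]; exact fun p hp => (inv p (by omega)).1
  · rw [m20]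
    intro p hp q hq h
    rw [← (inv p (by omega)).2, h, (inv q (by omega)).2]
  · rw [m20, f₇.mem 21 rfl]
    intro p hp q hq hlt v hv
    obtain ⟨c1, c2⟩ := inv p (by omega)
    obtain ⟨d1, d2⟩ := inv q (by omega)
    obtain ⟨d, hd⟩ : ∃ d, s₅.mem 20 q = s₅.mem 20 p + d + 1 :=
      ⟨s₅.mem 20 q - s₅.mem 20 p - 1, by omega⟩
    rw [hd] at hv
    have := lce_of_isMin hsaT hadj _ d v (by omega) hv
    rwa [c2, ← hd, d2] at this

end SuffixSorting

/-! ### The sorting program -/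

namespace SuffixSorting

open WordRAM

variable {W : ℕ}

/-! ### Lexicographic comparison of list suffixes by their first mismatch -/

section lists

variable {U : List ℕ} {p q : ℕ}

theorem drop_lt_of_getD_lt (hp : p < U.length) (hq : q < U.length)
    (h : U.getD p 0 < U.getD q 0) : U.drop p < U.drop q := by
  rw [List.drop_eq_getElem_cons hp, List.drop_eq_getElem_cons hq, List.cons_lt_cons_iff]
  rw [List.getD_eq_getElem _ _ hp, List.getD_eq_getElem _ _ hq] at h
  exact .inl h

theorem drop_lt_of_drop_succ_lt (hp : p < U.length) (hq : q < U.length)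
    (h : U.getD p 0 = U.getD q 0) (hl : U.drop (p + 1) < U.drop (q + 1)) :
    U.drop p < U.drop q := by
  rw [List.drop_eq_getElem_cons hp, List.drop_eq_getElem_cons hq, List.cons_lt_cons_iff]
  rw [List.getD_eq_getElem _ _ hp, List.getD_eq_getElem _ _ hq] at h
  exact .inr ⟨h, hl⟩

theorem drop_length_lt (hp : p < U.length) : U.drop U.length < U.drop p := by
  rw [List.drop_eq_getElem_cons hp, List.drop_length]
  exact List.nil_lt_cons _ _

theorem drop_lt_of_prefix {L : ℕ} (he : ∀ k < L, U.getD (p + k) 0 = U.getD (q + k) 0)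
    (hp : p + L ≤ U.length) (hq : q + L ≤ U.length) (h : U.drop (p + L) < U.drop (q + L)) :
    U.drop p < U.drop q := by
  induction L generalizing p q with
  | zero => exact h
  | succ L ih =>
    refine drop_lt_of_drop_succ_lt (by omega) (by omega) (he 0 (by omega))
      (ih (fun k hk => ?_) (by omega) (by omega) ?_)
    · have := he (k + 1) (by omega)
      rwa [← add_assoc, ← add_assoc, add_right_comm, add_right_comm q] at this
    · rwa [add_right_comm p, add_right_comm q]

end lists

theorem remap_getD {M : ℕ → ℕ} {S : List ℕ} {k : ℕ} (hk : k < S.length) :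
    (remap M S).getD k 0 = M (S.getD k 0) := by
  rw [List.getD_eq_getElem _ _ (by simpa [remap] using hk), List.getD_eq_getElem _ _ hk]
  simp [remap]

/-- The order of two remapped suffixes is decided by the first mismatch. -/
theorem remap_compare {S : List ℕ} {M : ℕ → ℕ} (hM : Set.InjOn M {a | a ∈ S}) {p q L : ℕ}
    (h : Lce (text S) p q L) (hpq : p < q) (hq : q < S.length) :
    q + L ≤ S.length ∧
    (q + L = S.length → (remap M S).drop q < (remap M S).drop p) ∧
    (q + L ≠ S.length →
      (M (S.getD (p + L) 0) < M (S.getD (q + L) 0) → (remap M S).drop p < (remap M S).drop q) ∧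
      (¬ M (S.getD (p + L) 0) < M (S.getD (q + L) 0) →
        (remap M S).drop q < (remap M S).drop p)) := by
  have hlen : (remap M S).length = S.length := by simp [remap]
  have hL : q + L ≤ S.length := by
    cases L with
    | zero => omega
    | succ L =>
      have := ((text_uniqLast S).succ_lt (d := L) (p := p) (q := q) (by omega) (by omega) hpq.ne
        fun k hk => h.eq k (by omega)).2
      omega
  have he : ∀ k < L, (remap M S).getD (p + k) 0 = (remap M S).getD (q + k) 0 := fun k hk => by
    have := h.eq k hk
    rw [text_of_lt (by omega), text_of_lt (by omega)] at this
    rw [remap_getD (by omega), remap_getD (by omega), Nat.succ.inj this]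
  have hne := h.ne
  refine ⟨hL, fun hc => ?_, fun hc => ⟨fun hlt => ?_, fun hge => ?_⟩⟩
  -- Here the suffix at q ends first and is a proper prefix of the one at p, whatever M is.
  · refine drop_lt_of_prefix (fun k hk => (he k hk).symm) (by omega) (by omega) ?_
    rw [hc, ← hlen]
    exact drop_length_lt (by omega)
  · refine drop_lt_of_prefix he (by omega) (by omega) (drop_lt_of_getD_lt (by omega) (by omega) ?_)
    rwa [remap_getD (by omega), remap_getD (by omega)]
  · refine drop_lt_of_prefix (fun k hk => (he k hk).symm) (by omega) (by omega)
      (drop_lt_of_getD_lt (by omega) (by omega) ?_)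
    rw [remap_getD (by omega), remap_getD (by omega)]
    -- This is the only use of injectivity: equal images would mean equal symbols, against the
    -- mismatch in S.
    refine lt_of_le_of_ne (not_lt.1 hge) fun h' => hne ?_
    rw [text_of_lt (by omega), text_of_lt (by omega)]
    have hmem : ∀ k < S.length, S.getD k 0 ∈ {a | a ∈ S} := fun k hk => by
      rw [Set.mem_ofPred_eq, List.getD_eq_getElem _ _ hk]; exact List.getElem_mem hk
    rw [hM (hmem _ (by omega)) (hmem _ (by omega)) h']

/-- `T` lists the symbols at the positions `i, …, i + m` of `U`, refined by the order of the suffixes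
there relative to the suffix at `i + m`. -/
structure Refines (U : List ℕ) (i m : ℕ) (T c : ℕ → ℕ) : Prop where
  lt : i + m < U.length
  eq : ∀ k ≤ m, T k = 3 * U.getD (i + k) 0 + c k
  last : c m = 1
  compare : ∀ k < m, c k = 0 ∧ U.drop (i + k) < U.drop (i + m) ∨
    c k = 2 ∧ U.drop (i + m) < U.drop (i + k)

/-- Modulo 3 the last symbol is 1 and all others are 0 or 2. -/
theorem Refines.uniqLast {U : List ℕ} {i m : ℕ} {T c : ℕ → ℕ} (h : Refines U i m T c) :
    UniqLast T (m + 1) := by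
  refine ⟨by omega, fun p hp he => ?_⟩
  rw [Nat.add_sub_cancel, h.eq p (by omega), h.eq m le_rfl, h.last] at he
  rcases h.compare p (by omega) with h' | h' <;> omega

/-- The suffix order of the refined window is that of the suffixes of the whole string. -/
theorem Refines.drop_lt {U : List ℕ} {i m : ℕ} {T c : ℕ → ℕ} (h : Refines U i m T c) {a b : ℕ}
    (ha : a ≤ m) (hb : b ≤ m) (hl : SLt T a b) : U.drop (i + a) < U.drop (i + b) := by
  have hlt := h.lt
  have hc : ∀ k ≤ m, k = m ∧ c k = 1 ∨ k < m ∧ (c k = 0 ∧ U.drop (i + k) < U.drop (i + m) ∨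
      c k = 2 ∧ U.drop (i + m) < U.drop (i + k)) := fun k hk => by
    rcases hk.lt_or_eq with h' | h'
    · exact .inr ⟨h', h.compare k h'⟩
    · exact .inl ⟨h', h' ▸ h.last⟩
  obtain ⟨l, h1, h2⟩ := hl
  induction l generalizing a b with
  | zero =>
    rw [add_zero, add_zero, h.eq a ha, h.eq b hb] at h2
    by_cases hu : U.getD (i + a) 0 = U.getD (i + b) 0
    · have hcc : c a < c b := by omega
      -- A smaller digit leaves three cases: 1 < 2, 0 < 1 and 0 < 2. In the first two the suffix at
      -- i + m is one of the pair, in the third it lies between them.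
      rcases hc a ha with ⟨a1, a2⟩ | ⟨a1, ⟨a2, a3⟩ | ⟨a2, a3⟩⟩ <;>
      rcases hc b hb with ⟨b1, b2⟩ | ⟨b1, ⟨b2, b3⟩ | ⟨b2, b3⟩⟩ <;> first | omega | skip
      · rw [a1]; exact b3
      · rw [b1]; exact a3
      · exact a3.trans b3
    · have := hc a ha
      have := hc b hb
      exact drop_lt_of_getD_lt (by omega) (by omega) (by omega)
  | succ l ih =>
    have hab : a ≠ b := by rintro rfl; exact lt_irrefl _ h2
    have h0 : T a = T b := h1 0 (by omega)
    -- Equal refined symbols have equal U-symbols and, by uniqueness of the last, successors still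
    -- in the window.
    have := h.uniqLast.succ_lt (d := 0) (show a < m + 1 by omega) (show b < m + 1 by omega) hab
      (by intro k hk; obtain rfl : k = 0 := by omega
          exact h0)
    rw [h.eq a ha, h.eq b hb] at h0
    have hca := hc a ha
    have hcb := hc b hb
    refine drop_lt_of_drop_succ_lt (by omega) (by omega) (by omega)
      (ih (a := a + 1) (b := b + 1) (by omega) (by omega) (fun k hk => ?_) ?_)
    · have := h1 (k + 1) (by omega)
      rwa [← add_assoc, ← add_assoc, add_right_comm, add_right_comm b] at this
    · rwa [← add_assoc, ← add_assoc, add_right_comm, add_right_comm b] at h2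

theorem Refines.isSortedSuffixes {U : List ℕ} {i m : ℕ} {T c sa : ℕ → ℕ} (h : Refines U i m T c)
    (hsa : IsSA T (m + 1) sa) :
    IsSortedSuffixes U i (i + m) ((List.range (m + 1)).map fun k => i + sa k) := by
  rw [IsSortedSuffixes, Nat.add_sub_cancel_left]
  constructor
  · rw [List.perm_ext_iff_of_nodup]
    · intro x
      simp only [List.mem_map, List.mem_range, List.mem_range'_1]
      constructor
      · rintro ⟨k, hk, rfl⟩
        have := hsa.lt k hk
        omega
      · intro hx
        obtain ⟨a, ha, ha'⟩ := hsa.exists_eq (show x - i < m + 1 by omega)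
        exact ⟨a, ha, by omega⟩
    · refine List.Nodup.map_on (fun x hx y hy hxy => ?_) List.nodup_range
      exact hsa.injOn (List.mem_range.1 hx) (List.mem_range.1 hy) (by omega)
    · exact List.nodup_range'
  · rw [List.pairwise_map]
    refine List.pairwise_lt_range.imp_of_mem fun {a b} ha hb hab => ?_
    rw [List.mem_range] at ha hb
    have h1 := hsa.lt a ha
    have h2 := hsa.lt b hb
    exact h.drop_lt (by omega) (by omega) (hsa.sorted a b hab hb)

/-- Compares the remapped suffixes at `reg 38` and `reg 1`; the result `0`, `1` or `2` is put in
`reg 39`. -/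
def compareSuffix : Prog :=
  .cond (V 38 ≡ₑ V 1) (39 ≔ C 1)
    ((30 ≔ emin (Rd 20 (V 38)) (Rd 20 (V 1)) + C 1 ⨾
      31 ≔ Rd 20 (V 38) + (Rd 20 (V 1) - Rd 20 (V 38))) ⨾
     rmqQuery ⨾
     .cond (V 1 + V 32 ≡ₑ V 2) (39 ≔ C 2)
      (.cond (Rd 1 (Rd 0 (V 38 + V 32)) ≺ₑ Rd 1 (Rd 0 (V 1 + V 32))) (39 ≔ C 0) (39 ≔ C 2)))

/-- Writes the refined window to array `3`, and its maximum to `reg 40`. -/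
def sortWindow : Prog :=
  (36 ≔ V 1 - V 0 + C 1 ⨾ 40 ≔ C 0) ⨾ forLt 37 36
    (38 ≔ V 0 + V 37 ⨾ compareSuffix ⨾
      (41 ≔ C 3 * Rd 1 (Rd 0 (V 38)) + V 39 ⨾ .store 3 (V 37) (V 41) ⨾ 40 ≔ V 40 + (V 41 - V 40)))

/-- Appends the pads. -/
def sortPad : Prog :=
  .store 3 (V 36) (C 0) ⨾ .store 3 (V 36 + C 1) (C 0) ⨾ 10 ≔ V 36 ⨾ 11 ≔ V 40 + C 1 ⨾ 12 ≔ C 0 ⨾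
  13 ≔ C 0

/-- Writes the answer. -/
def sortOutput : Prog := forLt 20 36 (.store 2 (V 20) (V 0 + Rd 7 (V 20)))

/-- The sorting program. -/
def sortRange : Prog := sortWindow ⨾ sortPad ⨾ suffixArray ⨾ sortOutput

/-- A request at the suffixes `i, …, i + m` as it is present in the store. -/
structure Request (W : ℕ) (S : List ℕ) (s : State) (i m : ℕ) (M : ℕ → ℕ) : Prop where
  ready : IsReady W S s
  fst : s.reg 0 = i
  snd : s.reg 1 = i + m
  lt : i + m < S.length
  table : ∀ k < S.length, s.mem 1 (S.getD k 0) = M (S.getD k 0)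
  injOn : Set.InjOn M {a | a ∈ S}
  bound : 8 * S.length + 20 < W

/-- A request reuses the scratch arrays of the suffix array construction, including array 3, but
writes none of the cells that `IsReady` mentions. Hence any number of requests can follow one
another. -/
theorem IsReady.of_frame {S : List ℕ} {s s' : State} (h : IsReady W S s) (hb : Bdd W s')
    (hf : Fr sortRange s s') : IsReady W S s' := by
  obtain ⟨-, h2, h0, ⟨B, nb, hr, hB⟩, h20, hi, hl⟩ := h
  refine ⟨hb, (hf.reg 2 rfl).trans h2, by rwa [hf.mem 0 rfl], ⟨B, nb, hr.congr (hf.reg 3 rfl)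
    (hf.reg 4 rfl) (hf.mem 21 rfl) (hf.mem 22 rfl) (hf.mem 23 rfl) (hf.mem 24 rfl) (hf.mem 25 rfl)
    (hf.mem 26 rfl), hB⟩, by rwa [hf.mem 20 rfl], by rwa [hf.mem 20 rfl], ?_⟩
  rw [hf.mem 20 rfl, hf.mem 21 rfl]
  exact hl

theorem Request.of_frame {S : List ℕ} {s s' : State} {i m : ℕ} {M : ℕ → ℕ} (h : Request W S s i m M)
    (hb : Bdd W s') (hf : Fr sortRange s s') : Request W S s' i m M :=
  ⟨h.ready.of_frame hb hf, (hf.reg 0 rfl).trans h.fst, (hf.reg 1 rfl).trans h.snd, h.lt,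
    by rw [hf.mem 1 rfl]; exact h.table, h.injOn, h.bound⟩

/-- One range minimum between the ranks in the original order gives the common prefix length; the
table M is consulted only at the two symbols behind it. -/
theorem compareSuffix_run {S : List ℕ} {s : State} {i m p : ℕ} {M : ℕ → ℕ}
    (h : Request W S s i m M) (h38 : s.reg 38 = p) (hp : p ≤ i + m) :
    ∃ s', Run W compareSuffix s 0 s' ∧ (p = i + m ∧ s'.reg 39 = 1 ∨ p < i + m ∧
      (s'.reg 39 = 0 ∧ (remap M S).drop p < (remap M S).drop (i + m) ∨
       s'.reg 39 = 2 ∧ (remap M S).drop (i + m) < (remap M S).drop p)) := by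
  have hb := h.ready.bdd
  have hW := h.bound
  have hlt := h.lt
  have h1 := h.snd
  by_cases hpj : p = i + m
  · refine ⟨_, .cond_true hb (by simp) (by simp [h38, h1, hpj])
      (run_den (p := 39 ≔ C 1) hb (by simp [Prog.Safe]; omega)), .inl ⟨hpj, by simp [Prog.den]⟩⟩
  obtain ⟨B, nb, hrmq, hB⟩ := h.ready.rmq
  have hp1 := h.ready.rank_lt p (by omega)
  have hj1 := h.ready.rank_lt (i + m) (by omega)
  have hne : s.mem 20 p ≠ s.mem 20 (i + m) := fun hc =>
    hpj (h.ready.rank_inj p (by omega) _ (by omega) hc)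
  have r₁ := run_den (p := (30 ≔ emin (Rd 20 (V 38)) (Rd 20 (V 1)) + C 1 ⨾
      31 ≔ Rd 20 (V 38) + (Rd 20 (V 1) - Rd 20 (V 38)))) hb
    (by simp only [Prog.Safe, safe_add, safe_emin, safe_Rd, safe_V, safe_C, val_emin, val_Rd, val_V,
          val_C, Prog.den, setReg_reg, setReg_mem, safe_sub, val_sub, h38, h1, true_and,
          Nat.reduceEqDiff, if_false]
        omega)
  have b₁ := r₁.bdd hb
  simp only [Prog.den, val_emin, val_Rd, val_V, val_C, val_add, val_sub, setReg_reg, setReg_mem, h38,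
    h1, Nat.reduceEqDiff, if_false] at r₁ b₁
  set s₁ := (s.setReg 30 (min (s.mem 20 p) (s.mem 20 (i + m)) + 1)).setReg 31
    (s.mem 20 p + (s.mem 20 (i + m) - s.mem 20 p)) with hs₁
  obtain ⟨s₂, r₂, hmin⟩ := rmqQuery_run b₁ (hrmq.congr (by simp [hs₁]) (by simp [hs₁]) rfl rfl rfl
    rfl rfl rfl) (l := min (s.mem 20 p) (s.mem 20 (i + m)) + 1)
    (r := s.mem 20 p + (s.mem 20 (i + m) - s.mem 20 p)) (by simp [hs₁]) (by simp [hs₁]) (by omega)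
    (by omega)
  have b₂ := r₂.bdd b₁
  have f₂ := (r₁.seq r₂).frame
  rw [show s₁.mem 21 = s.mem 21 from rfl] at hmin
  set L := s₂.reg 32 with hL
  have hlce : Lce (text S) p (i + m) L := by
    rcases Nat.lt_or_gt_of_ne hne with c | c
    -- By truncated subtraction, p's rank plus the difference is the larger rank, so the query runs
    -- from the smaller rank plus 1 to the larger one.
    · refine h.ready.lce p (by omega) _ (by omega) c L ?_
      rwa [min_eq_left c.le, Nat.add_sub_cancel' c.le] at hmin
    · refine (h.ready.lce (i + m) (by omega) p (by omega) c L ?_).symm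
      rwa [min_eq_right c.le, Nat.sub_eq_zero_of_le c.le, add_zero] at hmin
  obtain ⟨q1, q2, q3⟩ := remap_compare h.injOn hlce (by omega) (by omega)
  have e1 : s₂.reg 1 = i + m := (f₂.reg 1 rfl).trans h1
  have e2 : s₂.reg 2 = S.length := (f₂.reg 2 rfl).trans h.ready.len
  have e38 : s₂.reg 38 = p := (f₂.reg 38 rfl).trans h38
  have m0 : ∀ k < S.length, s₂.mem 0 k = S.getD k 0 := by rw [f₂.mem 0 rfl]; exact h.ready.str
  have m1 : ∀ k < S.length, s₂.mem 1 (S.getD k 0) = M (S.getD k 0) := by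
    rw [f₂.mem 1 rfl]; exact h.table
  have hpre : (V 38 ≡ₑ V 1).val s = 0 := by simp [h38, h1, hpj]
  by_cases hend : i + m + L = S.length
  · refine ⟨_, .cond_false hb (by simp) hpre (r₁.seq (r₂.seq (.cond_true b₂
      (by simp [e1, ← hL]; omega) (by simp [e1, e2, ← hL, hend])
      (run_den (p := 39 ≔ C 2) b₂ (by simp [Prog.Safe]; omega))))),
      .inr ⟨by omega, .inr ⟨by simp [Prog.den], q2 hend⟩⟩⟩
  have q3 := q3 hend
  have hs : (V 1 + V 32 ≡ₑ V 2).Safe W s₂ := by simp [e1, ← hL]; omega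
  have hv : (V 1 + V 32 ≡ₑ V 2).val s₂ = 0 := by simp [e1, e2, ← hL, hend]
  have hs' : (Rd 1 (Rd 0 (V 38 + V 32)) ≺ₑ Rd 1 (Rd 0 (V 1 + V 32))).Safe W s₂ := by
    simp [e1, e38, ← hL]; omega
  by_cases hcmp : M (S.getD (p + L) 0) < M (S.getD (i + m + L) 0)
  · refine ⟨_, .cond_false hb (by simp) hpre (r₁.seq (r₂.seq (.cond_false b₂ hs hv
      (.cond_true b₂ hs' ?_ (run_den (p := 39 ≔ C 0) b₂ (by simp [Prog.Safe]; omega)))))),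
      .inr ⟨by omega, .inl ⟨by simp [Prog.den], q3.1 hcmp⟩⟩⟩
    simp only [val_less, val_Rd, val_add, val_V, e1, e38, ← hL]
    rw [m0 _ (by omega), m0 _ (by omega), m1 _ (by omega), m1 _ (by omega), if_pos hcmp]
    exact one_ne_zero
  · refine ⟨_, .cond_false hb (by simp) hpre (r₁.seq (r₂.seq (.cond_false b₂ hs hv
      (.cond_false b₂ hs' ?_ (run_den (p := 39 ≔ C 2) b₂ (by simp [Prog.Safe]; omega)))))),
      .inr ⟨by omega, .inr ⟨by simp [Prog.den], q3.2 hcmp⟩⟩⟩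
    simp only [val_less, val_Rd, val_add, val_V, e1, e38, ← hL]
    rw [m0 _ (by omega), m0 _ (by omega), m1 _ (by omega), m1 _ (by omega), if_neg hcmp]

theorem sortWindow_run {S : List ℕ} {s : State} {i m D : ℕ} {M : ℕ → ℕ} (h : Request W S s i m M)
    (hM : ∀ p, i ≤ p → p ≤ i + m → M (S.getD p 0) < D) (hD : 3 * D < W) :
    ∃ s' c, Run W sortWindow s (m + 1) s' ∧ s'.reg 36 = m + 1 ∧ s'.reg 40 < 3 * D ∧
      (∀ k ≤ m, s'.mem 3 k ≤ s'.reg 40) ∧ Refines (remap M S) i m (s'.mem 3) c := by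
  have hb := h.ready.bdd
  have hW := h.bound
  have hlt := h.lt
  have hlen : (remap M S).length = S.length := by simp [remap]
  have hD0 := hM i (by omega) (by omega)
  have r₁ := run_den (p := (36 ≔ V 1 - V 0 + C 1 ⨾ 40 ≔ C 0)) hb
    (by simp [Prog.Safe, h.fst, h.snd]; omega)
  have b₁ := r₁.bdd hb
  simp only [Prog.den, val_sub, val_add, val_V, val_C, h.fst, h.snd, Nat.add_sub_cancel_left]
    at r₁ b₁
  set U := remap M S with hU
  obtain ⟨s', hr, ⟨hval, hcmp, h40, hle⟩, -⟩ := run_for b₁ (x := 37) (y := 36)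
    (body := (38 ≔ V 0 + V 37 ⨾ compareSuffix ⨾
      (41 ≔ C 3 * Rd 1 (Rd 0 (V 38)) + V 39 ⨾ .store 3 (V 37) (V 41) ⨾
        40 ≔ V 40 + (V 41 - V 40)))) rfl rfl (N := m + 1) (by simp)
    -- The digits are not stored; they are recovered as differences, and the first clause says that
    -- the truncated subtraction is exact.
    (fun k s' => (∀ a < k, s'.mem 3 a = 3 * U.getD (i + a) 0 +
        (s'.mem 3 a - 3 * U.getD (i + a) 0)) ∧
      (∀ a < k, a = m ∧ s'.mem 3 a - 3 * U.getD (i + a) 0 = 1 ∨ a < m ∧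
        (s'.mem 3 a - 3 * U.getD (i + a) 0 = 0 ∧ U.drop (i + a) < U.drop (i + m) ∨
         s'.mem 3 a - 3 * U.getD (i + a) 0 = 2 ∧ U.drop (i + m) < U.drop (i + a))) ∧
      s'.reg 40 < 3 * D ∧ ∀ a < k, s'.mem 3 a ≤ s'.reg 40)
    (fun _ => 0) 0 (by simp; omega)
    (by
      rintro k hk s' hb' hf hk' ⟨hval, hcmp, h40, hle⟩
      have hf' : Fr sortRange s s' := (r₁.frame.mono (by
          simp +contextual [sortRange, sortWindow, Prog.wr]) (by simp [Prog.wm])).trans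
        (hf.mono (by simp +contextual [sortRange, sortWindow, Prog.wr])
          (by simp +contextual [sortRange, sortWindow, Prog.wm]))
      have h' := h.of_frame hb' hf'
      have r₂ := run_den (p := 38 ≔ V 0 + V 37) hb' (by simp [Prog.Safe, h'.fst, hk']; omega)
      have b₂ := r₂.bdd hb'
      simp only [Prog.den, val_add, val_V, h'.fst, hk'] at r₂ b₂
      have h'' := h'.of_frame b₂ (r₂.frame.mono (by
          simp +contextual [sortRange, sortWindow, Prog.wr, forLt]) (by simp [Prog.wm]))
      obtain ⟨s₃, r₃, hc⟩ := compareSuffix_run h'' (p := i + k) (by simp) (by omega)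
      have b₃ := r₃.bdd b₂
      have f₃ := (r₂.seq r₃).frame
      have e38 : s₃.reg 38 = i + k := (r₃.frame.reg 38 rfl).trans (by simp)
      have e37 : s₃.reg 37 = k := (f₃.reg 37 rfl).trans hk'
      have e40 : s₃.reg 40 = s'.reg 40 := f₃.reg 40 rfl
      have m3 : s₃.mem 3 = s'.mem 3 := f₃.mem 3 rfl
      have hMk := hM (i + k) (by omega) (by omega)
      have hUk : U.getD (i + k) 0 = M (S.getD (i + k) 0) := remap_getD (by omega)
      have e01 : s₃.mem 1 (s₃.mem 0 (i + k)) = U.getD (i + k) 0 := by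
        rw [f₃.mem 0 rfl, f₃.mem 1 rfl, h'.ready.str _ (by omega), h'.table _ (by omega), hUk]
      have hc2 : s₃.reg 39 ≤ 2 := by omega
      have r₄ := run_den (p := (41 ≔ C 3 * Rd 1 (Rd 0 (V 38)) + V 39 ⨾ .store 3 (V 37) (V 41) ⨾
        40 ≔ V 40 + (V 41 - V 40))) b₃ (by
          simp only [Prog.Safe, Prog.den, safe_add, safe_mul, safe_sub, safe_C, safe_V, safe_Rd,
            val_add, val_mul, val_sub, val_C, val_V, val_Rd, setReg_reg, setMem_reg,
            e38, e37, e40, e01, true_and, Nat.reduceEqDiff, if_true, if_false]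
          omega)
      refine ⟨_, _, r₂.seq (r₃.seq r₄), ?_, by simp⟩
      simp only [Prog.den, val_add, val_mul, val_sub, val_C, val_V, val_Rd, setReg_reg, setMem_reg,
        setReg_mem, setMem_mem, e38, e37, e40, e01, m3, Nat.reduceEqDiff, if_true, if_false,
        Function.update_apply]
      refine ⟨fun a ha => ?_, fun a ha => ?_, by omega, fun a ha => ?_⟩
      · split_ifs with hak
        · subst hak; omega
        · exact hval a (by omega)
      · split_ifs with hak
        · subst hak
          rw [Nat.add_sub_cancel_left]
          rcases hc with hc | hc
          · exact .inl ⟨by omega, hc.2⟩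
          · exact .inr ⟨by omega, hc.2⟩
        · exact hcmp a (by omega)
      · split_ifs with hak
        · omega
        · have := hle a (by omega)
          omega)
  refine ⟨s', fun k => s'.mem 3 k - 3 * U.getD (i + k) 0, (r₁.seq hr).mono (by simp),
    (hr.frame.reg 36 rfl).trans (by simp), h40, fun k hk => hle k (by omega),
    ⟨by omega, fun k hk => hval k (by omega), ?_, fun k hk => ?_⟩⟩
  · have := hcmp m (by omega)
    omega
  · rcases hcmp k (by omega) with ⟨h1, -⟩ | ⟨-, h2⟩
    · omega
    · exact h2

/-- The program does not know the bound D: it uses the measured maximum of the refined window plus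
1, at most 3D, as alphabet size. This gives 8 * 3D for the alphabet, and 80 + 1 + 1 per position for
sorting, window and output. -/
theorem sortRange_run {S : List ℕ} {s : State} {i m D : ℕ} {M : ℕ → ℕ} (h : Request W S s i m M)
    (hM : ∀ p, i ≤ p → p ≤ i + m → M (S.getD p 0) < D) (hD : 3 * D < W) :
    ∃ s', Run W sortRange s (24 * D + 82 * (m + 1)) s' ∧
      IsSortedSuffixes (remap M S) i (i + m) (output s' (m + 1)) ∧ IsReady W S s' := by
  have hb := h.ready.bdd
  have hW := h.bound
  have hlt := h.lt
  obtain ⟨s₁, c, r₁, e36, h40, hle, href⟩ := sortWindow_run h hM hD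
  have b₁ := r₁.bdd hb
  have r₂ := run_den (p := sortPad) b₁ (by simp [sortPad, Prog.Safe, Prog.den, e36]; omega)
  have b₂ := r₂.bdd b₁
  simp only [sortPad, Prog.den, val_add, val_V, val_C, setReg_reg, setMem_reg, e36,
    Nat.reduceEqDiff, if_false] at r₂ b₂
  set s₂ := ((((((s₁.setMem 3 (m + 1) 0).setMem 3 (m + 1 + 1) 0).setReg 10 (m + 1)).setReg 11
    (s₁.reg 40 + 1)).setReg 12 0).setReg 13 0) with hs₂
  have hX : ∀ k < m + 1, s₁.mem 3 k = s₂.mem 3 k := fun k hk => by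
    simp [hs₂, Function.update_apply, if_neg (show k ≠ m + 1 by omega),
      if_neg (show k ≠ m + 1 + 1 by omega)]
  have hl : IsLevel W s₂ 0 (m + 1) (s₁.reg 40 + 1) 0 := by
    refine ⟨by simp [hs₂], by simp [hs₂], by simp [hs₂], by simp [hs₂], ?_, ?_, by omega,
      by omega⟩
    · exact href.uniqLast.congr fun k hk => by rw [hX k hk, zero_add]
    · intro k hk
      rw [zero_add]
      rcases Nat.lt_or_ge k (m + 1) with c | c
      · rw [← hX k c]
        have := hle k (by omega)
        omega
      · rcases (by omega : k = m + 1 ∨ k = m + 1 + 1) with rfl | rfl <;>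
          simp [hs₂]
  obtain ⟨s₃, r₃, hsa, -⟩ := suffixArray_run b₂ hl
  have hsa := hsa.congr (href.uniqLast.congr hX) (fun k hk => (hX k hk).symm)
  have b₃ := r₃.bdd b₂
  have f₃ := (r₁.seq (r₂.seq r₃)).frame
  have e0 : s₃.reg 0 = i := (f₃.reg 0 rfl).trans h.fst
  have e36₃ : s₃.reg 36 = m + 1 := (r₃.frame.reg 36 rfl).trans (by simp [hs₂, e36])
  obtain ⟨s₄, r₄, hout, -⟩ := run_for_straight (x := 20) (y := 36)
    (body := .store 2 (V 20) (V 0 + Rd 7 (V 20))) b₃ rfl rfl e36₃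
    (fun k s' => ∀ a < k, s'.mem 2 a = i + s₃.mem 7 a) (by simp)
    (by
      intro k hk s' hb' hf hk' hI
      have f0 : s'.reg 0 = i := (hf.reg 0 rfl).trans e0
      have f7 := hf.mem 7 rfl
      have := hsa.lt k hk
      refine ⟨by simp [Prog.Safe, hk', f0, f7]; omega, fun a ha => ?_⟩
      simp [Prog.den, hk', f0, f7, Function.update_apply]
      split_ifs with hak
      · rw [hak]
      · exact hI a (by omega))
  have hrun := r₁.seq (r₂.seq (r₃.seq r₄))
  refine ⟨s₄, hrun.mono (by omega), ?_, h.ready.of_frame (r₄.bdd b₃) hrun.frame⟩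
  have : output s₄ (m + 1) = (List.range (m + 1)).map fun k => i + s₃.mem 7 k := by
    rw [output]
    exact List.map_congr_left fun k hk => hout k (List.mem_range.1 hk)
  rw [this]
  exact href.isSortedSuffixes hsa

theorem Request.of_admissible {C σ i j : ℕ} {S : List ℕ} {M : ℕ → ℕ} {s : State}
    (hs : IsReady W S s) (hσ : ∀ a ∈ S, a < σ) (hW : 8 * S.length + 20 < W)
    (h : Admissible W C σ S i j M) : Request W S (requestState s σ i j M) i (j - i) M := by
  have hb : Bdd W (requestState s σ i j M) := by
    refine ⟨hs.bdd.one_lt, fun x => ?_, fun a k => ?_⟩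
    · have := h.le
      have := h.lt_length
      simp only [requestState]
      split_ifs
      · omega
      · omega
      · exact hs.bdd.reg x
    · simp only [requestState]
      split_ifs with hc
      · exact h.entry_lt k hc.2
      · exact hs.bdd.mem a k
  have hmem : ∀ a, a ≠ 1 → (requestState s σ i j M).mem a = s.mem a := fun a ha => by
    funext k
    simp [requestState, ha]
  obtain ⟨B, nb, hr, hB⟩ := hs.rmq
  have hle := h.le
  refine ⟨⟨hb, by simpa [requestState] using hs.len, ?_, ⟨B, nb, hr.congr (by simp [requestState])
    (by simp [requestState]) (hmem 21 (by omega)) (hmem 22 (by omega)) (hmem 23 (by omega))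
    (hmem 24 (by omega)) (hmem 25 (by omega)) (hmem 26 (by omega)), hB⟩, ?_, ?_, ?_⟩,
    by simp [requestState], by simp [requestState]; omega, by have := h.lt_length; omega,
    fun k hk => ?_, h.injOn, hW⟩
  · rw [hmem 0 (by omega)]; exact hs.str
  · rw [hmem 20 (by omega)]; exact hs.rank_lt
  · rw [hmem 20 (by omega)]; exact hs.rank_inj
  · rw [hmem 20 (by omega), hmem 21 (by omega)]; exact hs.lce
  · have : S.getD k 0 ∈ S := by
      rw [List.getD_eq_getElem _ _ hk]; exact List.getElem_mem hk
    have := hσ _ this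
    simp only [requestState]
    rw [if_pos ⟨trivial, this⟩]

/-- A word length of c + 1 times the bit length of n leaves room for the factor c < 2^c. -/
theorem mul_lt_two_pow {c n w : ℕ} (h : (c + 1) * (Nat.log 2 n + 1) ≤ w) :
    c * (n + 1) < 2 ^ w := by
  have h1 : n < 2 ^ (Nat.log 2 n + 1) := Nat.lt_pow_succ_log_self (by omega) n
  calc c * (n + 1) ≤ c * 2 ^ (Nat.log 2 n + 1) := Nat.mul_le_mul_left _ h1
    _ < 2 ^ c * 2 ^ (Nat.log 2 n + 1) := Nat.mul_lt_mul_of_pos_right Nat.lt_two_pow_self (by positivity)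
    _ ≤ 2 ^ (c * (Nat.log 2 n + 1)) * 2 ^ (Nat.log 2 n + 1) :=
      Nat.mul_le_mul_right _ (Nat.pow_le_pow_right (by omega) (Nat.le_mul_of_pos_right _ (by omega)))
    _ = 2 ^ ((c + 1) * (Nat.log 2 n + 1)) := by rw [← pow_add]; congr 1; ring
    _ ≤ 2 ^ w := Nat.pow_le_pow_right (by omega) h

end SuffixSorting

/-! ### The main theorem: choice of the constants -/

theorem mainTheorem6 :
    ∃ (pre sort : WordRAM.Prog) (K₀ : ℕ), ∀ C : ℕ, ∃ c K : ℕ,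
      ∀ (S : List ℕ) (σ w : ℕ), (∀ a ∈ S, a < σ) →
        c * (Nat.log 2 (S.length + σ) + 1) ≤ w →
        ∃ Ready : Set WordRAM.State,
          (∃ t s, WordRAM.Exec (2 ^ w) pre (SuffixSorting.inputState S σ) t s ∧
            t ≤ K₀ * (S.length + σ + 1) ∧ s ∈ Ready) ∧
          ∀ s ∈ Ready, ∀ (i j : ℕ) (M : ℕ → ℕ),
            SuffixSorting.Admissible (2 ^ w) C σ S i j M →
            ∃ t s', WordRAM.Exec (2 ^ w) sort (SuffixSorting.requestState s σ i j M) t s' ∧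
              t ≤ K * (j - i + 1) ∧
              SuffixSorting.IsSortedSuffixes (SuffixSorting.remap M S) i j
                (SuffixSorting.output s' (j - i + 1)) ∧
              s' ∈ Ready := by
  -- Programs and K₀ are fixed before C. The factor 140 covers 8(σ + 1) + 130(n + 1) + 1, and 24C +
  -- 83 covers 24D + 82(m + 1) + 1 with D = C(m + 1). The word-length constant comes from
  -- `mul_lt_two_pow` with factor 3C + 30, enough both for addresses (30) and for the refined
  -- symbols (3C).
  refine ⟨SuffixSorting.preprocess, SuffixSorting.sortRange,
    SuffixSorting.preprocess.kappa * 140, fun C => ⟨3 * C + 30 + 1,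
    SuffixSorting.sortRange.kappa * (24 * C + 83), fun S σ w hσ hw => ?_⟩⟩
  have hW := SuffixSorting.mul_lt_two_pow hw
  have hW₁ : 30 * (S.length + σ + 1) < 2 ^ w := by nlinarith
  have hW₂ : 3 * (C * (S.length + σ + 1)) < 2 ^ w := by nlinarith
  clear hW
  refine ⟨{s | SuffixSorting.IsReady (2 ^ w) S s}, ?_, ?_⟩
  · have hb : WordRAM.Bdd (2 ^ w) (SuffixSorting.inputState S σ) := by
      refine ⟨by omega, fun x => ?_, fun a k => ?_⟩
      · simp only [SuffixSorting.inputState]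
        split_ifs <;> omega
      · simp only [SuffixSorting.inputState]
        split_ifs
        · rcases Nat.lt_or_ge k S.length with c | c
          · have : S.getD k 0 ∈ S := by
              rw [List.getD_eq_getElem _ _ c]; exact List.getElem_mem c
            have := hσ _ this
            omega
          · rw [List.getD_eq_default _ _ c]; omega
        · omega
    obtain ⟨s, ⟨t, ht, htt⟩, hs⟩ := SuffixSorting.preprocess_run hb hσ (by omega) (by omega)
      (by simp [SuffixSorting.inputState]) (by simp [SuffixSorting.inputState])
      (by simp [SuffixSorting.inputState])
    refine ⟨t, s, ht, htt.trans ?_, hs⟩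
    rw [mul_assoc]
    exact Nat.mul_le_mul_left _ (by omega)
  · intro s hs i j M hM
    have hle := hM.le
    have hlt := hM.lt_length
    have hreq := SuffixSorting.Request.of_admissible hs hσ (by omega) hM
    have hCm : C * (j - i + 1) ≤ C * (S.length + σ + 1) := Nat.mul_le_mul_left _ (by omega)
    have hij : i + (j - i) = j := by omega
    obtain ⟨s', ⟨t, ht, htt⟩, hsort, hready⟩ := SuffixSorting.sortRange_run hreq
      (fun p h1 h2 => hM.small p h1 (by omega)) (by omega)
    rw [hij] at hsort
    refine ⟨t, s', ht, htt.trans ?_, hsort, hready⟩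
    rw [mul_assoc]
    refine Nat.mul_le_mul_left _ ?_
    have : (24 * C + 83) * (j - i + 1) = 24 * (C * (j - i + 1)) + 83 * (j - i + 1) := by ring
    omega
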